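/- **Setting.** Let $\Sigma$ be a compact connected oriented surface with non-empty boundary, $\mathcal M\subset\partial\Sigma$ a finite set of marked points meeting every boundary component, and $\mathcal P$ a finite set of interior points (punctures). Let $\tau$ be an ideal triangulation of $(\Sigma,\mathcal M,\mathcal P)$, i.e. a presentation of $\Sigma$ as finitely many triangles glued along pairs of sides, with vertex set $\mathcal M\cup\mathcal P$ and whose unglued sides form $\partial\Sigma$, such that every puncture $P$ is enclosed by a self-folded triangle $T_P$ (two sides of $T_P$ are glued to each other and $P$ is their common vertex). The orbifold fundamental groupoid $\pi_1^{\rm orb}(\Sigma)$, with objects the points of $\Sigma\setminus\mathcal P$, is the quotient of the fundamental groupoid of $\Sigma\setminus\mathcal P$ by the congruence identifying each loop that goes once around a puncture, in a disc containing no other puncture, with its inverse. Composition is written from right to left. For $x_0\in\Sigma\setminus\mathcal P$, write $\pi_1^{\rm orb}(\Sigma,x_0)$ for the group of endomorphisms of $x_0$, and $\pi_1^{\rm orb,free}(\Sigma)$ for the set of classes $[\gamma]$ of loops (at arbitrary base points) up to conjugation by morphisms of the groupoid. An element of a group is *primitive* if it has infinite order and generates the largest cyclic subgroup containing it. For $P\in\mathcal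 P$ let $P'$ be the barycentre of $T_P$, let $e_P$ be the class of the loop at $P'$ in $T_P$ that goes once around $P$, crossing once the arc obtained from the two glued sides of $T_P$, and let $\mathcal P'=\{P' : P\in\mathcal P\}$. Fix $x_0\in\Sigma\setminus\mathcal P$ and, for each $P$, a morphism $w_P\colon P'\to x_0$ of $\pi_1^{\rm orb}(\Sigma)$, and put $s_P=w_Pe_Pw_P^{-1}\in\pi_1^{\rm orb}(\Sigma,x_0)$. Let $\pi_1^{\rm orb}(\Sigma,\mathcal P')$ be the set of morphisms between points of $\mathcal P'$. **Statement.** 1. Let $\gamma\in\pi_1^{\rm orb}(\Sigma,x_0)$ be primitive with $[\gamma]=[\gamma^{-1}]$. Then there are $P,Q\in\mathcal P$ and $v\in\pi_1^{\rm orb}(\Sigma,x_0)$ with $[\gamma]=[s_Pvs_Qv^{-1}]$. Moreover, the triples $(P,Q,v)$ with this property form exactly one class of the equivalence relation generated by $(P,Q,v)\sim(Q,P,s_Q^{\epsilon'}v^{-1}s_P^{\epsilon})$, $\epsilon,\epsilon'\in\{0,1\}$. 2. Let $\mathcal R$ be the set of classes $[\gamma]\in\pi_1^{\rm orb,free}(\Sigma)$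 with $\gamma$ primitive and $[\gamma]=[\gamma^{-1}]$. There is an injective map $$\mathcal R\times(\mathbb Z/2\mathbb Z)^2\longrightarrow\big\{\{w,w^{-1}\}\subset\pi_1^{\rm orb}(\Sigma,\mathcal P')\ :\ w^2\neq1\big\},$$ where $w^2\ne 1$ means that it is not the case that $w$ is a loop with $w^2=1$. More precisely, one can choose for each class $c\in\mathcal R$ a triple $(P,Q,v)$ with $c=[s_Pvs_Qv^{-1}]$, and for every such choice the assignment $$(c,\epsilon_1,\epsilon_2)\longmapsto\{w,w^{-1}\},\qquad w=e_P^{\epsilon_1}w_P^{-1}\,v\,w_Q\,e_Q^{\epsilon_2}\colon Q'\to P',$$ is well defined and injective. -/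

import Mathlib

open CategoryTheory

noncomputable section

namespace OrbSurface

universe u

/-- A (possibly punctured) marked surface: on a surface with boundary `S`, the finite set of marked
points on the boundary, which meets every boundary component, and the finite set of punctures in
the interior. The boundary is required to be non-empty. -/
structure MarkedSurface (S : Type u) [TopologicalSpace S]
    [ChartedSpace (EuclideanHalfSpace 2) S] where
  marked : Set S
  punctures : Set S
  marked_finite : marked.Finite
  punctures_finite : punctures.Finite
  boundary_nonempty : ((modelWithCornersEuclideanHalfSpace 2).boundary S).Nonempty
  marked_subset : marked ⊆ (modelWithCornersEuclideanHalfSpace 2).boundary S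
  marked_meets : ∀ x ∈ (modelWithCornersEuclideanHalfSpace 2).boundary S,
    ∃ m ∈ marked, m ∈ connectedComponentIn ((modelWithCornersEuclideanHalfSpace 2).boundary S) x
  punctures_subset : punctures ⊆ (modelWithCornersEuclideanHalfSpace 2).interior S

/-! ### Triangulations -/

/-- The closed triangle, in barycentric coordinates. Its vertices are `0, 1, 2`, in the
positive cyclic order; its side `i` runs from vertex `i` to vertex `i + 1`, and is the locus where
the coordinate `i + 2` vanishes. -/
abbrev Triangle : Type := stdSimplex ℝ (Fin 3)

/-- The elementary identifications when the side `s` is glued to the side `mate s`, for every side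
`s` with `mate s ≠ s`. The gluing of the side `(T, i)` to the side `(T', j)` is affine and
reverses the direction: vertex `i` of `T` goes to vertex `j + 1` of `T'`, and vertex `i + 1` of
`T` goes to vertex `j` of `T'`. -/
def Glue {n : ℕ} (mate : Fin n × Fin 3 → Fin n × Fin 3) (a b : Fin n × Triangle) : Prop :=
  ∃ i j : Fin 3, mate (a.1, i) = (b.1, j) ∧ (a.1, i) ≠ (b.1, j) ∧
    a.2 (i + 2) = 0 ∧ b.2 (j + 2) = 0 ∧ b.2 (j + 1) = a.2 i ∧ b.2 j = a.2 (i + 1)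

/-- An ideal triangulation of a marked surface. The surface is obtained from finitely many oriented
triangles by gluing pairs of distinct sides (the arcs of the triangulation), possibly two
sides of the same triangle, in a way that respects the orientations. The sides that are not glued
(those with `mate s = s`) are the boundary segments. The vertices are the marked points and the
punctures. -/
structure IdealTriangulation {S : Type u} [TopologicalSpace S]
    [ChartedSpace (EuclideanHalfSpace 2) S] (X : MarkedSurface S) where
  n : ℕ
  mate : Fin n × Fin 3 → Fin n × Fin 3
  mate_mate : ∀ s, mate (mate s) = s
  chi : Fin n → C(Triangle, S)
  chi_surjective : ∀ x, ∃ T p, chi T p = x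
  chi_eq_iff : ∀ T p T' p', chi T p = chi T' p' ↔ Relation.EqvGen (Glue mate) (T, p) (T', p')
  boundary_eq : (modelWithCornersEuclideanHalfSpace 2).boundary S =
    {x | ∃ s : Fin n × Fin 3, mate s = s ∧ ∃ p : Triangle, p (s.2 + 2) = 0 ∧ chi s.1 p = x}
  vertices_eq : {x | ∃ T, ∃ k : Fin 3, chi T (stdSimplex.vertex k) = x} =
    X.marked ∪ X.punctures

/-- An ideal triangulation in which every puncture `P` is enclosed by a self-folded triangle `T_P`.
Here `corner P = (T_P, i)` means that the sides `i` and `i + 1` of the triangle `T_P` are glued to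
each other and that their common vertex `i + 1` is `P`. (The corner is unique.) -/
structure FoldedTriangulation {S : Type u} [TopologicalSpace S]
    [ChartedSpace (EuclideanHalfSpace 2) S] (X : MarkedSurface S) extends
    IdealTriangulation X where
  corner : X.punctures → Fin n × Fin 3
  mate_corner : ∀ P, mate (corner P) = ((corner P).1, (corner P).2 + 1)
  chi_corner : ∀ P : X.punctures, chi (corner P).1 (stdSimplex.vertex ((corner P).2 + 1)) = P

/-! ### The orbifold fundamental groupoid -/

section Orbifold

variable {S : Type u} [TopologicalSpace S] [ChartedSpace (EuclideanHalfSpace 2) S]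

/-- The surface with its punctures removed. -/
abbrev MarkedSurface.Punctured (X : MarkedSurface S) : Type u := {x : S // x ∉ X.punctures}

/-- An open disc on the surface, with a chosen parametrization by the plane, whose centre is a
puncture and which contains no other puncture. -/
structure PuncturedDisc (X : MarkedSurface S) where
  phi : ℂ → S
  isOpenEmbedding : Topology.IsOpenEmbedding phi
  center_mem : phi 0 ∈ X.punctures
  eq_zero_of_mem : ∀ z, phi z ∈ X.punctures → z = 0

/-- The point `z ≠ 0` of a punctured disc. -/
def PuncturedDisc.point {X : MarkedSurface S} (D : PuncturedDisc X) (z : ℂ) (hz : z ≠ 0) :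
    X.Punctured :=
  ⟨D.phi z, fun h => hz (D.eq_zero_of_mem z h)⟩

/-- The loop `t ↦ exp (2 π i t)` of a punctured disc, which goes once around the puncture. -/
def PuncturedDisc.loop {X : MarkedSurface S} (D : PuncturedDisc X) :
    Path (D.point 1 one_ne_zero) (D.point 1 one_ne_zero) where
  toFun t := D.point (Complex.exp (2 * Real.pi * Complex.I * (t : ℝ))) (Complex.exp_ne_zero _)
  continuous_toFun := by
    refine Continuous.subtype_mk ?_ _
    exact D.isOpenEmbedding.continuous.comp (by fun_prop)
  source' := by simp [PuncturedDisc.point]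
  target' := by simp [PuncturedDisc.point, Complex.exp_two_pi_mul_I]

/-- The defining relation of the orbifold fundamental groupoid: a loop going once around a puncture
`P` is identified with the loop going once around `P` in the opposite direction. -/
inductive PunctureRel (X : MarkedSurface S) :
    ∀ ⦃x y : FundamentalGroupoid X.Punctured⦄, (x ⟶ y) → (x ⟶ y) → Prop
  | loop (D : PuncturedDisc X) :
      PunctureRel X (FundamentalGroupoid.fromPath (Path.Homotopic.Quotient.mk D.loop))
        (FundamentalGroupoid.fromPath (Path.Homotopic.Quotient.mk D.loop.symm))

/-- `PunctureRel` as a relation on every hom-set of the fundamental groupoid. -/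
def punctureHomRel (X : MarkedSurface S) : HomRel (FundamentalGroupoid X.Punctured) :=
  PunctureRel X

/-- The orbifold fundamental groupoid of a surface: the quotient of the fundamental groupoid of the
complement of the punctures by the congruence generated by `PunctureRel`. -/
abbrev Orb (X : MarkedSurface S) : Type u := CategoryTheory.Quotient (punctureHomRel X)

/-- A point of the complement of the punctures, as an object of the orbifold groupoid. -/
def orbPt (X : MarkedSurface S) (x : X.Punctured) : Orb X :=
  (CategoryTheory.Quotient.functor (punctureHomRel X)).obj (FundamentalGroupoid.mk x)

/-- The class of a path in the orbifold fundamental groupoid. -/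
def orbPath (X : MarkedSurface S) {x y : X.Punctured} (p : Path x y) : orbPt X x ⟶ orbPt X y :=
  (CategoryTheory.Quotient.functor (punctureHomRel X)).map
    (FundamentalGroupoid.fromPath (Path.Homotopic.Quotient.mk p))

/-- The orbifold fundamental group at `x`. The product `α * β` is "first `β`, then `α`". -/
abbrev OrbGroup (X : MarkedSurface S) (x : X.Punctured) : Type u := End (orbPt X x)

end Orbifold

/-! ### Conjugacy classes in a groupoid, primitive elements -/

/-- Two loops (possibly at different objects) of a groupoid are freely conjugate if some morphism
conjugates one into the other. -/
def freeSetoid (G : Type*) [Groupoid G] : Setoid (Σ x : G, End x) where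
  r a b := ∃ f : a.1 ⟶ b.1, End.asHom a.2 ≫ f = f ≫ End.asHom b.2
  iseqv :=
    { refl := fun a => ⟨𝟙 a.1, by simp⟩
      symm := by
        rintro a b ⟨f, hf⟩
        refine ⟨Groupoid.inv f, ?_⟩
        rw [← cancel_epi f, ← cancel_mono f]
        simp [hf]
      trans := by
        rintro a b c ⟨f, hf⟩ ⟨g, hg⟩
        refine ⟨f ≫ g, ?_⟩
        rw [← Category.assoc, hf, Category.assoc, hg, Category.assoc] }

/-- The free conjugacy classes `G^free` of a groupoid. -/
def FreeClass (G : Type*) [Groupoid G] : Type _ := _root_.Quotient (freeSetoid G)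

/-- The free conjugacy class `[γ]` of a loop `γ`. -/
def freeClass {G : Type*} [Groupoid G] {x : G} (γ : End x) : FreeClass G :=
  _root_.Quotient.mk (freeSetoid G) ⟨x, γ⟩

/-- An element of a group is primitive if it has infinite order and generates the largest cyclic
subgroup containing it. -/
def IsPrimitive {G : Type*} [Group G] (γ : G) : Prop :=
  ¬ IsOfFinOrder γ ∧
    ∀ C : Subgroup G, IsCyclic C → γ ∈ C → C ≤ Subgroup.zpowers γ

section Triangulated

variable {S : Type u} [TopologicalSpace S] [ChartedSpace (EuclideanHalfSpace 2) S]
  {X : MarkedSurface S}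

/-! ### The base points near the punctures -/

theorem Glue.vertex_iff {n : ℕ} {mate : Fin n × Fin 3 → Fin n × Fin 3} {a b : Fin n × Triangle}
    (h : Relation.EqvGen (Glue mate) a b) : (∃ k, a.2 k = 1) ↔ ∃ k, b.2 k = 1 := by
  induction h with
  | rel a b h =>
    obtain ⟨i, j, -, -, ha, hb, h1, h2⟩ := h
    have key : ∀ (c : Triangle) (i : Fin 3), c (i + 2) = 0 →
        ((∃ k, c k = 1) ↔ (c i = 1 ∨ c (i + 1) = 1)) := by
      intro c i hc
      constructor
      · rintro ⟨k, hk⟩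
        have : k = i ∨ k = i + 1 ∨ k = i + 2 := by clear hk hc; revert k i; decide
        rcases this with rfl | rfl | rfl
        · exact Or.inl hk
        · exact Or.inr hk
        · rw [hc] at hk; norm_num at hk
      · rintro (h | h)
        · exact ⟨_, h⟩
        · exact ⟨_, h⟩
    rw [key _ i ha, key _ j hb, h1, h2, or_comm]
  | refl a => rfl
  | symm a b _ ih => exact ih.symm
  | trans a b c _ _ ih1 ih2 => exact ih1.trans ih2

/-- A point of a triangle that is not a vertex does not go to a puncture. -/
theorem IdealTriangulation.notMem_punctures (τ : IdealTriangulation X) (T : Fin τ.n)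
    (p : Triangle) (hp : ∀ k, p k ≠ 1) : τ.chi T p ∉ X.punctures := by
  intro h
  have h' : τ.chi T p ∈ X.marked ∪ X.punctures := Or.inr h
  rw [← τ.vertices_eq] at h'
  obtain ⟨T', k, hk⟩ := h'
  obtain ⟨l, hl⟩ := (Glue.vertex_iff ((τ.chi_eq_iff _ _ _ _).1 hk)).1 ⟨k, by simp⟩
  exact hp l hl

/-- The point `(1 - t) b + t m` of the triangle, where `b` is the barycentre and `m` is the
midpoint of the side `i`. -/
def spoke (i : Fin 3) (t : unitInterval) : Triangle :=
  ⟨fun k => (1 - (t : ℝ)) / 3 + (t : ℝ) * (if k = i + 2 then 0 else 1 / 2), by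
    have h0 := t.2.1
    have h1 := t.2.2
    constructor
    · intro k
      change 0 ≤ (1 - (t : ℝ)) / 3 + (t : ℝ) * (if k = i + 2 then 0 else 1 / 2)
      split_ifs <;> linarith
    · fin_cases i <;> simp [Fin.sum_univ_three] <;> ring⟩

theorem spoke_apply (i : Fin 3) (t : unitInterval) (k : Fin 3) :
    spoke i t k = (1 - (t : ℝ)) / 3 + (t : ℝ) * (if k = i + 2 then 0 else 1 / 2) := rfl

theorem spoke_ne_one (i : Fin 3) (t : unitInterval) (k : Fin 3) : spoke i t k ≠ 1 := by
  have h0 := t.2.1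
  have h1 := t.2.2
  rw [spoke_apply]
  split_ifs <;> intro h <;> linarith

theorem continuous_spoke (i : Fin 3) : Continuous (spoke i) := by
  refine Continuous.subtype_mk ?_ _
  fun_prop

/-- The path on the surface from (the image of) the barycentre of `T` to the midpoint of its side
`i`: half of the edge of the dual graph that crosses the side `i`. -/
def IdealTriangulation.halfEdge (τ : IdealTriangulation X) (T : Fin τ.n) (i : Fin 3)
    (t : unitInterval) : X.Punctured :=
  ⟨τ.chi T (spoke i t), τ.notMem_punctures T _ (spoke_ne_one i t)⟩

/-- The same, as a path. -/
def IdealTriangulation.halfEdgePath (τ : IdealTriangulation X) (T : Fin τ.n) (i : Fin 3) :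
    Path (τ.halfEdge T i 0) (τ.halfEdge T i 1) where
  toFun := τ.halfEdge T i
  continuous_toFun := by
    refine Continuous.subtype_mk ?_ _
    exact (τ.chi T).continuous.comp (continuous_spoke i)
  source' := rfl
  target' := rfl

theorem IdealTriangulation.halfEdge_zero (τ : IdealTriangulation X) (T : Fin τ.n) (i j : Fin 3) :
    τ.halfEdge T i 0 = τ.halfEdge T j 0 := by
  have h : spoke i 0 = spoke j 0 := by
    apply Subtype.ext
    funext k
    change (1 - ((0 : unitInterval) : ℝ)) / 3 + _ = (1 - ((0 : unitInterval) : ℝ)) / 3 + _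
    simp
  apply Subtype.ext
  change τ.chi T (spoke i 0) = τ.chi T (spoke j 0)
  rw [h]

/-- The midpoints of two sides that are glued to each other coincide. -/
theorem IdealTriangulation.halfEdge_one (τ : IdealTriangulation X) {T T' : Fin τ.n} {i j : Fin 3}
    (h : τ.mate (T, i) = (T', j)) : τ.halfEdge T i 1 = τ.halfEdge T' j 1 := by
  apply Subtype.ext
  change τ.chi T (spoke i 1) = τ.chi T' (spoke j 1)
  by_cases hne : (T, i) = (T', j)
  · cases hne
    rfl
  · rw [τ.chi_eq_iff]
    apply Relation.EqvGen.rel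
    refine ⟨i, j, h, hne, ?_, ?_, ?_, ?_⟩ <;> simp [spoke_apply]

/-- The point `P'`: the point `x_T` (the barycentre) of the self-folded triangle `T = T_P` around
the puncture `P`. -/
def FoldedTriangulation.nearPt (τ : FoldedTriangulation X) (P : X.punctures) : X.Punctured :=
  τ.halfEdge (τ.corner P).1 (τ.corner P).2 0

/-- The loop at `P'` which stays in the self-folded triangle `T_P` and goes once around `P`,
crossing once the arc that joins `P` to the other vertex of `T_P`. -/
def FoldedTriangulation.nearLoop (τ : FoldedTriangulation X) (P : X.punctures) :
    Path (τ.nearPt P) (τ.nearPt P) :=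
  (τ.halfEdgePath (τ.corner P).1 (τ.corner P).2).trans
    ((τ.halfEdgePath (τ.corner P).1 ((τ.corner P).2 + 1)).symm.cast
      (τ.halfEdge_one (τ.mate_corner P))
      (τ.halfEdge_zero _ _ _))

/-- `P'` as an object of the orbifold fundamental groupoid. -/
def FoldedTriangulation.pt (τ : FoldedTriangulation X) (P : X.punctures) : Orb X :=
  orbPt X (τ.nearPt P)

/-- The element `e_P` of the orbifold fundamental group at `P'`. -/
def FoldedTriangulation.e (τ : FoldedTriangulation X) (P : X.punctures) : End (τ.pt P) :=
  orbPath X (τ.nearLoop P)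

/-- The element `s_P = w_P e_P w_P⁻¹` of the orbifold fundamental group at `x₀`, where `w_P` is a
path from `P'` to `x₀`. -/
def FoldedTriangulation.s (τ : FoldedTriangulation X) {x₀ : X.Punctured}
    (w : ∀ P, τ.pt P ⟶ orbPt X x₀) (P : X.punctures) : OrbGroup X x₀ :=
  Groupoid.inv (w P) ≫ End.asHom (τ.e P) ≫ w P

/-- The element `s_P v s_Q v⁻¹`. -/
def FoldedTriangulation.link (τ : FoldedTriangulation X) {x₀ : X.Punctured}
    (w : ∀ P, τ.pt P ⟶ orbPt X x₀) (a : X.punctures × X.punctures × OrbGroup X x₀) :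
    OrbGroup X x₀ :=
  τ.s w a.1 * a.2.2 * τ.s w a.2.1 * a.2.2⁻¹

/-- The elementary moves `(P, Q, v) ~ (Q, P, s_Q^ε' v⁻¹ s_P^ε)` with `ε, ε' ∈ {0, 1}`. -/
def FoldedTriangulation.Move (τ : FoldedTriangulation X) {x₀ : X.Punctured}
    (w : ∀ P, τ.pt P ⟶ orbPt X x₀) (a b : X.punctures × X.punctures × OrbGroup X x₀) : Prop :=
  ∃ ε ε' : Fin 2,
    b = (a.2.1, a.1, τ.s w a.2.1 ^ (ε' : ℕ) * a.2.2⁻¹ * τ.s w a.1 ^ (ε : ℕ))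

/-! ### Paths between the points near the punctures -/

/-- The free orbifold classes `[γ]` with `γ` primitive and `[γ] = [γ⁻¹]`. -/
def ReversibleClass (X : MarkedSurface S) : Type u :=
  {c : FreeClass (Orb X) // ∃ (x : X.Punctured) (γ : OrbGroup X x),
    c = freeClass γ ∧ IsPrimitive γ ∧ freeClass γ = freeClass γ⁻¹}

/-- A morphism of the orbifold fundamental groupoid between two of the points `P'`. -/
structure TaggedPath (τ : FoldedTriangulation X) where
  source : X.punctures
  target : X.punctures
  hom : τ.pt source ⟶ τ.pt target

/-- The inverse of a path. -/
def TaggedPath.inv {τ : FoldedTriangulation X} (w : TaggedPath τ) : TaggedPath τ :=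
  ⟨w.target, w.source, Groupoid.inv w.hom⟩

/-- The condition `w² = 1`: the path `w` can be composed with itself, and the result is an
identity. -/
def TaggedPath.SqEqOne {τ : FoldedTriangulation X} (w : TaggedPath τ) : Prop :=
  ∃ (P : X.punctures) (f : τ.pt P ⟶ τ.pt P), w = ⟨P, P, f⟩ ∧ f ≫ f = 𝟙 (τ.pt P)

/-- The unordered pairs `{w, w⁻¹}` of paths between the points `P'` such that `w² ≠ 1`. -/
def TaggedPair (τ : FoldedTriangulation X) : Type u :=
  {A : Set (TaggedPath τ) // ∃ w : TaggedPath τ, A = {w, w.inv} ∧ ¬ w.SqEqOne}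

/-- The path `e_P^ε₁ w_P⁻¹ v w_Q e_Q^ε₂` from `Q'` to `P'`, for a triple `(P, Q, v)`. -/
def FoldedTriangulation.tagged (τ : FoldedTriangulation X) {x₀ : X.Punctured}
    (w : ∀ P, τ.pt P ⟶ orbPt X x₀) (a : X.punctures × X.punctures × OrbGroup X x₀)
    (ε₁ ε₂ : ZMod 2) : TaggedPath τ where
  source := a.2.1
  target := a.1
  hom :=
    End.asHom (τ.e a.2.1 ^ ε₂.val) ≫ w a.2.1 ≫
      End.asHom a.2.2 ≫ Groupoid.inv (w a.1) ≫
        End.asHom (τ.e a.1 ^ ε₁.val)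

end Triangulated

end OrbSurface

end

open OrbSurface

/-! The orbifold group is a free product of infinite cyclic groups and of groups of order two, one
for each puncture. It is not computed here by van Kampen's theorem; it is embedded in the universal
Coxeter group on the set of all sides of the triangles, i.e. the free product of groups of order
two, which acts faithfully on reduced words. Crossing an ordinary arc goes to the product of the two
letters of its sides, and crossing the folded arc around `P` goes to the single letter `corner P`.

This representation exists because the monodromy of a covering space can be prescribed freely on the
half-edges of the dual graph (`exists_side_monodromy`), and because small loops around a puncture
act through a single letter, so that it descends to the orbifold groupoid (`disc_loop_sq`,
`exists_representation`). The dual edges generate the groupoid (`reach_of_path`), and a product of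
edges without backtracking has a reduced image. This gives injectivity (`EdgeLetters.eq_of_theta`)
and shows that every nontrivial involution is conjugate to some `s_P`
(`EdgeLetters.exists_edge_of_involution`). The covering lives over the complement of the marked
points as well; since these lie on the boundary, they can be pushed inwards (`exists_push`) without
affecting homotopy classes between barycentres.

The rest is algebra from the properties collected in `IsReflectionSystem`. If `g` conjugates a
primitive `γ` to its inverse, then `g²` commutes with `γ`, so it is a power of `γ` which `g` both
fixes and inverts; hence `g² = 1`, and `γ = g · (gγ)` is a product of two involutions, conjugates of
some `s_P` and `s_Q`. If `δ = st = s't'` are two such factorizations, then `ss'` commutes with `δ`,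
so `s' = sδ^k`. The parity of `k` decides whether `s'` is conjugate by a power of `δ` to `s` or to
`t`, and since the centralizer of `s_P` is `{1, s_P}`, the remaining freedom is that of the moves.
Finally, the pair `{w, w⁻¹}` determines the class of the link. A coincidence between its four tags,
or `w² = 1`, would make some `s_P` trivial, or would make the link trivial or a square,
contradicting primitivity. -/

namespace OrbSurface

/-! ### Universal Coxeter groups: normal forms, centralizers, conjugacy of letters -/

section ReducedWords

variable {I : Type*} [DecidableEq I]

/-- The reduced words of the universal Coxeter group on the alphabet `I`. -/
abbrev ReducedWord (I : Type*) : Type _ := {l : List I // l.IsChain (· ≠ ·)}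

/-- Left multiplication by a letter, on reduced words. -/
def letterAct (i : I) : List I → List I
  | [] => [i]
  | j :: t => if i = j then t else i :: j :: t

theorem letterAct_isChain (i : I) {l : List I} (hl : l.IsChain (· ≠ ·)) :
    (letterAct i l).IsChain (· ≠ ·) := by
  cases l with
  | nil => simp [letterAct]
  | cons j t =>
    rw [letterAct]
    split_ifs with h
    · exact hl.tail
    · exact List.isChain_cons_cons.2 ⟨h, hl⟩

theorem letterAct_letterAct (i : I) {l : List I} (hl : l.IsChain (· ≠ ·)) :
    letterAct i (letterAct i l) = l := by
  cases l with
  | nil => simp [letterAct]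
  | cons j t =>
    by_cases h : i = j
    · subst h
      cases t with
      | nil => simp [letterAct]
      | cons k t =>
        have : i ≠ k := (List.isChain_cons_cons.1 hl).1
        simp [letterAct, this]
    · simp [letterAct, h]

/-- A letter, as an involution of the set of reduced words. -/
def letter (i : I) : Equiv.Perm (ReducedWord I) where
  toFun l := ⟨letterAct i l.1, letterAct_isChain i l.2⟩
  invFun l := ⟨letterAct i l.1, letterAct_isChain i l.2⟩
  left_inv l := Subtype.ext (letterAct_letterAct i l.2)
  right_inv l := Subtype.ext (letterAct_letterAct i l.2)

theorem letter_mul_self (i : I) : letter i * letter i = 1 :=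
  Equiv.ext fun l => (letter i).left_inv l

theorem letter_inv (i : I) : (letter i)⁻¹ = letter i :=
  inv_eq_of_mul_eq_one_left (letter_mul_self i)

/-- The product of a word in the universal Coxeter group. -/
def wordProd (l : List I) : Equiv.Perm (ReducedWord I) := (l.map letter).prod

@[simp] theorem wordProd_nil : wordProd ([] : List I) = 1 := rfl

@[simp] theorem wordProd_cons (i : I) (l : List I) : wordProd (i :: l) = letter i * wordProd l := by
  simp [wordProd]

@[simp] theorem wordProd_append (l m : List I) :
    wordProd (l ++ m) = wordProd l * wordProd m := by
  simp [wordProd]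

theorem wordProd_reverse (l : List I) : wordProd l.reverse = (wordProd l)⁻¹ := by
  induction l with
  | nil => simp
  | cons i l ih => simp [ih, letter_inv]

/-- No cancellation occurs when a reduced word acts letter by letter on the empty word. The
resulting injectivity, `wordProd_injOn`, is the normal form theorem for a free product of groups of
order two. -/
theorem wordProd_apply_nil {l : List I} (hl : l.IsChain (· ≠ ·)) :
    (wordProd l ⟨[], List.isChain_nil⟩).1 = l := by
  induction l with
  | nil => simp
  | cons i l ih =>
    have h := ih hl.tail
    rw [wordProd_cons, Equiv.Perm.mul_apply]
    change letterAct i _ = _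
    rw [h]
    cases l with
    | nil => rfl
    | cons j t =>
      have : i ≠ j := (List.isChain_cons_cons.1 hl).1
      simp [letterAct, this]

theorem wordProd_injOn {l m : List I} (hl : l.IsChain (· ≠ ·)) (hm : m.IsChain (· ≠ ·))
    (h : wordProd l = wordProd m) : l = m := by
  rw [← wordProd_apply_nil hl, ← wordProd_apply_nil hm, h]

theorem wordProd_letterAct (i : I) (l : List I) :
    wordProd (letterAct i l) = letter i * wordProd l := by
  cases l with
  | nil => simp [letterAct]
  | cons j t =>
    by_cases h : i = j
    · subst h
      simp [letterAct, ← mul_assoc, letter_mul_self]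
    · simp [letterAct, h]

/-- Every word is equivalent to a reduced one, which is shorter unless the word is reduced. -/
theorem exists_reduced (l : List I) : ∃ m : List I, m.IsChain (· ≠ ·) ∧ wordProd m = wordProd l ∧
    m.length ≤ l.length ∧ (m.length = l.length → m = l) := by
  induction l with
  | nil => exact ⟨[], List.isChain_nil, rfl, le_rfl, fun _ => rfl⟩
  | cons i l ih =>
    obtain ⟨m, hm, hml, hle, heq⟩ := ih
    refine ⟨letterAct i m, letterAct_isChain i hm, by rw [wordProd_letterAct, hml, wordProd_cons],
      ?_⟩
    cases m with
    | nil =>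
      simp only [List.length_nil, letterAct] at heq ⊢
      simp
    | cons j t =>
      rw [letterAct]
      split_ifs with h
      · simp at hle ⊢
        exact ⟨by omega, fun h => by omega⟩
      · simp only [List.length_cons] at hle heq ⊢
        exact ⟨by omega, fun h => by rw [heq (by omega)]⟩

/-- If two reduced words commute and one of the products is reduced, then the words commute as
lists. -/
theorem append_comm_of_commute {l m : List I} (h : (l ++ m).IsChain (· ≠ ·))
    (hc : Commute (wordProd l) (wordProd m)) : l ++ m = m ++ l := by
  obtain ⟨k, hk, hkw, -, hkeq⟩ := exists_reduced (m ++ l)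
  -- Reduction shortens every unreduced word. As the reduced form `l ++ m` of `m ++ l` has the same
  -- length, `m ++ l` was reduced already.
  have : k = l ++ m := wordProd_injOn hk h (by
    rw [hkw, wordProd_append, wordProd_append, hc.eq])
  rw [← this]
  exact hkeq (by rw [this]; simp [add_comm])

omit [DecidableEq I] in
/-- Two lists which commute are powers of a common list. -/
theorem exists_common_root (l m : List I) (h : l ++ m = m ++ l) :
    ∃ (z : List I) (a b : ℕ), l = (List.replicate a z).flatten ∧
      m = (List.replicate b z).flatten := by
  induction hn : l.length + m.length using Nat.strong_induction_on generalizing l m with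
  | _ n ih =>
    wlog hle : l.length ≤ m.length generalizing l m
    · obtain ⟨z, a, b, h1, h2⟩ := this m l h.symm (by omega) (by omega)
      exact ⟨z, b, a, h2, h1⟩
    by_cases hl : l = []
    · subst hl
      exact ⟨m, 0, 1, by simp, by simp⟩
    -- Euclid's algorithm on the lengths: the shorter list is a prefix of the longer one and is
    -- removed from it.
    · have hp : l <+: m :=
        List.prefix_of_prefix_length_le ⟨m, rfl⟩ ⟨l, h.symm⟩ hle
      obtain ⟨k, rfl⟩ := hp
      have hk : l ++ k = k ++ l := by
        simpa using h
      have : 0 < l.length := List.length_pos_of_ne_nil hl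
      obtain ⟨z, a, b, h1, h2⟩ := ih (l.length + k.length) (by simp at hn; omega) l k hk rfl
      refine ⟨z, a, a + b, h1, ?_⟩
      rw [List.replicate_add, List.flatten_append, ← h1, ← h2]

theorem wordProd_flatten_replicate (z : List I) (a : ℕ) :
    wordProd (List.replicate a z).flatten = wordProd z ^ a := by
  induction a with
  | zero => simp
  | succ a ih => rw [List.replicate_succ, List.flatten_cons, wordProd_append, ih, pow_succ']

theorem mem_zpowers_of_append_isChain {l m : List I} (h : (l ++ m).IsChain (· ≠ ·))
    (hc : Commute (wordProd l) (wordProd m)) : ∃ z : Equiv.Perm (ReducedWord I),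
      wordProd l ∈ Subgroup.zpowers z ∧ wordProd m ∈ Subgroup.zpowers z := by
  obtain ⟨z, a, b, h1, h2⟩ := exists_common_root l m (append_comm_of_commute h hc)
  refine ⟨wordProd z, ?_, ?_⟩
  · rw [h1, wordProd_flatten_replicate]
    exact Subgroup.npow_mem_zpowers _ _
  · rw [h2, wordProd_flatten_replicate]
    exact Subgroup.npow_mem_zpowers _ _

/-- An element of infinite order of the universal Coxeter group, and an element which commutes with
it, lie in a common cyclic subgroup. -/
theorem exists_zpowers_of_commute (l m : List I) (hfin : ¬ IsOfFinOrder (wordProd l))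
    (hc : Commute (wordProd l) (wordProd m)) : ∃ z : Equiv.Perm (ReducedWord I),
      wordProd l ∈ Subgroup.zpowers z ∧ wordProd m ∈ Subgroup.zpowers z := by
  induction hn : l.length using Nat.strong_induction_on generalizing l m with
  | _ n ih =>
    wlog hl : l.IsChain (· ≠ ·) generalizing l
    · obtain ⟨l', hl', h1, h2, h3⟩ := exists_reduced l
      rw [← h1] at hfin hc ⊢
      rcases h2.eq_or_lt with h2 | h2
      · rw [h3 h2] at hl'
        exact absurd hl' hl
      · exact ih _ (by omega) l' m hfin hc rfl
    obtain ⟨m', hm, hm', -⟩ := exists_reduced m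
    rw [← hm'] at hc ⊢
    clear hm'
    rcases l with - | ⟨i, l⟩
    · simp at hfin
    rcases l.eq_nil_or_concat with rfl | ⟨k, j, rfl⟩
    · refine absurd ?_ hfin
      rw [wordProd_cons, wordProd_nil, mul_one, isOfFinOrder_iff_pow_eq_one]
      exact ⟨2, by norm_num, by rw [pow_two, letter_mul_self]⟩
    by_cases hij : i = j
    · subst hij
      -- Equal end letters: conjugation by this letter carries the pair to the shorter word `k` and
      -- to the word `i m' i`, and a common root is conjugated back.
      have hconj : wordProd (i :: (k ++ [i])) = letter i * wordProd k * (letter i)⁻¹ := by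
        simp [letter_inv, mul_assoc]
      have hm2 : wordProd m' = letter i * wordProd (i :: (m' ++ [i])) * (letter i)⁻¹ := by
        rw [letter_inv, wordProd_cons, wordProd_append, wordProd_cons, wordProd_nil, mul_one]
        simp only [← mul_assoc, letter_mul_self, one_mul]
        rw [mul_assoc, letter_mul_self, mul_one]
      rw [List.concat_eq_append, hconj] at hfin hc ⊢
      rw [hm2] at hc ⊢
      obtain ⟨z, hz1, hz2⟩ := ih k.length (by simp at hn; omega) k (i :: (m' ++ [i]))
        (fun h => hfin (by
          rw [← MulAut.conj_apply]
          exact (MulAut.conj (letter i)).toMonoidHom.isOfFinOrder h))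
        (by
          rw [← MulAut.conj_apply, ← MulAut.conj_apply] at hc
          exact Commute.of_map (f := MulAut.conj (letter i)) (MulAut.conj (letter i)).injective
            hc) rfl
      obtain ⟨a, ha⟩ := Subgroup.mem_zpowers_iff.1 hz1
      obtain ⟨b, hb⟩ := Subgroup.mem_zpowers_iff.1 hz2
      refine ⟨letter i * z * (letter i)⁻¹, Subgroup.mem_zpowers_iff.2 ⟨a, ?_⟩,
        Subgroup.mem_zpowers_iff.2 ⟨b, ?_⟩⟩
      · rw [← ha, conj_zpow]
      · rw [← hb, conj_zpow]
    · rw [List.concat_eq_append] at *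
      -- Distinct end letters. If the product with `m'` cancels, then `m'` begins with `j`; the
      -- inverse word ends in `i ≠ j`, so its product with `m'` is reduced.
      by_cases hj : ((i :: (k ++ [j])) ++ m').IsChain (· ≠ ·)
      · exact mem_zpowers_of_append_isChain hj hc
      · have hmj : m'.head? = some j := by
          by_contra hne
          apply hj
          rw [List.isChain_append]
          refine ⟨hl, hm, ?_⟩
          intro x hx y hy hxy
          rw [← List.cons_append, List.getLast?_append] at hx
          simp at hx
          subst hx hxy
          exact hne hy
        have hrev : ((i :: (k ++ [j])).reverse ++ m').IsChain (· ≠ ·) := by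
          rw [List.isChain_append]
          refine ⟨?_, hm, ?_⟩
          · rw [List.isChain_reverse]
            exact hl.imp fun _ _ h => h.symm
          · intro x hx y hy
            rw [hmj] at hy
            rw [List.getLast?_reverse] at hx
            simp at hx hy
            rw [← hx, ← hy]
            exact hij
        obtain ⟨z, h1, h2⟩ := mem_zpowers_of_append_isChain hrev (by
          rw [wordProd_reverse]
          exact hc.inv_left)
        rw [wordProd_reverse, inv_mem_iff] at h1
        exact ⟨z, h1, h2⟩

/-- The centralizer of a letter. -/
theorem eq_of_commute_letter {i : I} {m : List I} (hc : Commute (letter i) (wordProd m)) :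
    wordProd m = 1 ∨ wordProd m = letter i := by
  -- If `m` does not begin with `i`, then `i :: m` is reduced, hence equal to `m ++ [i]` as a list,
  -- and a nonempty `m` would begin with `i` after all.
  have key : ∀ m : List I, m.IsChain (· ≠ ·) → Commute (letter i) (wordProd m) →
      m.head? ≠ some i → m = [] := by
    intro m hm hc hi
    have h : ([i] ++ m).IsChain (· ≠ ·) := by
      rw [List.isChain_append]
      refine ⟨List.isChain_singleton i, hm, ?_⟩
      rintro x hx y hy rfl
      simp at hx
      rw [hx] at hi
      exact hi hy
    have h' := append_comm_of_commute h (by simpa using hc)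
    cases m with
    | nil => rfl
    | cons j t =>
      simp at h'
      simp [h'.1] at hi
  obtain ⟨m', hm, h, -⟩ := exists_reduced m
  rw [← h] at hc ⊢
  by_cases hi : m'.head? = some i
  · cases m' with
    | nil => simp at hi
    | cons j t =>
      simp at hi
      subst hi
      right
      have ht : t = [] := by
        refine key t hm.tail ?_ ?_
        · have h2 : wordProd t = letter j * wordProd (j :: t) := by
            rw [wordProd_cons, ← mul_assoc, letter_mul_self, one_mul]
          rw [h2]
          exact (Commute.refl _).mul_right hc
        · intro h3
          cases t with
          | nil => simp at h3
          | cons k t =>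
            simp at h3
            exact (List.isChain_cons_cons.1 hm).1 h3.symm
      subst ht
      simp
  · left
    rw [key m' hm hc hi]
    rfl

/-- Distinct letters are not conjugate. -/
theorem letter_conj_injective {i j : I} {m : List I}
    (h : wordProd m * letter i = letter j * wordProd m) : i = j := by
  -- The parity of the number of occurrences of a letter depends only on the group element. For `i ≠
  -- j` the words `m ++ [i]` and `j :: m` contain `i` with different parities.
  have parity : ∀ (c : I) (l : List I), ∀ l', l'.IsChain (· ≠ ·) → wordProd l' = wordProd l →
      (l'.count c + l.count c) % 2 = 0 := by
    intro c l
    induction l with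
    | nil =>
      intro l' hl' h
      rw [wordProd_injOn hl' List.isChain_nil h]
      simp
    | cons k l ih =>
      intro l' hl' h
      have := ih (letterAct k l') (letterAct_isChain k hl') (by
        rw [wordProd_letterAct, h, wordProd_cons, ← mul_assoc, letter_mul_self, one_mul])
      cases l' with
      | nil =>
        simp only [letterAct, List.count_cons, List.count_nil] at this ⊢
        split_ifs at this ⊢ <;> omega
      | cons a t =>
        rw [letterAct] at this
        by_cases hka : k = a
        · subst hka
          rw [if_pos rfl] at this
          simp only [List.count_cons] at this ⊢
          split_ifs at this ⊢ <;> omega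
        · rw [if_neg hka] at this
          simp only [List.count_cons] at this ⊢
          split_ifs at this ⊢ <;> omega
  obtain ⟨l, hl, hlm, -⟩ := exists_reduced (m ++ [i])
  have h1 := parity i (m ++ [i]) l hl hlm
  have h2 := parity i (j :: m) l hl (by simpa [hlm] using h)
  by_contra hij
  simp [List.count_append, Ne.symm hij] at h1 h2
  omega

end ReducedWords

end OrbSurface
namespace OrbSurface

/-! ### Reversible primitive elements as products of two reflections -/

section Reflections

variable {G P : Type*} [Group G]

/-- The properties of the involutions `s P` of a free product of infinite cyclic groups and of the
groups of order two generated by the `s P`. -/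
structure IsReflectionSystem (s : P → G) : Prop where
  mul_self : ∀ p, s p * s p = 1
  cyclic : ∀ γ g : G, ¬ IsOfFinOrder γ → Commute γ g →
    ∃ C : Subgroup G, IsCyclic C ∧ γ ∈ C ∧ g ∈ C
  involution : ∀ g : G, g * g = 1 → g ≠ 1 → ∃ p h, g = h * s p * h⁻¹
  conj : ∀ (p q : P) (h : G), h * s p * h⁻¹ = s q → p = q
  commute : ∀ (p : P) (g : G), Commute (s p) g → g = 1 ∨ g = s p
  ne_one : ∀ p, s p ≠ 1

/-- The element `s_P v s_Q v⁻¹`. -/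
def reflLink (s : P → G) (a : P × P × G) : G := s a.1 * a.2.2 * s a.2.1 * a.2.2⁻¹

/-- The elementary moves `(P, Q, v) ~ (Q, P, s_Q^ε' v⁻¹ s_P^ε)`. -/
def ReflMove (s : P → G) (a b : P × P × G) : Prop :=
  ∃ ε ε' : Fin 2, b = (a.2.1, a.1, s a.2.1 ^ (ε' : ℕ) * a.2.2⁻¹ * s a.1 ^ (ε : ℕ))

theorem IsPrimitive.mem_zpowers {γ g : G} (hγ : IsPrimitive γ)
    (h : ∃ C : Subgroup G, IsCyclic C ∧ γ ∈ C ∧ g ∈ C) : g ∈ Subgroup.zpowers γ := by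
  obtain ⟨C, hC, h1, h2⟩ := h
  exact hγ.2 C hC h1 h2

/-- Otherwise `g` is a power of its own square, an odd power of `g` is trivial, and `g * g` has
finite order. -/
theorem not_isPrimitive_sq (g : G) : ¬ IsPrimitive (g * g) := by
  rintro ⟨h1, h2⟩
  have h3 := h2 (Subgroup.zpowers g) inferInstance
    (Subgroup.mul_mem _ (Subgroup.mem_zpowers g) (Subgroup.mem_zpowers g)) (Subgroup.mem_zpowers g)
  obtain ⟨k, hk⟩ := Subgroup.mem_zpowers_iff.1 h3
  have hk' : g ^ (2 * k - 1) = 1 := by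
    rw [zpow_sub, zpow_mul, zpow_one, zpow_two, hk, mul_inv_cancel]
  refine h1 ?_
  have : IsOfFinOrder g := isOfFinOrder_iff_zpow_eq_one.2 ⟨2 * k - 1, by omega, hk'⟩
  rw [← pow_two]
  exact this.pow

theorem IsPrimitive.map {G H : Type*} [Group G] [Group H] {γ : G} (hγ : IsPrimitive γ)
    (e : G ≃* H) : IsPrimitive (e γ) := by
  refine ⟨fun hf => hγ.1 ?_, fun C hC hmem => ?_⟩
  · simpa using e.symm.toMonoidHom.isOfFinOrder hf
  · have h1 := hγ.2 (C.map e.symm.toMonoidHom)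
      (isCyclic_of_surjective _ (e.symm.toMonoidHom.subgroupMap_surjective C))
      ⟨_, hmem, e.symm_apply_apply γ⟩
    intro c hc
    obtain ⟨k, hk⟩ := h1 ⟨c, hc, rfl⟩
    refine ⟨k, ?_⟩
    have h2 := congrArg e hk
    simpa using h2

theorem IsPrimitive.conj {γ γ' h : G} (hγ : IsPrimitive γ) (e : γ' = h * γ * h⁻¹) :
    IsPrimitive γ' :=
  e ▸ hγ.map (MulAut.conj h)

theorem mul_conj_of_involutions {a b : G} (ha : a * a = 1) (hb : b * b = 1) :
    a * (a * b) * a⁻¹ = (a * b)⁻¹ := by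
  rw [mul_inv_rev, inv_eq_of_mul_eq_one_left ha, inv_eq_of_mul_eq_one_left hb, ← mul_assoc, ha,
    one_mul]

namespace IsReflectionSystem

variable {s : P → G} (hs : IsReflectionSystem s)
include hs

theorem inv_eq (p : P) : (s p)⁻¹ = s p := inv_eq_of_mul_eq_one_left (hs.mul_self p)

theorem mul_cancel (p : P) (x : G) : s p * (s p * x) = x := by
  rw [← mul_assoc, hs.mul_self, one_mul]

/-- A primitive element which is conjugate to its inverse is a product of two involutions. -/
theorem exists_link {γ g : G} (hγ : IsPrimitive γ) (hg : g * γ * g⁻¹ = γ⁻¹) :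
    ∃ (a : P × P × G) (h : G), γ = h * reflLink s a * h⁻¹ := by
  have hγ0 : ∀ k : ℤ, γ ^ k = 1 → k = 0 := by
    intro k hk
    by_contra hne
    exact hγ.1 (isOfFinOrder_iff_zpow_eq_one.2 ⟨k, hne, hk⟩)
  have hg1 : g * γ = γ⁻¹ * g := by rw [← hg]; group
  have hcomm : Commute γ (g * g) := by
    have h2 : g * γ⁻¹ = γ * g := by
      rw [← inv_inj]
      have : g⁻¹ * γ⁻¹ = γ * g⁻¹ := by
        calc g⁻¹ * γ⁻¹ = g⁻¹ * (γ⁻¹ * g) * g⁻¹ := by group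
          _ = γ * g⁻¹ := by rw [← hg1]; group
      calc (g * γ⁻¹)⁻¹ = γ * g⁻¹ := by group
        _ = g⁻¹ * γ⁻¹ := this.symm
        _ = (γ * g)⁻¹ := by group
    change γ * (g * g) = g * g * γ
    rw [mul_assoc g g γ, hg1, ← mul_assoc g, h2, mul_assoc]
  obtain ⟨k, hk⟩ := Subgroup.mem_zpowers_iff.1 (hγ.mem_zpowers (hs.cyclic γ (g * g) hγ.1 hcomm))
  -- Conjugation by `g` fixes `g * g = γ ^ k` but inverts every power of `γ`, so `γ ^ (2 * k) = 1`
  -- and `k = 0`.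
  have hgg : g * g = 1 := by
    have h1 : g * γ ^ k * g⁻¹ = (γ⁻¹) ^ k := by rw [← hg, conj_zpow]
    rw [hk, inv_zpow, hk] at h1
    have h2 : γ ^ (2 * k) = 1 := by
      rw [zpow_mul', zpow_two, hk]
      nth_rewrite 2 [show g * g = g * (g * g) * g⁻¹ by group]
      rw [h1, mul_inv_cancel]
    have : k = 0 := by have := hγ0 _ h2; omega
    rw [← hk, this, zpow_zero]
  have hginv : g⁻¹ = g := inv_eq_of_mul_eq_one_left hgg
  have hg_ne : g ≠ 1 := by
    rintro rfl
    have : γ ^ (2 : ℤ) = 1 := by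
      rw [zpow_two]
      nth_rewrite 1 [show γ = 1 * γ * 1⁻¹ by group]
      rw [hg, inv_mul_cancel]
    have := hγ0 _ this
    omega
  have h2 : (g * γ) * (g * γ) = 1 := by
    calc (g * γ) * (g * γ) = (g * γ * g) * γ := by group
      _ = 1 := by
        nth_rewrite 2 [← hginv]
        rw [hg, inv_mul_cancel]
  have h2_ne : g * γ ≠ 1 := by
    intro h
    have : γ = g := by rw [← hginv]; exact eq_inv_of_mul_eq_one_right h
    have h3 := hγ0 2 (by rw [zpow_two, this, hgg])
    omega
  obtain ⟨p, a, ha⟩ := hs.involution g hgg hg_ne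
  obtain ⟨q, b, hb⟩ := hs.involution _ h2 h2_ne
  -- The two involutions are conjugates by `a` and `b`; taking the conjugation by `a` out of the
  -- product leaves `a⁻¹ * b` between the reflections.
  refine ⟨(p, q, a⁻¹ * b), a, ?_⟩
  calc γ = g * (g * γ) := by rw [← mul_assoc, hgg, one_mul]
    _ = (a * s p * a⁻¹) * (b * s q * b⁻¹) := by rw [← ha, ← hb]
    _ = _ := by simp only [reflLink]; group

omit hs in
theorem pow_fin (p : P) {x : G} (hx : x = 1 ∨ x = s p) : ∃ ε : Fin 2, s p ^ (ε : ℕ) = x := by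
  rcases hx with rfl | rfl
  · exact ⟨0, by simp⟩
  · exact ⟨1, by simp⟩

/-- A cyclic rotation exchanges the two reflections, and `x`, `y` do not change the conjugacy class
because they commute with `s q` and `s p`. -/
theorem link_swap {p q : P} {v x y : G} (hx : x = 1 ∨ x = s q) (hy : y = 1 ∨ y = s p) :
    ∃ h, reflLink s (q, p, x * v⁻¹ * y) = h * reflLink s (p, q, v) * h⁻¹ := by
  have hy' : y * s p * y⁻¹ = s p := by rcases hy with rfl | rfl <;> simp
  have hx' : x⁻¹ * s q * x = s q := by rcases hx with rfl | rfl <;> simp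
  refine ⟨x * v⁻¹ * s p, ?_⟩
  simp only [reflLink]
  calc s q * (x * v⁻¹ * y) * s p * (x * v⁻¹ * y)⁻¹
      = x * (x⁻¹ * s q * x) * v⁻¹ * (y * s p * y⁻¹) * v * x⁻¹ := by group
    _ = x * s q * v⁻¹ * s p * v * x⁻¹ := by rw [hx', hy']
    _ = x * v⁻¹ * (s p * s p) * v * s q * v⁻¹ * (s p)⁻¹ * v * x⁻¹ := by
      rw [hs.mul_self, hs.inv_eq]; group
    _ = _ := by group

omit hs in
theorem link_conj {p q : P} {v x y : G} (hx : x = 1 ∨ x = s p) (hy : y = 1 ∨ y = s q) :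
    ∃ h, reflLink s (p, q, x * v * y) = h * reflLink s (p, q, v) * h⁻¹ := by
  have hy' : y * s q * y⁻¹ = s q := by rcases hy with rfl | rfl <;> simp
  have hx' : x⁻¹ * s p * x = s p := by rcases hx with rfl | rfl <;> simp
  refine ⟨x, ?_⟩
  simp only [reflLink]
  calc s p * (x * v * y) * s q * (x * v * y)⁻¹
      = x * (x⁻¹ * s p * x) * v * (y * s q * y⁻¹) * v⁻¹ * x⁻¹ := by group
    _ = _ := by rw [hx', hy']; group

theorem inv_mem {p : P} {x : G} (hx : x = 1 ∨ x = s p) : x⁻¹ = 1 ∨ x⁻¹ = s p := by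
  rcases hx with rfl | rfl
  · simp
  · right
    exact hs.inv_eq p

theorem mul_mem {p : P} {x : G} (hx : x = 1 ∨ x = s p) : x * s p = 1 ∨ x * s p = s p := by
  rcases hx with rfl | rfl
  · simp
  · left
    exact hs.mul_self p

theorem mul_mem' {p : P} {x : G} (hx : x = 1 ∨ x = s p) : s p * x = 1 ∨ s p * x = s p := by
  rcases hx with rfl | rfl
  · simp
  · left
    exact hs.mul_self p

theorem link_of_move {a b : P × P × G} (h : ReflMove s a b) :
    ∃ h, reflLink s b = h * reflLink s a * h⁻¹ := by
  obtain ⟨ε, ε', rfl⟩ := h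
  obtain ⟨p, q, v⟩ := a
  refine hs.link_swap ?_ ?_
  · fin_cases ε' <;> simp
  · fin_cases ε <;> simp

theorem link_of_eqvGen {a b : P × P × G} (h : Relation.EqvGen (ReflMove s) a b) :
    ∃ h, reflLink s b = h * reflLink s a * h⁻¹ := by
  induction h with
  | rel a b h => exact hs.link_of_move h
  | refl a => exact ⟨1, by simp⟩
  | symm a b _ ih =>
    obtain ⟨h, hh⟩ := ih
    exact ⟨h⁻¹, by rw [hh]; group⟩
  | trans a b c _ _ ih1 ih2 =>
    obtain ⟨h, hh⟩ := ih1
    obtain ⟨k, hk⟩ := ih2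
    exact ⟨k * h, by rw [hk, hh]; group⟩

omit hs in
theorem move_swap {p q : P} {v x y : G} (hx : x = 1 ∨ x = s q) (hy : y = 1 ∨ y = s p) :
    ReflMove s (p, q, v) (q, p, x * v⁻¹ * y) := by
  obtain ⟨ε', rfl⟩ := pow_fin q hx
  obtain ⟨ε, rfl⟩ := pow_fin p hy
  exact ⟨ε, ε', rfl⟩

/-- The triple which represents a primitive element is unique up to the elementary moves. -/
theorem eqvGen_of_conj {a b : P × P × G} {h : G} (ha : IsPrimitive (reflLink s a))
    (hab : reflLink s a = h * reflLink s b * h⁻¹) : Relation.EqvGen (ReflMove s) a b := by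
  obtain ⟨p, q, v⟩ := a
  obtain ⟨p', q', v'⟩ := b
  set δ := reflLink s (p, q, v) with hδ
  have hd1 : δ = s p * (v * s q * v⁻¹) := by rw [hδ]; simp only [reflLink]; group
  have hd2 : δ = (h * s p' * h⁻¹) * (h * v' * s q' * v'⁻¹ * h⁻¹) := by
    rw [hab]; simp only [reflLink]; group
  set t := v * s q * v⁻¹ with ht
  set s' := h * s p' * h⁻¹ with hs'
  set t' := h * v' * s q' * v'⁻¹ * h⁻¹ with ht'
  have htt : t * t = 1 := by
    calc t * t = v * (s q * s q) * v⁻¹ := by rw [ht]; group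
      _ = 1 := by rw [hs.mul_self]; group
  have hss' : s' * s' = 1 := by
    calc s' * s' = h * (s p' * s p') * h⁻¹ := by rw [hs']; group
      _ = 1 := by rw [hs.mul_self]; group
  have htt' : t' * t' = 1 := by
    calc t' * t' = h * v' * (s q' * s q') * v'⁻¹ * h⁻¹ := by rw [ht']; group
      _ = 1 := by rw [hs.mul_self]; group
  have hss := hs.mul_self p
  have hsi := hs.inv_eq p
  have hti : t⁻¹ = t := inv_eq_of_mul_eq_one_left htt
  have hs'i : s'⁻¹ = s' := inv_eq_of_mul_eq_one_left hss'
  have hflip : s p * δ * (s p)⁻¹ = δ⁻¹ := by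
    rw [hd1]
    exact mul_conj_of_involutions hss htt
  have hflip' : s' * δ * s'⁻¹ = δ⁻¹ := by
    rw [hd2]
    exact mul_conj_of_involutions hss' htt'
  -- Both `s p` and `s'` invert `δ`, so their product commutes with it, and is a power of `δ` by
  -- primitivity.
  have hcomm : Commute δ (s p * s') := by
    have h1 : s p * s' * δ * (s p * s')⁻¹ = δ := by
      calc s p * s' * δ * (s p * s')⁻¹ = s p * (s' * δ * s'⁻¹) * (s p)⁻¹ := by group
        _ = (s p * δ * (s p)⁻¹)⁻¹ := by rw [hflip']; group
        _ = δ := by rw [hflip, inv_inv]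
    exact (mul_inv_eq_iff_eq_mul.1 h1).symm
  have hsz : ∀ m : ℤ, s p * δ ^ m = δ ^ (-m) * s p := by
    intro m
    rw [← mul_inv_eq_iff_eq_mul, ← conj_zpow, hflip, inv_zpow, zpow_neg]
  obtain ⟨k, hk⟩ := Subgroup.mem_zpowers_iff.1 (ha.mem_zpowers (hs.cyclic δ _ ha.1 hcomm))
  have hs'k : s' = s p * δ ^ k := by rw [hk, hs.mul_cancel]
  have ht's : t' = s' * δ := by rw [hd2, ← mul_assoc, hss', one_mul]
  have hts : t = s p * δ := by rw [hd1, hs.mul_cancel]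
  -- The infinite dihedral group generated by `s p` and `δ` has two classes of reflections under
  -- conjugation by powers of `δ`, those of `s p` and of `t`. The parity of `k` tells to which of
  -- them `s'` belongs.
  rcases Int.even_or_odd' k with ⟨m, rfl | rfl⟩
  · have e1 : s' = δ ^ (-m) * s p * δ ^ m := by
      rw [hs'k, ← hsz, mul_assoc, ← zpow_add, two_mul]
    have e2 : t' = δ ^ (-m) * t * δ ^ m := by
      rw [ht's, e1, hts]
      simp only [mul_assoc]
      rw [← zpow_add_one, ← zpow_one_add, add_comm]
    set g := δ ^ m * h with hg
    have c1 : g * s p' * g⁻¹ = s p := by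
      calc g * s p' * g⁻¹ = δ ^ m * s' * (δ ^ m)⁻¹ := by rw [hg, hs']; group
        _ = s p := by rw [e1]; group
    have hp : p' = p := hs.conj _ _ _ c1
    subst hp
    have c2 : (v⁻¹ * g * v') * s q' * (v⁻¹ * g * v')⁻¹ = s q := by
      calc (v⁻¹ * g * v') * s q' * (v⁻¹ * g * v')⁻¹ = v⁻¹ * (δ ^ m * t' * (δ ^ m)⁻¹) * v := by
            rw [hg, ht']; group
        _ = s q := by rw [e2, ht]; group
    have hq : q' = q := hs.conj _ _ _ c2
    subst hq
    have m1 := hs.commute p' g (mul_inv_eq_iff_eq_mul.1 c1).symm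
    have m2 := hs.commute q' _ (mul_inv_eq_iff_eq_mul.1 c2).symm
    -- Both `g` and `v⁻¹ * g * v'` lie in centralizers of reflections. Two moves are needed, since
    -- each of them swaps the ends and here the ends are kept.
    have hv' : v' = 1 * (1 * v⁻¹ * g)⁻¹ * (v⁻¹ * g * v') := by group
    rw [hv']
    refine Relation.EqvGen.trans _ _ _ (Relation.EqvGen.rel _ _
      (move_swap (p := p') (q := q') (v := v) (Or.inl rfl) m1)) (Relation.EqvGen.rel _ _ ?_)
    exact move_swap (Or.inl rfl) m2
  · have e1 : s' = δ ^ (-m) * t * δ ^ m := by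
      rw [hs'k, hts, ← mul_assoc, ← hsz]
      simp only [mul_assoc]
      rw [← zpow_one_add, ← zpow_add]
      congr 2
      omega
    have e2 : t' = δ ^ (-m) * (δ⁻¹ * s p * δ) * δ ^ m := by
      have : t * δ = δ⁻¹ * s p * δ := by
        rw [← hflip, hsi, hts]
        simp only [mul_assoc]
        rw [hs.mul_cancel]
      rw [ht's, e1, mul_assoc, ← zpow_add_one, add_comm, zpow_one_add, ← mul_assoc,
        mul_assoc (δ ^ (-m)), this]
    set g := δ ^ m * h with hg
    have c1 : (v⁻¹ * g) * s p' * (v⁻¹ * g)⁻¹ = s q := by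
      calc (v⁻¹ * g) * s p' * (v⁻¹ * g)⁻¹ = v⁻¹ * (δ ^ m * s' * (δ ^ m)⁻¹) * v := by
            rw [hg, hs']; group
        _ = s q := by rw [e1, ht]; group
    have hp : p' = q := hs.conj _ _ _ c1
    subst hp
    have c2 : (δ * g * v') * s q' * (δ * g * v')⁻¹ = s p := by
      calc (δ * g * v') * s q' * (δ * g * v')⁻¹ = δ * (δ ^ m * t' * (δ ^ m)⁻¹) * δ⁻¹ := by
            rw [hg, ht']; group
        _ = s p := by rw [e2]; group
    have hq : q' = p := hs.conj _ _ _ c2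
    subst hq
    have m1 := hs.commute p' _ (mul_inv_eq_iff_eq_mul.1 c1).symm
    have m2 := hs.commute q' _ (mul_inv_eq_iff_eq_mul.1 c2).symm
    -- The ends are exchanged, so one move suffices. The centralizer elements are `v⁻¹ * g` and `δ *
    -- g * v'`; solving for `v'` brings in `δ⁻¹`, whose two reflections are absorbed in them.
    have hδi : δ⁻¹ = v * s p' * v⁻¹ * s q' := by rw [hd1, mul_inv_rev, hti, hsi]
    have hv' : v' = ((v⁻¹ * g)⁻¹ * s p') * v⁻¹ * (s q' * (δ * g * v')) := by
      calc v' = g⁻¹ * δ⁻¹ * (δ * g * v') := by group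
        _ = _ := by rw [hδi]; group
    rw [hv']
    exact Relation.EqvGen.rel _ _ (move_swap (hs.mul_mem (hs.inv_mem m1)) (hs.mul_mem' m2))

-- If `x * v * y` were its own inverse, the link built on it, which is conjugate to the given one,
-- would be the square of `s p * (x * v * y)`.
omit hs in
theorem tag_sq_ne_one {p : P} {v x y : G} (hv : IsPrimitive (reflLink s (p, p, v)))
    (hx : x = 1 ∨ x = s p) (hy : y = 1 ∨ y = s p) : x * v * y * (x * v * y) ≠ 1 := by
  intro h
  obtain ⟨k, hk⟩ := link_conj (v := v) hx hy
  refine not_isPrimitive_sq (s p * (x * v * y)) ((hv.conj hk).conj (h := 1) ?_)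
  rw [one_mul, inv_one, mul_one, reflLink, ← mul_assoc]
  change _ = s p * (x * v * y) * s p * (x * v * y)⁻¹
  rw [inv_eq_of_mul_eq_one_left h]

/-- A single nontrivial factor would make a reflection trivial; two of them would make the link
trivial. -/
theorem tag_injective {p q : P} {v x y : G} (hv : IsPrimitive (reflLink s (p, q, v)))
    (hx : x = 1 ∨ x = s p) (hy : y = 1 ∨ y = s q) (h : x * v * y = v) : x = 1 ∧ y = 1 := by
  rcases hx with rfl | rfl <;> rcases hy with rfl | rfl
  · exact ⟨rfl, rfl⟩
  · exact absurd (by simpa using h) (hs.ne_one q)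
  · exact absurd (by simpa using h) (hs.ne_one p)
  · refine absurd ?_ hv.1
    rw [reflLink]
    change IsOfFinOrder (s p * v * s q * v⁻¹)
    rw [h, mul_inv_cancel]
    exact IsOfFinOrder.one

/-- If exactly one factor is nontrivial, the equation makes `s p` a power of `v`, so the two commute
and the link is trivial. If both are, the link is the square of `v⁻¹`. If none is, `v` is its own
inverse, as in `tag_sq_ne_one`. -/
theorem tag_ne_inv {p : P} {v x y : G} (hv : IsPrimitive (reflLink s (p, p, v)))
    (hx : x = 1 ∨ x = s p) (hy : y = 1 ∨ y = s p) : x * v * y ≠ v⁻¹ := by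
  intro h
  have hfin : ¬ IsOfFinOrder (s p * v * s p * v⁻¹) := hv.1
  have hcomm : Commute (s p) v → False := by
    intro hc
    apply hfin
    rw [hc.eq, mul_assoc v, hs.mul_self, mul_one, mul_inv_cancel]
    exact IsOfFinOrder.one
  rcases hx with rfl | rfl <;> rcases hy with rfl | rfl
  · refine tag_sq_ne_one hv (x := 1) (y := 1) (Or.inl rfl) (Or.inl rfl) ?_
    nth_rewrite 1 [h]
    simp
  · apply hcomm
    have : s p = v⁻¹ * v⁻¹ := by
      have : s p = v⁻¹ * (1 * v * s p) := by group
      rwa [h] at this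
    rw [this]
    exact ((Commute.refl v).inv_left.mul_left (Commute.refl v).inv_left)
  · apply hcomm
    have : s p = v⁻¹ * v⁻¹ := by
      have : s p = (s p * v * 1) * v⁻¹ := by group
      rwa [h] at this
    rw [this]
    exact ((Commute.refl v).inv_left.mul_left (Commute.refl v).inv_left)
  · refine not_isPrimitive_sq v⁻¹ (hv.conj (h := 1) ?_)
    rw [one_mul, inv_one, mul_one, reflLink]
    change _ = s p * v * s p * v⁻¹
    rw [h]

end IsReflectionSystem

/-- A group which embeds into the universal Coxeter group, in such a way that its involutions are
the conjugates of the `s p`, which go to conjugates of distinct letters. -/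
theorem isReflectionSystem_of_injective {I : Type*} [DecidableEq I] {s : P → G}
    (θ : G →* Equiv.Perm (ReducedWord I)) (hθ : Function.Injective θ)
    (hword : ∀ g, ∃ l, θ g = wordProd l) (i : P → I) (hi : Function.Injective i)
    (hletter : ∀ p, ∃ l, θ (s p) = wordProd l * letter (i p) * (wordProd l)⁻¹)
    (hinv : ∀ g : G, g * g = 1 → g ≠ 1 → ∃ p h, g = h * s p * h⁻¹) : IsReflectionSystem s where
  mul_self p := by
    obtain ⟨l, hl⟩ := hletter p
    apply hθ
    rw [map_mul, hl, map_one]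
    calc wordProd l * letter (i p) * (wordProd l)⁻¹ * (wordProd l * letter (i p) * (wordProd l)⁻¹)
        = wordProd l * (letter (i p) * letter (i p)) * (wordProd l)⁻¹ := by group
      _ = 1 := by rw [letter_mul_self]; group
  cyclic γ g hγ hc := by
    obtain ⟨l, hl⟩ := hword γ
    obtain ⟨m, hm⟩ := hword g
    obtain ⟨z, h1, h2⟩ := exists_zpowers_of_commute l m
      (by rwa [← hl, hθ.isOfFinOrder_iff]) (by
        rw [← hl, ← hm]; exact hc.map θ)
    -- The root `z` need not be in the image of `θ`; the preimage of the group it generates is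
    -- nevertheless cyclic, since it embeds in that group.
    refine ⟨(Subgroup.zpowers z).comap θ, ?_, ?_, ?_⟩
    · exact isCyclic_of_injective (θ.subgroupComap (Subgroup.zpowers z)) (fun a b h => by
        apply Subtype.ext
        apply hθ
        exact congrArg Subtype.val h)
    · rwa [Subgroup.mem_comap, hl]
    · rwa [Subgroup.mem_comap, hm]
  involution := hinv
  conj p q h hpq := by
    obtain ⟨l, hl⟩ := hletter p
    obtain ⟨m, hm⟩ := hletter q
    obtain ⟨k, hk⟩ := hword h
    have := congrArg θ hpq
    rw [map_mul, map_mul, map_inv, hl, hm, hk] at this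
    apply hi
    apply letter_conj_injective (m := m.reverse ++ (k ++ l))
    rw [wordProd_append, wordProd_append, wordProd_reverse]
    calc (wordProd m)⁻¹ * (wordProd k * wordProd l) * letter (i p)
        = (wordProd m)⁻¹ * (wordProd k * (wordProd l * letter (i p) * (wordProd l)⁻¹) *
          (wordProd k)⁻¹) * wordProd k * wordProd l := by group
      _ = _ := by rw [this]; group
  commute p g hc := by
    obtain ⟨l, hl⟩ := hletter p
    obtain ⟨m, hm⟩ := hword g
    have h1 : Commute (letter (i p)) (wordProd (l.reverse ++ (m ++ l))) := by
      have h2 := (hc.map θ).eq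
      rw [hl, hm] at h2
      rw [wordProd_append, wordProd_append, wordProd_reverse]
      change letter (i p) * ((wordProd l)⁻¹ * (wordProd m * wordProd l)) =
        (wordProd l)⁻¹ * (wordProd m * wordProd l) * letter (i p)
      calc letter (i p) * ((wordProd l)⁻¹ * (wordProd m * wordProd l))
          = (wordProd l)⁻¹ * (wordProd l * letter (i p) * (wordProd l)⁻¹ * wordProd m) *
            wordProd l := by group
        _ = _ := by rw [h2]; group
    have h3 : θ g = wordProd l * wordProd (l.reverse ++ (m ++ l)) * (wordProd l)⁻¹ := by
      rw [hm, wordProd_append, wordProd_append, wordProd_reverse]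
      group
    rcases eq_of_commute_letter h1 with h | h
    · left
      apply hθ
      rw [h3, h]
      simp
    · right
      apply hθ
      rw [h3, h, hl]
  ne_one p := by
    intro h
    obtain ⟨l, hl⟩ := hletter p
    rw [h, map_one] at hl
    have h1 : letter (i p) = 1 := by
      calc letter (i p) = (wordProd l)⁻¹ * (wordProd l * letter (i p) * (wordProd l)⁻¹) *
            wordProd l := by group
        _ = 1 := by rw [← hl]; group
    have h2 := wordProd_injOn (List.isChain_singleton (i p)) List.isChain_nil (by simpa using h1)
    simp at h2

end Reflections

end OrbSurface

namespace OrbSurface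

/-! ### Edge paths in a groupoid and their words -/

section EdgeWords

variable {𝒢 : Type*} [Groupoid 𝒢] {V A : Type*} {b : V → 𝒢}

/-- The morphism `g` is the composite of the edges of the list `l`, the first of which is the last
element of the list. The relation `E s f` says that `f` is the edge `s`. -/
inductive Realizes (E : A → ∀ T T' : V, (b T ⟶ b T') → Prop) :
    ∀ {T T' : V}, (b T ⟶ b T') → List A → Prop
  | nil (T : V) : Realizes E (𝟙 (b T)) []
  | cons {T T' T'' : V} {g : b T ⟶ b T'} {l : List A} (s : A) {f : b T' ⟶ b T''} :
      Realizes E g l → E s T' T'' f → Realizes E (g ≫ f) (s :: l)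

variable {E : A → ∀ T T' : V, (b T ⟶ b T') → Prop}

theorem Realizes.nil_inv {T T' : V} {g : b T ⟶ b T'} (h : Realizes E g []) :
    ∃ h : T = T', g = eqToHom (congrArg b h) := by
  cases h
  exact ⟨rfl, rfl⟩

theorem Realizes.cons_inv {T T' : V} {g : b T ⟶ b T'} {s : A} {l : List A}
    (h : Realizes E g (s :: l)) : ∃ (T₁ : V) (g' : b T ⟶ b T₁) (f : b T₁ ⟶ b T'),
      Realizes E g' l ∧ E s T₁ T' f ∧ g = g' ≫ f := by
  cases h with
  | cons _ h1 h2 => exact ⟨_, _, _, h1, h2, rfl⟩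

theorem Realizes.append_inv {t : A} {l : List A} {T T' : V} {g : b T ⟶ b T'}
    (h : Realizes E g (l ++ [t])) : ∃ (T₁ : V) (f : b T ⟶ b T₁) (g' : b T₁ ⟶ b T'),
      E t T T₁ f ∧ Realizes E g' l ∧ g = f ≫ g' := by
  induction l generalizing T' with
  | nil =>
    obtain ⟨T₁, g', f, h1, h2, rfl⟩ := h.cons_inv
    obtain ⟨rfl, rfl⟩ := h1.nil_inv
    exact ⟨_, f, 𝟙 _, h2, .nil _, by simp⟩
  | cons s l ih =>
    obtain ⟨T₁, g', f, h1, h2, rfl⟩ := h.cons_inv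
    obtain ⟨T₂, f', g'', h3, h4, rfl⟩ := ih h1
    exact ⟨T₂, f', g'' ≫ f, h3, .cons s h4 h2, by simp⟩

/-- The words in the letters of the universal Coxeter group which correspond to the edges, such that
an edge whose word is not reduced is trivial, and that the composite of two edges between whose words
there is a cancellation is trivial. -/
structure EdgeLetters (E : A → ∀ T T' : V, (b T ⟶ b T') → Prop) (letters : A → List A) :
    Prop where
  ne_nil : ∀ s, letters s ≠ []
  length_le : ∀ s, (letters s).length ≤ 2
  fix : ∀ (s : A) (T T' : V) (f : b T ⟶ b T'), ¬ (letters s).IsChain (· ≠ ·) → E s T T' f →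
    ∃ h : T = T', f = eqToHom (congrArg b h)
  cancel : ∀ (s t : A) (T T' T'' : V) (f : b T ⟶ b T') (g : b T' ⟶ b T''), E s T T' f →
    E t T' T'' g → (letters t).getLast? = (letters s).head? →
      ∃ h : T = T'', f ≫ g = eqToHom (congrArg b h)

variable {letters : A → List A} (hL : EdgeLetters E letters)
include hL

theorem EdgeLetters.head?_flatMap (s : A) (l : List A) :
    ((s :: l).flatMap letters).head? = (letters s).head? := by
  rw [List.flatMap_cons, List.head?_append]
  cases h : letters s with
  | nil => exact absurd h (hL.ne_nil s)
  | cons => simp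

theorem EdgeLetters.getLast?_flatMap (s : A) (l : List A) :
    ((l ++ [s]).flatMap letters).getLast? = (letters s).getLast? := by
  rw [List.flatMap_append, List.flatMap_singleton, List.getLast?_append]
  rcases (letters s).eq_nil_or_concat with h | ⟨k, j, h⟩
  · exact absurd h (hL.ne_nil s)
  · simp [h]

/-- When an edge is added to a reduced edge path, only the junction can cancel, and then the two
edges meeting there compose to the identity and are dropped together. -/
theorem EdgeLetters.exists_reduced {T T' : V} {g : b T ⟶ b T'} {l : List A}
    (h : Realizes E g l) : ∃ l', Realizes E g l' ∧ (l'.flatMap letters).IsChain (· ≠ ·) := by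
  induction h with
  | nil => exact ⟨[], .nil T, List.isChain_nil⟩
  | @cons T' T'' g l s f h hf ih =>
    obtain ⟨m, hm, hc⟩ := ih
    by_cases hs : (letters s).IsChain (· ≠ ·)
    · by_cases hcs : ((s :: m).flatMap letters).IsChain (· ≠ ·)
      · exact ⟨_, .cons s hm hf, hcs⟩
      · cases m with
        | nil => simp [hs] at hcs
        | cons t m =>
          have hlast : (letters s).getLast? = (letters t).head? := by
            by_contra hne
            apply hcs
            rw [List.flatMap_cons, List.isChain_append]
            refine ⟨hs, hc, ?_⟩
            rintro x hx y hy rfl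
            rw [hL.head?_flatMap] at hy
            exact hne (hx.trans hy.symm)
          obtain ⟨T₁, g', f', h1, h2, rfl⟩ := hm.cons_inv
          obtain ⟨rfl, h3⟩ := hL.cancel t s _ _ _ f' f h2 hf hlast
          refine ⟨m, ?_, ?_⟩
          · rw [Category.assoc, h3]
            simpa using h1
          · rw [List.flatMap_cons, List.isChain_append] at hc
            exact hc.2.1
    · obtain ⟨rfl, rfl⟩ := hL.fix s _ _ f hs hf
      exact ⟨m, by simpa using hm, hc⟩

variable [DecidableEq A] (θ : ∀ {x y : 𝒢}, (x ⟶ y) → Equiv.Perm (ReducedWord A))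
  (hθ_id : ∀ x : 𝒢, θ (𝟙 x) = 1)
  (hθ_comp : ∀ {x y z : 𝒢} (f : x ⟶ y) (g : y ⟶ z), θ (f ≫ g) = θ g * θ f)
  (hθ : ∀ (s : A) (T T' : V) (f : b T ⟶ b T'), E s T T' f → θ f = wordProd (letters s))
include hθ_id hθ_comp hθ

omit hL in
theorem Realizes.theta_eq {T T' : V} {g : b T ⟶ b T'} {l : List A} (h : Realizes E g l) :
    θ g = wordProd (l.flatMap letters) := by
  induction h with
  | nil => simp [hθ_id]
  | cons s h hf ih => rw [hθ_comp, hθ _ _ _ _ hf, ih, List.flatMap_cons, wordProd_append]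

/-- The image of a reduced edge path is a reduced word, which is trivial only when empty; as every
edge has at least one letter, the path is then empty. -/
theorem EdgeLetters.eq_of_theta {T : V} {g : b T ⟶ b T} {l : List A} (h : Realizes E g l)
    (h1 : θ g = 1) : g = 𝟙 (b T) := by
  obtain ⟨m, hm, hc⟩ := hL.exists_reduced h
  rw [hm.theta_eq θ hθ_id hθ_comp hθ, ← wordProd_nil] at h1
  have h2 := wordProd_injOn hc List.isChain_nil h1
  cases m with
  | nil => exact hm.nil_inv.2
  | cons s m =>
    rw [List.flatMap_cons, List.append_eq_nil_iff] at h2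
    exact absurd h2.1 (hL.ne_nil s)

/-- An involution is conjugate to an edge which corresponds to a single letter. -/
theorem EdgeLetters.exists_edge_of_involution {T : V} {g : b T ⟶ b T} {l : List A}
    (h : Realizes E g l) (h1 : g ≫ g = 𝟙 _) (hne : g ≠ 𝟙 _) :
    ∃ (T₁ : V) (s : A) (f : b T₁ ⟶ b T₁) (k : b T ⟶ b T₁), E s T₁ T₁ f ∧
      (letters s).length = 1 ∧ g ≫ k = k ≫ f := by
  wlog hc : (l.flatMap letters).IsChain (· ≠ ·) generalizing l
  · obtain ⟨m, hm, hc⟩ := hL.exists_reduced h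
    exact this hm hc
  induction hn : l.length using Nat.strong_induction_on generalizing T l with
  | _ n ih =>
    rcases l with - | ⟨s, l⟩
    · exact absurd h.nil_inv.2 hne
    -- Since `g` squares to the identity, the doubled word cannot be reduced, and its only possible
    -- defect is at the junction.
    have hlast : ((s :: l).flatMap letters).getLast? = ((s :: l).flatMap letters).head? := by
      by_contra hlast
      have h2 : ((s :: l).flatMap letters ++ (s :: l).flatMap letters).IsChain (· ≠ ·) := by
        rw [List.isChain_append]
        refine ⟨hc, hc, ?_⟩
        rintro x hx y hy rfl
        exact hlast (hx.trans hy.symm)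
      have h3 := wordProd_injOn h2 List.isChain_nil (by
        rw [wordProd_append, ← h.theta_eq θ hθ_id hθ_comp hθ, ← hθ_comp, h1, hθ_id, wordProd_nil])
      rw [List.append_eq_nil_iff, List.flatMap_cons, List.append_eq_nil_iff] at h3
      exact hL.ne_nil s h3.1.1
    rw [hL.head?_flatMap] at hlast
    rcases l.eq_nil_or_concat with rfl | ⟨m, t, rfl⟩
    · obtain ⟨T₁, g', f, h3, h2, rfl⟩ := h.cons_inv
      obtain ⟨rfl, rfl⟩ := h3.nil_inv
      refine ⟨_, s, f, 𝟙 _, h2, ?_, by simp⟩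
      rw [List.flatMap_singleton] at hlast hc
      have h3 := hL.length_le s
      -- A reduced word of exactly two letters cannot have equal ends, so only one letter is left.
      match hl : letters s with
      | [] => exact absurd hl (hL.ne_nil s)
      | [a] => rfl
      | [a, b] =>
        rw [hl] at hc hlast
        simp at hc hlast
        exact absurd hlast.symm hc
      | a :: b :: c :: t =>
        rw [hl] at h3
        simp at h3
    · rw [List.concat_eq_append] at *
      rw [← List.cons_append, hL.getLast?_flatMap] at hlast
      obtain ⟨T₁, g', f, h3, h4, rfl⟩ := h.cons_inv
      obtain ⟨T₂, f', g'', h5, h6, rfl⟩ := h3.append_inv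
      obtain ⟨rfl, h7⟩ := hL.cancel s t _ _ _ f f' h4 h5 hlast
      -- The outer edges are mutually inverse, so `g` is conjugate to the involution `g''`, which
      -- has a shorter edge path.
      simp only [eqToHom_refl] at h7
      obtain rfl : f = inv f' := by
        rw [← cancel_mono f', h7, IsIso.inv_hom_id]
      have hsq : g'' ≫ g'' = 𝟙 _ := by
        simp only [Category.assoc, IsIso.inv_hom_id_assoc] at h1
        rw [← cancel_epi f', ← cancel_mono (inv f')]
        simpa using h1
      have hne' : g'' ≠ 𝟙 _ := by
        rintro rfl
        apply hne
        simp
      obtain ⟨T₃, s', f₃, k, h10, h11, h12⟩ := ih m.length (by simp at hn; omega) hsq hne' h6 (by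
        rw [List.flatMap_cons, List.isChain_append, List.flatMap_append,
          List.isChain_append] at hc
        exact hc.2.1.1) rfl
      refine ⟨T₃, s', f₃, f' ≫ k, h10, h11, ?_⟩
      simp [h12]

end EdgeWords

end OrbSurface

namespace OrbSurface

/-! ### Covering spaces with two charts and induction along paths -/

section Monodromy

open Topology Bundle

variable {Y : Type*} [TopologicalSpace Y] {U V : Set Y} {Φ : Type*}

open Classical in
/-- The bundle with fibre `Φ` which is trivial on the open sets `U` and `V`, with transition function
`g` on `U ∩ V`. -/
noncomputable def twoChartCore [TopologicalSpace Φ] [DiscreteTopology Φ] (hU : IsOpen U) (hV : IsOpen V)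
    (hUV : ∀ x, x ∈ U ∨ x ∈ V) (g : Y → Equiv.Perm Φ)
    (hg : ∀ x ∈ U ∩ V, ∀ᶠ y in 𝓝 x, g y = g x) : FiberBundleCore Bool Y Φ where
  baseSet i := cond i U V
  isOpen_baseSet i := by cases i <;> assumption
  indexAt x := decide (x ∈ U)
  mem_baseSet_at x := by
    by_cases h : x ∈ U
    · simp [h]
    · simpa [h] using (hUV x).resolve_left h
  -- Index `true` stands for `U`, and `g x` is the change from the coordinate of `U` to that of `V`.
  -- Over a point of `U` the preferred coordinate is that of `U`.
  coordChange i j x v := (cond j 1 (g x) : Equiv.Perm Φ) ((cond i 1 (g x) : Equiv.Perm Φ)⁻¹ v)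
  coordChange_self i x _ v := by simp
  coordChange_comp i j k x _ v := by simp
  continuousOn_coordChange i j := by
    by_cases hij : i = j
    · subst hij
      simpa using continuous_snd.continuousOn
    · have hmem : ∀ x, x ∈ (cond i U V : Set Y) ∩ (cond j U V : Set Y) → x ∈ U ∩ V := by
        intro x hx
        cases i <;> cases j <;> simp_all
      intro p hp
      apply ContinuousAt.continuousWithinAt
      have h1 := hg p.1 (hmem _ hp.1)
      have h2 : ∀ᶠ q in 𝓝 p, g q.1 = g p.1 ∧ q.2 = p.2 := by
        rw [nhds_prod_eq]
        exact h1.prod_mk (show ∀ᶠ v in 𝓝 p.2, v = p.2 by rw [nhds_discrete]; rfl)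
      refine continuousAt_const.congr (f := fun _ =>
        (cond j 1 (g p.1) : Equiv.Perm Φ) ((cond i 1 (g p.1) : Equiv.Perm Φ)⁻¹ p.2)) ?_
      filter_upwards [h2] with q hq
      rw [hq.1, hq.2]

open Classical in
/-- The monodromy of the bundle with two charts. -/
theorem exists_monodromy (hU : IsOpen U) (hV : IsOpen V)
    (hUV : ∀ x, x ∈ U ∨ x ∈ V) (g : Y → Equiv.Perm Φ)
    (hg : ∀ x ∈ U ∩ V, ∀ᶠ y in 𝓝 x, g y = g x) :
    ∃ θ : ∀ {x y : Y}, Path.Homotopic.Quotient x y → Equiv.Perm Φ,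
      (∀ x, θ (.refl x) = 1) ∧
      (∀ {x y z : Y} (γ : Path.Homotopic.Quotient x y) (δ : Path.Homotopic.Quotient y z),
        θ (γ.trans δ) = θ δ * θ γ) ∧
      (∀ {x y : Y} (γ : Path x y), (∀ t, γ t ∈ U) → θ (.mk γ) = 1) ∧
      (∀ {x y : Y} (γ : Path x y), (∀ t, γ t ∈ V) → θ (.mk γ) =
        (if y ∈ U then g y else 1)⁻¹ * (if x ∈ U then g x else 1)) := by
  let _ : TopologicalSpace Φ := ⊥
  have _ : DiscreteTopology Φ := ⟨rfl⟩
  let Z := twoChartCore hU hV hUV g hg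
  have cov : IsCoveringMap Z.proj := FiberBundle.isCoveringMap (F := Φ) (E := Z.Fiber)
  let pt : ∀ x : Y, Φ → Z.proj ⁻¹' {x} := fun x v => ⟨⟨x, v⟩, rfl⟩
  have hpt : ∀ {x : Y} (e : Z.proj ⁻¹' {x}), pt x e.1.2 = e := by
    rintro x ⟨⟨y, v⟩, hy⟩
    cases hy
    rfl
  let T : ∀ {x y : Y}, Path.Homotopic.Quotient x y → Φ → Φ := fun {x y} γ v =>
    (cov.monodromy γ (pt x v)).1.2
  have Trefl : ∀ x v, T (.refl x) v = v := by
    intro x v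
    change (cov.monodromy (.refl x) (pt x v)).1.2 = v
    rw [cov.monodromy_refl]
    rfl
  have Ttrans : ∀ {x y z : Y} (γ : Path.Homotopic.Quotient x y)
      (δ : Path.Homotopic.Quotient y z) (v), T (γ.trans δ) v = T δ (T γ v) := by
    intro x y z γ δ v
    change (cov.monodromy (γ.trans δ) (pt x v)).1.2 = (cov.monodromy δ (pt y _)).1.2
    rw [cov.monodromy_trans_apply, hpt]
  let θ : ∀ {x y : Y}, Path.Homotopic.Quotient x y → Equiv.Perm Φ := fun {x y} γ =>
    { toFun := T γ
      invFun := T γ.symm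
      left_inv := fun v => by rw [← Ttrans, Path.Homotopic.Quotient.trans_symm, Trefl]
      right_inv := fun v => by rw [← Ttrans, Path.Homotopic.Quotient.symm_trans, Trefl] }
  -- A path inside one chart lifts with constant coordinate in that chart, so its monodromy only
  -- compares the preferred coordinates at the two ends.
  have key : ∀ (i : Bool) {x y : Y} (γ : Path x y), (∀ t, γ t ∈ Z.baseSet i) → ∀ v,
      T (.mk γ) (Z.coordChange i (Z.indexAt x) x v) = Z.coordChange i (Z.indexAt y) y v := by
    intro i x y γ hγ v
    let Γ : unitInterval → Z.TotalSpace := fun t => ⟨γ t, Z.coordChange i (Z.indexAt (γ t)) (γ t) v⟩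
    have hΓ : Continuous Γ := by
      have h1 := (Z.localTriv i).continuousOn_invFun
      refine h1.comp_continuous (f := fun t => (γ t, v)) (by fun_prop) ?_
      intro t
      exact ⟨hγ t, Set.mem_univ _⟩
    have h2 := (cov.eq_liftPath_iff (γ := γ.toContinuousMap)
      (e := (⟨x, Z.coordChange i (Z.indexAt x) x v⟩ : Z.TotalSpace)) γ.source (Γ := Γ)).2
      ⟨hΓ, rfl, by simp only [Γ]; rw [γ.source]⟩
    have h3 := congrFun h2 1
    change (cov.liftPath γ.toContinuousMap (⟨x, Z.coordChange i (Z.indexAt x) x v⟩ : Z.TotalSpace)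
      γ.source 1).2 = _
    rw [← h3]
    change Z.coordChange i (Z.indexAt (γ 1)) (γ 1) v = _
    rw [γ.target]
  refine ⟨θ, fun x => Equiv.ext (Trefl x), fun γ δ => Equiv.ext (Ttrans γ δ), ?_, ?_⟩
  · intro x y γ hγ
    have hx : x ∈ U := by simpa using hγ 0
    have hy : y ∈ U := by simpa using hγ 1
    refine Equiv.ext fun v => ?_
    have := key true γ hγ v
    change T (.mk γ) v = v
    simpa [Z, twoChartCore, hx, hy] using this
  · intro x y γ hγ
    have hx : x ∈ V := by simpa using hγ 0
    have hy : y ∈ V := by simpa using hγ 1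
    refine Equiv.ext fun v => ?_
    have := key false γ hγ ((if x ∈ U then g x else 1) v)
    change T (.mk γ) v = _
    by_cases hx : x ∈ U <;> by_cases hy : y ∈ U <;>
      simpa [Z, twoChartCore, hx, hy] using this

/-- A property of homotopy classes of paths which is stable under composition holds as soon as it
holds for the paths which lie in one of the sets of an open cover. -/
theorem path_induction {ι : Type*} {c : ι → Set Y} (hc : ∀ i, IsOpen (c i)) (hcov : ∀ x, ∃ i, x ∈ c i)
    (p : ∀ {x y : Y}, Path.Homotopic.Quotient x y → Prop)
    (hcomp : ∀ {x y z : Y} (γ : Path.Homotopic.Quotient x y) (δ : Path.Homotopic.Quotient y z),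
      p γ → p δ → p (γ.trans δ))
    (hp : ∀ (i : ι) {x y : Y} (γ : Path x y), (∀ t, γ t ∈ c i) → p (.mk γ))
    {x y : Y} (γ : Path x y) : p (.mk γ) := by
  -- A Lebesgue subdivision: each piece lies in one set of the cover, and the subdivision points are
  -- equal to `1` from the index `n` on.
  obtain ⟨t, t0, tmono, ⟨n, hn⟩, ht⟩ := exists_monotone_Icc_subset_open_cover_unitInterval
    (c := fun i => γ ⁻¹' c i) (fun i => (hc i).preimage γ.continuous) (by
      intro s _
      obtain ⟨i, hi⟩ := hcov (γ s)
      exact Set.mem_iUnion.2 ⟨i, hi⟩)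
  have key : ∀ m, p (.mk (γ.subpath (t 0) (t m))) := by
    intro m
    induction m with
    | zero =>
      obtain ⟨i, hi⟩ := hcov (γ (t 0))
      refine hp i _ fun s => ?_
      rw [Path.subpath_self]
      exact hi
    | succ m ih =>
      obtain ⟨i, hi⟩ := ht m
      have h1 : p (.mk (γ.subpath (t m) (t (m + 1)))) := by
        refine hp i _ fun s => ?_
        have h2 : γ.subpath (t m) (t (m + 1)) s ∈ Set.range (γ.subpath (t m) (t (m + 1))) := ⟨s, rfl⟩
        rw [Path.range_subpath_of_le _ _ _ (tmono m.le_succ)] at h2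
        obtain ⟨s', hs', h3⟩ := h2
        rw [← h3]
        exact hi hs'
      have h2 := hcomp _ _ ih h1
      rw [← Path.Homotopic.Quotient.mk_trans] at h2
      rwa [Path.Homotopic.Quotient.eq.2 ⟨Path.Homotopy.subpathTransSubpath γ (t 0) (t m) (t (m + 1))⟩]
        at h2
  have h := key n
  rw [hn n le_rfl, t0, Path.subpath_zero_one] at h
  have : ∀ {x' y' : Y} (hx : x' = x) (hy : y' = y), p (.mk (γ.cast hx hy)) → p (.mk γ) := by
    rintro _ _ rfl rfl h
    exact h
  exact this _ _ h

end Monodromy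

end OrbSurface

namespace OrbSurface

/-! ### Barycentric coordinates and sectors -/

section Coordinates

theorem fin_three_cases (i k : Fin 3) : k = i ∨ k = i + 1 ∨ k = i + 2 := by
  revert i k
  decide

theorem fin_three_ne (i : Fin 3) : i + 1 ≠ i ∧ i + 2 ≠ i ∧ i + 2 ≠ i + 1 := by
  revert i
  decide

theorem fin_three_add (i : Fin 3) : i + 1 + 1 = i + 2 ∧ i + 1 + 2 = i ∧ i + 2 + 1 = i ∧
    i + 2 + 2 = i + 1 := by
  revert i
  decide

theorem triangle_sum (p : Triangle) (i : Fin 3) : p i + p (i + 1) + p (i + 2) = 1 := by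
  have h : ∑ k, p k = 1 := p.2.2
  rw [Fin.sum_univ_three] at h
  fin_cases i <;> simp <;> linarith

theorem triangle_nonneg (p : Triangle) (i : Fin 3) : 0 ≤ p i := p.2.1 i

theorem triangle_ext {p q : Triangle} (i : Fin 3) (h0 : p i = q i) (h1 : p (i + 1) = q (i + 1))
    (h2 : p (i + 2) = q (i + 2)) : p = q := by
  apply Subtype.ext
  funext k
  rcases fin_three_cases i k with rfl | rfl | rfl
  exacts [h0, h1, h2]

theorem triangle_continuous (i : Fin 3) : Continuous fun p : Triangle => p i :=
  (continuous_apply i).comp continuous_subtype_val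

/-- The point whose coordinates `i`, `i + 1`, `i + 2` are `x`, `y`, `z`. -/
def trianglePt (i : Fin 3) (x y z : ℝ) (hx : 0 ≤ x) (hy : 0 ≤ y) (hz : 0 ≤ z)
    (h : x + y + z = 1) : Triangle :=
  ⟨fun k => if k = i then x else if k = i + 1 then y else z, by
    constructor
    · intro k
      dsimp only
      split_ifs <;> assumption
    · fin_cases i <;> simp [Fin.sum_univ_three] <;> linarith⟩

section
variable {i : Fin 3} {x y z : ℝ} {hx : 0 ≤ x} {hy : 0 ≤ y} {hz : 0 ≤ z} {h : x + y + z = 1}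

@[simp] theorem trianglePt_zero : trianglePt i x y z hx hy hz h i = x := if_pos rfl

@[simp] theorem trianglePt_one : trianglePt i x y z hx hy hz h (i + 1) = y := by
  change (if i + 1 = i then x else if i + 1 = i + 1 then y else z) = y
  rw [if_neg (fin_three_ne i).1, if_pos rfl]

@[simp] theorem trianglePt_two : trianglePt i x y z hx hy hz h (i + 2) = z := by
  change (if i + 2 = i then x else if i + 2 = i + 1 then y else z) = z
  rw [if_neg (fin_three_ne i).2.1, if_neg (fin_three_ne i).2.2]

end

theorem continuous_trianglePt {Z : Type*} [TopologicalSpace Z] (i : Fin 3) {x y z : Z → ℝ}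
    (hx : Continuous x) (hy : Continuous y) (hz : Continuous z) (h0 : ∀ a, 0 ≤ x a)
    (h1 : ∀ a, 0 ≤ y a) (h2 : ∀ a, 0 ≤ z a) (h : ∀ a, x a + y a + z a = 1) :
    Continuous fun a => trianglePt i (x a) (y a) (z a) (h0 a) (h1 a) (h2 a) (h a) := by
  refine Continuous.subtype_mk ?_ _
  refine continuous_pi fun k => ?_
  split_ifs <;> assumption

/-- The points of the triangle which are closer to the side `k` than to the other sides. -/
def sector (k : Fin 3) : Set Triangle := {p | p (k + 2) < p k ∧ p (k + 2) < p (k + 1)}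

theorem isOpen_sector (k : Fin 3) : IsOpen (sector k) :=
  (isOpen_lt (triangle_continuous _) (triangle_continuous _)).inter
    (isOpen_lt (triangle_continuous _) (triangle_continuous _))

/-- The strictly smallest coordinate of a point is unique. -/
theorem eq_of_mem_sector {k l : Fin 3} {p : Triangle} (hk : p ∈ sector k) (hl : p ∈ sector l) :
    k = l := by
  obtain ⟨h1, h2⟩ := hk
  obtain ⟨h3, h4⟩ := hl
  rcases fin_three_cases k l with rfl | rfl | rfl
  · rfl
  · rw [(fin_three_add k).1, (fin_three_add k).2.1] at *
    linarith
  · rw [(fin_three_add k).2.2.1, (fin_three_add k).2.2.2] at *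
    linarith

theorem ne_one_of_mem_sector {k : Fin 3} {p : Triangle} (hk : p ∈ sector k) (l : Fin 3) :
    p l ≠ 1 := by
  obtain ⟨h1, h2⟩ := hk
  have h3 := triangle_sum p k
  have h4 := triangle_nonneg p (k + 2)
  rcases fin_three_cases k l with rfl | rfl | rfl <;> intro h <;> linarith

/-- A point which is on a side and is not a vertex is in the sector of the side. -/
theorem mem_sector_of_side {k : Fin 3} {p : Triangle} (hp : ∀ l, p l ≠ 1) (h : p (k + 2) = 0) :
    p ∈ sector k := by
  have h3 := triangle_sum p k
  have h4 := triangle_nonneg p k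
  have h5 := triangle_nonneg p (k + 1)
  have h6 := hp k
  have h7 := hp (k + 1)
  constructor
  · rw [h]
    refine lt_of_le_of_ne h4 fun h8 => h7 (by linarith)
  · rw [h]
    refine lt_of_le_of_ne h5 fun h8 => h6 (by linarith)

end Coordinates

/-! ### Fibres of the gluing map and open sets of the surface -/

section Gluing

variable {n : ℕ} {mate : Fin n × Fin 3 → Fin n × Fin 3}

theorem Glue.symm (hm : ∀ s, mate (mate s) = s) {a b : Fin n × Triangle} (h : Glue mate a b) :
    Glue mate b a := by
  obtain ⟨i, j, h1, h2, h3, h4, h5, h6⟩ := h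
  exact ⟨j, i, by rw [← h1, hm], h2.symm, h4, h3, h6.symm, h5.symm⟩

theorem Glue.ne_one {a b : Fin n × Triangle} (h : Glue mate a b) (ha : ∀ k, a.2 k ≠ 1) (k : Fin 3) :
    b.2 k ≠ 1 := by
  intro hk
  obtain ⟨l, hl⟩ := (Glue.vertex_iff (Relation.EqvGen.rel _ _ h)).2 ⟨k, hk⟩
  exact ha l hl

theorem Glue.eq_of_glue (hm : ∀ s, mate (mate s) = s) {a b c : Fin n × Triangle}
    (hab : Glue mate a b) (hbc : Glue mate b c) (ha : ∀ k, a.2 k ≠ 1) : a = c := by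
  have hb := hab.ne_one ha
  obtain ⟨i, j, h1, -, h3, h4, h5, h6⟩ := hab
  obtain ⟨j', k, h1', -, h3', h4', h5', h6'⟩ := hbc
  -- A point which is not a vertex lies on at most one side, so the second gluing starts from the
  -- side reached by the first, and undoes it.
  have hj : j = j' := eq_of_mem_sector (mem_sector_of_side hb h4) (mem_sector_of_side hb h3')
  subst hj
  have h7 : (a.1, i) = (c.1, k) := by rw [← h1', ← h1, hm]
  have h8 : a.1 = c.1 := (Prod.mk.inj h7).1
  have h9 : i = k := (Prod.mk.inj h7).2
  subst h9
  refine Prod.ext h8 (triangle_ext i ?_ ?_ ?_)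
  · rw [h6', h5]
  · rw [h5', h6]
  · rw [h3, h4']

/-- The fibres of the gluing map outside of the vertices. -/
theorem eqvGen_glue (hm : ∀ s, mate (mate s) = s) {a b : Fin n × Triangle}
    (h : Relation.EqvGen (Glue mate) a b) (ha : ∀ k, a.2 k ≠ 1) : a = b ∨ Glue mate a b := by
  have key : ∀ a b, Relation.EqvGen (Glue mate) a b → (∀ k, a.2 k ≠ 1) →
      a = b ∨ Glue mate a b := by
    intro a b h
    induction h with
    | rel a b h => exact fun _ => Or.inr h
    | refl a => exact fun _ => Or.inl rfl
    | symm a b h ih =>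
      intro hb
      have ha : ∀ k, a.2 k ≠ 1 := fun k hk => by
        obtain ⟨l, hl⟩ := (Glue.vertex_iff h).1 ⟨k, hk⟩
        exact hb l hl
      rcases ih ha with rfl | h1
      · exact Or.inl rfl
      · exact Or.inr (h1.symm hm)
    | trans a b c h1 h2 ih1 ih2 =>
      intro ha
      rcases ih1 ha with rfl | h3
      · exact ih2 ha
      · rcases ih2 (h3.ne_one ha) with rfl | h4
        · exact Or.inr h3
        · exact Or.inl (h3.eq_of_glue hm h4 ha)
  exact key a b h ha

end Gluing

section Surface

variable {S : Type*} [TopologicalSpace S] [ChartedSpace (EuclideanHalfSpace 2) S]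
  {X : MarkedSurface S}

namespace IdealTriangulation

variable (τ : IdealTriangulation X)

theorem chi_eq {T T' : Fin τ.n} {p p' : Triangle} (hp : ∀ k, p k ≠ 1)
    (h : τ.chi T p = τ.chi T' p') : (T, p) = (T', p') ∨ Glue τ.mate (T, p) (T', p') :=
  eqvGen_glue τ.mate_mate ((τ.chi_eq_iff _ _ _ _).1 h) hp

/-- A set is open as soon as its inverse images in the triangles are open. -/
theorem isOpen_of_preimage [T2Space S] {O : Set S} (h : ∀ T, IsOpen (τ.chi T ⁻¹' O)) : IsOpen O := by
  rw [← isClosed_compl_iff]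
  have : Oᶜ = ⋃ T, τ.chi T '' (τ.chi T ⁻¹' O)ᶜ := by
    ext x
    obtain ⟨T, p, rfl⟩ := τ.chi_surjective x
    constructor
    · intro hx
      exact Set.mem_iUnion.2 ⟨T, p, hx, rfl⟩
    · intro hx
      obtain ⟨T', q, hq, h1⟩ := Set.mem_iUnion.1 hx
      rw [← h1]
      exact hq
  rw [this]
  refine isClosed_iUnion_of_finite fun T => ?_
  exact (((h T).isClosed_compl).isCompact.image (τ.chi T).continuous).isClosed

/-- A criterion for a map to a triangulated surface to be an open embedding. -/
theorem isOpenEmbedding_of_charts [T2Space S] {Z κ : Type*} [TopologicalSpace Z] {f : Z → S}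
    (hf : Continuous f) (t : κ → Fin τ.n) (Ω : κ → Set Triangle) (hΩ : ∀ k, IsOpen (Ω k))
    (ψ : κ → Triangle → Z) (hψ : ∀ k, ContinuousOn (ψ k) (Ω k))
    (hcompat : ∀ k l p, t k = t l → p ∈ Ω k → p ∈ Ω l → ψ k p = ψ l p)
    (hiff : ∀ T p z, τ.chi T p = f z ↔ ∃ k, t k = T ∧ p ∈ Ω k ∧ ψ k p = z) :
    Topology.IsOpenEmbedding f := by
  refine Topology.IsOpenEmbedding.of_continuous_injective_isOpenMap hf ?_ ?_
  · intro z z' hz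
    obtain ⟨T, p, hp⟩ := τ.chi_surjective (f z)
    obtain ⟨k, hk, hpk, rfl⟩ := (hiff T p z).1 hp
    obtain ⟨l, hl, hpl, rfl⟩ := (hiff T p z').1 (hp.trans hz)
    exact hcompat k l p (hk.trans hl.symm) hpk hpl
  · intro O hO
    refine τ.isOpen_of_preimage fun T => ?_
    have : τ.chi T ⁻¹' (f '' O) = ⋃ k, ⋃ _ : t k = T, Ω k ∩ ψ k ⁻¹' O := by
      ext p
      simp only [Set.mem_preimage, Set.mem_image, Set.mem_iUnion, Set.mem_inter_iff]
      constructor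
      · rintro ⟨z, hz, hzp⟩
        obtain ⟨k, hk, hpk, rfl⟩ := (hiff T p z).1 hzp.symm
        exact ⟨k, hk, hpk, hz⟩
      · rintro ⟨k, hk, hpk, hz⟩
        exact ⟨_, hz, ((hiff T p _).2 ⟨k, hk, hpk, rfl⟩).symm⟩
    rw [this]
    exact isOpen_iUnion fun k => isOpen_iUnion fun _ => (hψ k).isOpen_inter_preimage (hΩ k) hO

/-- The points of a triangle which are neither a vertex nor on a side which is glued. -/
def region (T : Fin τ.n) : Set Triangle :=
  {p | (∀ k, p k ≠ 1) ∧ ∀ i, τ.mate (T, i) ≠ (T, i) → 0 < p (i + 2)}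

theorem isOpen_region (T : Fin τ.n) : IsOpen (τ.region T) := by
  have : τ.region T = (⋂ k, {p : Triangle | p k ≠ 1}) ∩
      ⋂ i, ⋂ _ : τ.mate (T, i) ≠ (T, i), {p : Triangle | 0 < p (i + 2)} := by
    ext p
    simp [region]
  rw [this]
  refine IsOpen.inter (isOpen_iInter_of_finite fun k => ?_)
    (isOpen_iInter_of_finite fun i => isOpen_iInter_of_finite fun _ => ?_)
  · exact isOpen_ne_fun (triangle_continuous k) continuous_const
  · exact isOpen_lt continuous_const (triangle_continuous _)

/-- Every gluing out of a non-vertex starts on a glued side, and a region contains no such point. -/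
theorem region_unique {T T' : Fin τ.n} {p p' : Triangle} (hp : p ∈ τ.region T)
    (h : τ.chi T p = τ.chi T' p') : (T, p) = (T', p') := by
  rcases τ.chi_eq hp.1 h with h | ⟨i, j, h1, h2, h3, -⟩
  · exact h
  · exact absurd h3 (hp.2 i (by rw [h1]; exact h2.symm)).ne'

theorem isOpen_image_of_subset_region [T2Space S] {T : Fin τ.n} {A : Set Triangle} (hA : IsOpen A)
    (h : A ⊆ τ.region T) : IsOpen (τ.chi T '' A) := by
  refine τ.isOpen_of_preimage fun T' => ?_
  by_cases hT : T' = T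
  · subst hT
    convert hA using 1
    ext p
    constructor
    · rintro ⟨q, hq, h1⟩
      cases τ.region_unique (h hq) h1
      exact hq
    · exact fun hp => ⟨p, hp, rfl⟩
  · convert isOpen_empty
    rw [Set.eq_empty_iff_forall_notMem]
    rintro p ⟨q, hq, h1⟩
    exact hT (congrArg Prod.fst (τ.region_unique (h hq) h1)).symm

/-- The image of the interior of a sector. -/
def openSector (s : Fin τ.n × Fin 3) : Set S := τ.chi s.1 '' {p | p ∈ sector s.2 ∧ 0 < p (s.2 + 2)}

theorem sector_subset_region (s : Fin τ.n × Fin 3) :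
    {p | p ∈ sector s.2 ∧ 0 < p (s.2 + 2)} ⊆ τ.region s.1 := by
  rintro p ⟨hp, h0⟩
  refine ⟨ne_one_of_mem_sector hp, fun i _ => ?_⟩
  obtain ⟨h1, h2⟩ := hp
  rcases fin_three_cases s.2 (i + 2) with h | h | h <;> rw [h] <;> linarith

theorem isOpen_openSector [T2Space S] (s : Fin τ.n × Fin 3) : IsOpen (τ.openSector s) :=
  τ.isOpen_image_of_subset_region
    ((isOpen_sector _).inter (isOpen_lt continuous_const (triangle_continuous _)))
    (τ.sector_subset_region s)

theorem openSector_unique {s s' : Fin τ.n × Fin 3} {x : S} (h : x ∈ τ.openSector s)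
    (h' : x ∈ τ.openSector s') : s = s' := by
  obtain ⟨p, hp, rfl⟩ := h
  obtain ⟨p', hp', h1⟩ := h'
  have h2 := τ.region_unique (τ.sector_subset_region s hp) h1.symm
  have h3 : p = p' := congrArg Prod.snd h2
  subst h3
  exact Prod.ext (Prod.mk.inj h2).1 (eq_of_mem_sector hp.1 hp'.1)

end IdealTriangulation

/-- The surface with its marked points and its punctures removed. -/
abbrev MarkedSurface.Unmarked (X : MarkedSurface S) : Type _ :=
  {x : S // x ∉ X.marked ∪ X.punctures}

namespace IdealTriangulation

variable (τ : IdealTriangulation X)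

theorem notMem_vertices (T : Fin τ.n) (p : Triangle) (hp : ∀ k, p k ≠ 1) :
    τ.chi T p ∉ X.marked ∪ X.punctures := by
  intro h
  rw [← τ.vertices_eq] at h
  obtain ⟨T', k, hk⟩ := h
  obtain ⟨l, hl⟩ := (Glue.vertex_iff ((τ.chi_eq_iff _ _ _ _).1 hk)).1 ⟨k, by simp⟩
  exact hp l hl

theorem ne_one_of_notMem {T : Fin τ.n} {p : Triangle} (h : τ.chi T p ∉ X.marked ∪ X.punctures)
    (k : Fin 3) : p k ≠ 1 := by
  intro hk
  apply h
  rw [← τ.vertices_eq]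
  refine ⟨T, k, ?_⟩
  congr 1
  have h1 := triangle_sum p k
  have h2 := triangle_nonneg p (k + 1)
  have h3 := triangle_nonneg p (k + 2)
  refine triangle_ext k ?_ ?_ ?_
  · simp [hk]
  · simp [(fin_three_ne k).1]
    linarith
  · simp [(fin_three_ne k).2.1]
    linarith

/-! ### Diamonds -/

/-- The domain of the parametrizations of the neighbourhoods of the glued sides. -/
def diamond : Set (ℝ × ℝ) :=
  {q | q.2 < q.1 ∧ -q.2 < q.1 ∧ q.1 + 2 * q.2 < 1 ∧ q.1 - 2 * q.2 < 1}

theorem convex_diamond : Convex ℝ diamond := by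
  rintro x ⟨h1, h2, h3, h4⟩ y ⟨h5, h6, h7, h8⟩ a b ha hb hab
  simp only [diamond, Set.mem_ofPred, Prod.fst_add, Prod.snd_add, Prod.smul_fst, Prod.smul_snd,
    smul_eq_mul]
  rcases ha.eq_or_lt with rfl | ha
  · obtain rfl : b = 1 := by linarith
    simp only [zero_mul, one_mul, zero_add]
    exact ⟨h5, h6, h7, h8⟩
  · refine ⟨?_, ?_, ?_, ?_⟩ <;> nlinarith

end IdealTriangulation

end Surface

end OrbSurface

namespace OrbSurface

/-! ### Diamond charts around the glued sides -/

namespace IdealTriangulation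

theorem diamond_abs (q : diamond) : |q.1.2| < q.1.1 ∧ q.1.1 + 2 * |q.1.2| < 1 := by
  obtain ⟨h1, h2, h3, h4⟩ := q.2
  rcases abs_cases q.1.2 with ⟨h, -⟩ | ⟨h, -⟩ <;> rw [h] <;> constructor <;> linarith

/-- The coordinates of the point of a diamond, in the first triangle. -/
noncomputable def diamondPt (i : Fin 3) (q : diamond) : Triangle :=
  trianglePt i q.1.1 (1 - q.1.1 - |q.1.2|) |q.1.2|
    (by have := diamond_abs q; have := abs_nonneg q.1.2; linarith)
    (by have := diamond_abs q; have := abs_nonneg q.1.2; linarith) (abs_nonneg _) (by ring)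

/-- The coordinates of the point of a diamond, in the second triangle. -/
noncomputable def diamondPt' (i : Fin 3) (q : diamond) : Triangle :=
  trianglePt i (1 - q.1.1 - |q.1.2|) q.1.1 |q.1.2|
    (by have := diamond_abs q; have := abs_nonneg q.1.2; linarith)
    (by have := diamond_abs q; have := abs_nonneg q.1.2; linarith) (abs_nonneg _) (by ring)

theorem continuous_diamondPt (i : Fin 3) : Continuous (diamondPt i) :=
  continuous_trianglePt _ (by fun_prop) (by fun_prop) (by fun_prop) _ _ _ _

theorem continuous_diamondPt' (i : Fin 3) : Continuous (diamondPt' i) :=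
  continuous_trianglePt _ (by fun_prop) (by fun_prop) (by fun_prop) _ _ _ _

theorem diamondPt_mem (i : Fin 3) (q : diamond) : diamondPt i q ∈ sector i := by
  have := diamond_abs q
  constructor <;> simp [diamondPt] <;> linarith

theorem diamondPt'_mem (i : Fin 3) (q : diamond) : diamondPt' i q ∈ sector i := by
  have := diamond_abs q
  constructor <;> simp [diamondPt'] <;> linarith

/-- The point of the diamond above a point of the first sector. -/
def diamondInv (i : Fin 3) (p : Triangle) : ℝ × ℝ := (p i, p (i + 2))

/-- The point of the diamond above a point of the second sector. -/
def diamondInv' (i : Fin 3) (p : Triangle) : ℝ × ℝ := (p (i + 1), -p (i + 2))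

theorem diamondInv_mem {i : Fin 3} {p : Triangle} (hp : p ∈ sector i) : diamondInv i p ∈ diamond := by
  have h1 := triangle_sum p i
  have h2 := triangle_nonneg p (i + 2)
  obtain ⟨h3, h4⟩ := hp
  refine ⟨?_, ?_, ?_, ?_⟩ <;> simp only [diamondInv] <;> linarith

theorem diamondInv'_mem {i : Fin 3} {p : Triangle} (hp : p ∈ sector i) :
    diamondInv' i p ∈ diamond := by
  have h1 := triangle_sum p i
  have h2 := triangle_nonneg p (i + 2)
  obtain ⟨h3, h4⟩ := hp
  refine ⟨?_, ?_, ?_, ?_⟩ <;> simp only [diamondInv'] <;> linarith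

theorem diamondPt_inv {i : Fin 3} {p : Triangle} (hp : p ∈ sector i) :
    diamondPt i ⟨diamondInv i p, diamondInv_mem hp⟩ = p := by
  have h1 := triangle_sum p i
  have h2 := triangle_nonneg p (i + 2)
  refine triangle_ext i ?_ ?_ ?_ <;> simp [diamondPt, diamondInv, abs_of_nonneg h2]
  linarith

theorem diamondPt'_inv {i : Fin 3} {p : Triangle} (hp : p ∈ sector i) :
    diamondPt' i ⟨diamondInv' i p, diamondInv'_mem hp⟩ = p := by
  have h1 := triangle_sum p i
  have h2 := triangle_nonneg p (i + 2)
  refine triangle_ext i ?_ ?_ ?_ <;> simp [diamondPt', diamondInv', abs_of_nonneg h2]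
  linarith

theorem diamondInv_pt {i : Fin 3} {q : diamond} (hq : 0 ≤ q.1.2) :
    diamondInv i (diamondPt i q) = q.1 := by
  apply Prod.ext <;> simp [diamondInv, diamondPt, abs_of_nonneg hq]

theorem diamondInv'_pt {i : Fin 3} {q : diamond} (hq : q.1.2 ≤ 0) :
    diamondInv' i (diamondPt' i q) = q.1 := by
  apply Prod.ext <;> simp [diamondInv', diamondPt', abs_of_nonpos hq]

variable {S : Type*} [TopologicalSpace S] [ChartedSpace (EuclideanHalfSpace 2) S]
  {X : MarkedSurface S} (τ : IdealTriangulation X)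

open Classical in
/-- The neighbourhood of the interior of a side which is glued. -/
noncomputable def diamondMap (s : Fin τ.n × Fin 3) (q : diamond) : S :=
  if 0 ≤ q.1.2 then τ.chi s.1 (diamondPt s.2 q)
    else τ.chi (τ.mate s).1 (diamondPt' (τ.mate s).2 q)

variable {s : Fin τ.n × Fin 3}

theorem chi_diamondPt (hs : τ.mate s ≠ s) {q : diamond} (hq : q.1.2 = 0) :
    τ.chi s.1 (diamondPt s.2 q) = τ.chi (τ.mate s).1 (diamondPt' (τ.mate s).2 q) := by
  rw [τ.chi_eq_iff]
  refine Relation.EqvGen.rel _ _ ⟨s.2, (τ.mate s).2, rfl, hs.symm, ?_, ?_, ?_, ?_⟩ <;>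
    simp [diamondPt, diamondPt', hq]

theorem diamondMap_of_nonneg {q : diamond} (hq : 0 ≤ q.1.2) :
    τ.diamondMap s q = τ.chi s.1 (diamondPt s.2 q) := if_pos hq

theorem diamondMap_of_nonpos (hs : τ.mate s ≠ s) {q : diamond} (hq : q.1.2 ≤ 0) :
    τ.diamondMap s q = τ.chi (τ.mate s).1 (diamondPt' (τ.mate s).2 q) := by
  rcases hq.eq_or_lt with h | h
  · rw [τ.diamondMap_of_nonneg h.ge, τ.chi_diamondPt hs h]
  · exact if_neg (not_le.2 h)

theorem continuous_diamondMap (hs : τ.mate s ≠ s) : Continuous (τ.diamondMap s) := by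
  refine Continuous.if_le ?_ ?_ continuous_const (by fun_prop) ?_
  · exact (τ.chi _).continuous.comp (continuous_diamondPt _)
  · exact (τ.chi _).continuous.comp (continuous_diamondPt' _)
  · intro q hq
    exact τ.chi_diamondPt hs hq.symm

/-- The fibre over a non-vertex consists of one point or of two points related by one gluing. On the
axis of the diamond both alternatives are realized; off the axis, only the one on the corresponding
side. -/
theorem chi_eq_diamondMap (hs : τ.mate s ≠ s) {T : Fin τ.n} {p : Triangle} {q : diamond} :
    τ.chi T p = τ.diamondMap s q ↔ (T = s.1 ∧ p ∈ sector s.2 ∧ diamondInv s.2 p = q.1) ∨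
      (T = (τ.mate s).1 ∧ p ∈ sector (τ.mate s).2 ∧ diamondInv' (τ.mate s).2 p = q.1) := by
  have hmm := τ.mate_mate s
  constructor
  · intro h
    have hp : ∀ k, p k ≠ 1 := by
      apply τ.ne_one_of_notMem (T := T)
      rw [h]
      rcases le_total 0 q.1.2 with hq | hq
      · rw [τ.diamondMap_of_nonneg hq]
        exact τ.notMem_vertices _ _ (ne_one_of_mem_sector (diamondPt_mem _ q))
      · rw [τ.diamondMap_of_nonpos hs hq]
        exact τ.notMem_vertices _ _ (ne_one_of_mem_sector (diamondPt'_mem _ q))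
    have key : ∀ (s' : Fin τ.n × Fin 3) (p' : Triangle), p' ∈ sector s'.2 →
        τ.chi T p = τ.chi s'.1 p' → (T = s'.1 ∧ p = p') ∨
          (T = (τ.mate s').1 ∧ p' (s'.2 + 2) = 0 ∧ p ((τ.mate s').2 + 2) = 0 ∧
            p ((τ.mate s').2 + 1) = p' s'.2 ∧ p (τ.mate s').2 = p' (s'.2 + 1)) := by
      intro s' p' hp' h
      rcases τ.chi_eq hp h with h | ⟨i, j, h1, h2, h3, h4, h5, h6⟩
      · exact Or.inl ⟨(Prod.mk.inj h).1, (Prod.mk.inj h).2⟩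
      · right
        have hj : j = s'.2 := eq_of_mem_sector
          (mem_sector_of_side (ne_one_of_mem_sector hp') h4) hp'
        subst hj
        dsimp only at *
        have h7 : τ.mate s' = (T, i) := by
          have := τ.mate_mate (T, i)
          rw [h1] at this
          exact this
        rw [h7]
        exact ⟨rfl, h4, h3, h6.symm, h5.symm⟩
    rcases le_total 0 q.1.2 with hq | hq
    · rw [τ.diamondMap_of_nonneg hq] at h
      rcases key s _ (diamondPt_mem _ q) h with ⟨h1, rfl⟩ | ⟨h1, h2, h3, h4, h5⟩
      · exact Or.inl ⟨h1, diamondPt_mem _ q, diamondInv_pt hq⟩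
      · right
        refine ⟨h1, mem_sector_of_side hp h3, ?_⟩
        simp only [diamondPt, trianglePt_zero, trianglePt_two] at h2 h4
        rw [diamondInv', h3, h4]
        apply Prod.ext
        · rfl
        · simpa using (abs_eq_zero.1 h2).symm
    · rw [τ.diamondMap_of_nonpos hs hq] at h
      rcases key (τ.mate s) _ (diamondPt'_mem _ q) h with ⟨h1, rfl⟩ | ⟨h1, h2, h3, h4, h5⟩
      · exact Or.inr ⟨h1, diamondPt'_mem _ q, diamondInv'_pt hq⟩
      · left
        rw [hmm] at *
        refine ⟨h1, mem_sector_of_side hp h3, ?_⟩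
        simp only [diamondPt', trianglePt_one, trianglePt_two] at h2 h5
        rw [diamondInv, h3, h5]
        apply Prod.ext
        · rfl
        · simpa using (abs_eq_zero.1 h2).symm
  · rintro (⟨rfl, hp, h⟩ | ⟨rfl, hp, h⟩)
    · obtain rfl : q = ⟨_, diamondInv_mem hp⟩ := Subtype.ext h.symm
      rw [τ.diamondMap_of_nonneg (triangle_nonneg p _), diamondPt_inv hp]
    · obtain rfl : q = ⟨_, diamondInv'_mem hp⟩ := Subtype.ext h.symm
      rw [τ.diamondMap_of_nonpos hs (neg_nonpos.2 (triangle_nonneg p _)), diamondPt'_inv hp]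

theorem diamondMap_notMem (hs : τ.mate s ≠ s) (q : diamond) :
    τ.diamondMap s q ∉ X.marked ∪ X.punctures := by
  rcases le_total 0 q.1.2 with hq | hq
  · rw [τ.diamondMap_of_nonneg hq]
    exact τ.notMem_vertices _ _ (ne_one_of_mem_sector (diamondPt_mem _ q))
  · rw [τ.diamondMap_of_nonpos hs hq]
    exact τ.notMem_vertices _ _ (ne_one_of_mem_sector (diamondPt'_mem _ q))

-- The inverse is given by coordinates on the two sectors. If the two sides belong to the same
-- triangle, their sectors are still disjoint because the sides are distinct, so the two formulas
-- never conflict.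
open Classical in
theorem isOpenEmbedding_diamondMap [T2Space S] (hs : τ.mate s ≠ s) :
    Topology.IsOpenEmbedding (τ.diamondMap s) := by
  have h0 : ((1 / 2, 0) : ℝ × ℝ) ∈ diamond := by
    refine ⟨?_, ?_, ?_, ?_⟩ <;> norm_num
  -- The centre serves as a default value; only the restriction of `toD` to the diamond matters.
  let toD : ℝ × ℝ → diamond := fun q => if h : q ∈ diamond then ⟨q, h⟩ else ⟨_, h0⟩
  have htoD : ∀ {q} (h : q ∈ diamond), toD q = ⟨q, h⟩ := fun h => dif_pos h
  have hcont : ContinuousOn toD diamond := by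
    rw [continuousOn_iff_continuous_domRestrict]
    have : Set.domRestrict diamond toD = id := by
      funext q
      exact htoD q.2
    rw [this]
    exact continuous_id
  refine τ.isOpenEmbedding_of_charts (κ := Bool) (τ.continuous_diamondMap hs)
    (fun k => cond k s.1 (τ.mate s).1) (fun k => sector (cond k s.2 (τ.mate s).2))
    (fun k => isOpen_sector _)
    (fun k p => toD (cond k (diamondInv s.2 p) (diamondInv' (τ.mate s).2 p))) ?_ ?_ ?_
  · rintro (_ | _)
    · refine hcont.comp (s := sector (τ.mate s).2) ?_ fun p hp => diamondInv'_mem hp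
      exact ((triangle_continuous _).prodMk (triangle_continuous _).neg).continuousOn
    · refine hcont.comp (s := sector s.2) ?_ fun p hp => diamondInv_mem hp
      exact ((triangle_continuous _).prodMk (triangle_continuous _)).continuousOn
  · rintro (_ | _) (_ | _) p ht hk hl
    · rfl
    · exact absurd (Prod.ext ht (eq_of_mem_sector hk hl)) hs
    · exact absurd (Prod.ext ht.symm (eq_of_mem_sector hl hk)) hs
    · rfl
  · intro T p q
    rw [τ.chi_eq_diamondMap hs]
    simp only [Bool.exists_bool, cond_true, cond_false]
    rw [or_comm]
    refine or_congr ?_ ?_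
    · constructor
      · rintro ⟨h1, h2, h3⟩
        refine ⟨h1.symm, h2, ?_⟩
        rw [htoD (diamondInv'_mem h2)]
        exact Subtype.ext h3
      · rintro ⟨h1, h2, h3⟩
        rw [htoD (diamondInv'_mem h2)] at h3
        exact ⟨h1.symm, h2, congrArg Subtype.val h3⟩
    · constructor
      · rintro ⟨h1, h2, h3⟩
        refine ⟨h1.symm, h2, ?_⟩
        rw [htoD (diamondInv_mem h2)]
        exact Subtype.ext h3
      · rintro ⟨h1, h2, h3⟩
        rw [htoD (diamondInv_mem h2)] at h3
        exact ⟨h1.symm, h2, congrArg Subtype.val h3⟩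

end IdealTriangulation

end OrbSurface

namespace OrbSurface

/-! ### The covering defined by elements attached to the sides -/

section Subpaths

variable {Y : Type*} [TopologicalSpace Y]

theorem mk_subpath_trans {x y : Y} (γ : Path x y) (t : unitInterval) :
    (Path.Homotopic.Quotient.mk (γ.subpath 0 t)).trans (.mk (γ.subpath t 1)) =
      (Path.Homotopic.Quotient.mk γ).cast γ.source γ.target := by
  rw [← Path.Homotopic.Quotient.mk_trans,
    Path.Homotopic.Quotient.eq.2 ⟨Path.Homotopy.subpathTransSubpath γ 0 t 1⟩,
    Path.subpath_zero_one, Path.Homotopic.Quotient.mk_cast]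

theorem subpath_mem {x y : Y} (γ : Path x y) {t₀ t₁ : unitInterval} (h : t₀ ≤ t₁) {O : Set Y}
    (hO : ∀ t, t₀ ≤ t → t ≤ t₁ → γ t ∈ O) (t : unitInterval) : γ.subpath t₀ t₁ t ∈ O := by
  have h2 : γ.subpath t₀ t₁ t ∈ Set.range (γ.subpath t₀ t₁) := ⟨t, rfl⟩
  rw [Path.range_subpath_of_le _ _ _ h] at h2
  obtain ⟨s, hs, h3⟩ := h2
  rw [← h3]
  exact hO s hs.1 hs.2

/-- A path in the range of an embedding. -/
theorem exists_path_lift {Z : Type*} [TopologicalSpace Z] {f : Z → Y} (hf : Topology.IsEmbedding f)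
    {x y : Y} (γ : Path x y) (h : ∀ t, γ t ∈ Set.range f) :
    ∃ (a b : Z) (δ : Path a b), f a = x ∧ f b = y ∧ ∀ t, f (δ t) = γ t := by
  choose δ hδ using h
  refine ⟨δ 0, δ 1, ⟨⟨δ, hf.continuous_iff.2 ?_⟩, rfl, rfl⟩, ?_, ?_, hδ⟩
  · have : f ∘ δ = γ := funext hδ
    rw [this]
    exact γ.continuous
  · rw [hδ, γ.source]
  · rw [hδ, γ.target]

end Subpaths

variable {S : Type*} [TopologicalSpace S] [ChartedSpace (EuclideanHalfSpace 2) S]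
  {X : MarkedSurface S}

namespace IdealTriangulation

variable (τ : IdealTriangulation X)

/-- The union of the regions of the triangles. -/
def regions : Set X.Unmarked := {x | ∃ T, ∃ p ∈ τ.region T, τ.chi T p = x.1}

/-- The union of the diamonds around the glued sides. -/
def diamonds : Set X.Unmarked := {x | ∃ s, τ.mate s ≠ s ∧ ∃ p ∈ sector s.2, τ.chi s.1 p = x.1}

theorem isOpen_regions [T2Space S] : IsOpen τ.regions := by
  have : τ.regions = ⋃ T, Subtype.val ⁻¹' (τ.chi T '' τ.region T) := by
    ext x
    simp [regions]
  rw [this]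
  exact isOpen_iUnion fun T => (τ.isOpen_image_of_subset_region (τ.isOpen_region T)
    subset_rfl).preimage continuous_subtype_val

theorem mem_range_diamondMap {s : Fin τ.n × Fin 3} (hs : τ.mate s ≠ s) {p : Triangle}
    (hp : p ∈ sector s.2) : τ.diamondMap s ⟨_, diamondInv_mem hp⟩ = τ.chi s.1 p := by
  rw [eq_comm, τ.chi_eq_diamondMap hs]
  exact Or.inl ⟨rfl, hp, rfl⟩

theorem isOpen_diamonds [T2Space S] : IsOpen τ.diamonds := by
  have : τ.diamonds = ⋃ s, ⋃ _ : τ.mate s ≠ s, Subtype.val ⁻¹' (Set.range (τ.diamondMap s)) := by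
    ext x
    simp only [Set.mem_iUnion, Set.mem_preimage, Set.mem_range]
    constructor
    · rintro ⟨s, hs, p, hp, h⟩
      exact ⟨s, hs, ⟨_, diamondInv_mem hp⟩, by rw [τ.mem_range_diamondMap hs hp, h]⟩
    · rintro ⟨s, hs, q, hq⟩
      rcases le_total 0 q.1.2 with h | h
      · rw [τ.diamondMap_of_nonneg h] at hq
        exact ⟨s, hs, _, diamondPt_mem _ q, hq⟩
      · rw [τ.diamondMap_of_nonpos hs h] at hq
        exact ⟨τ.mate s, fun h => hs (by rw [τ.mate_mate] at h; exact h.symm), _,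
          diamondPt'_mem _ q, hq⟩
  rw [this]
  exact isOpen_iUnion fun s => isOpen_iUnion fun hs =>
    (τ.isOpenEmbedding_diamondMap hs).isOpen_range.preimage continuous_subtype_val

theorem mem_regions_or_diamonds (x : X.Unmarked) : x ∈ τ.regions ∨ x ∈ τ.diamonds := by
  obtain ⟨T, p, hp⟩ := τ.chi_surjective x.1
  have h : ∀ k, p k ≠ 1 := τ.ne_one_of_notMem (T := T) (by rw [hp]; exact x.2)
  by_cases h1 : p ∈ τ.region T
  · exact Or.inl ⟨T, p, h1, hp⟩
  · right
    simp only [region, Set.mem_ofPred, not_and, not_forall, not_lt] at h1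
    obtain ⟨i, hi, h2⟩ := h1 h
    exact ⟨(T, i), hi, p, mem_sector_of_side h (le_antisymm h2 (triangle_nonneg _ _)), hp⟩

theorem not_mem_regions_of_side {T : Fin τ.n} {i : Fin 3} (hs : τ.mate (T, i) ≠ (T, i))
    {p : Triangle} (hp : p (i + 2) = 0) {x : X.Unmarked} (hx : τ.chi T p = x.1) :
    x ∉ τ.regions := by
  rintro ⟨T', p', hp', h⟩
  cases τ.region_unique hp' (h.trans hx.symm)
  exact (hp'.2 i hs).ne' hp

variable {Φ : Type*}

open Classical in
/-- The locally constant function which takes the value `l s` on the open sector of the side `s`. -/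
noncomputable def sectorFun (l : Fin τ.n × Fin 3 → Equiv.Perm Φ) (x : X.Unmarked) : Equiv.Perm Φ :=
  if h : ∃ s, x.1 ∈ τ.openSector s then l h.choose else 1

theorem sectorFun_eq (l : Fin τ.n × Fin 3 → Equiv.Perm Φ) {x : X.Unmarked} {s : Fin τ.n × Fin 3}
    (h : x.1 ∈ τ.openSector s) : τ.sectorFun l x = l s := by
  have h' : ∃ s, x.1 ∈ τ.openSector s := ⟨s, h⟩
  rw [sectorFun, dif_pos h', τ.openSector_unique h'.choose_spec h]

/-- If the smallest coordinate of a point of a diamond vanishes, the point is on a glued side, hence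
outside the regions. -/
theorem exists_mem_openSector {x : X.Unmarked} (hx : x ∈ τ.regions ∩ τ.diamonds) :
    ∃ s, x.1 ∈ τ.openSector s := by
  obtain ⟨-, s, hs, p, hp, h2⟩ := id hx
  refine ⟨s, p, ⟨hp, ?_⟩, h2⟩
  rcases (triangle_nonneg p (s.2 + 2)).eq_or_lt with h3 | h3
  · exact absurd hx.1 (τ.not_mem_regions_of_side hs h3.symm h2)
  · exact h3

open Classical in
/-- The monodromy of the covering space associated with elements `l s` attached to the sides. -/
theorem exists_side_monodromy [T2Space S] (l : Fin τ.n × Fin 3 → Equiv.Perm Φ) :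
    ∃ θ : ∀ {x y : X.Unmarked}, Path.Homotopic.Quotient x y → Equiv.Perm Φ,
      (∀ x, θ (.refl x) = 1) ∧
      (∀ {x y z : X.Unmarked} (γ : Path.Homotopic.Quotient x y)
        (δ : Path.Homotopic.Quotient y z), θ (γ.trans δ) = θ δ * θ γ) ∧
      (∀ (s : Fin τ.n × Fin 3), τ.mate s ≠ s → ∀ {x y : X.Unmarked} (γ : Path x y),
        (∀ t, (γ t).1 = τ.chi s.1 (spoke s.2 t)) → θ (.mk γ) = l s) ∧
      (∀ (H : Subgroup (Equiv.Perm Φ)) (B : Set X.Unmarked),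
        (∀ x ∈ B, ∀ s, x.1 ∈ τ.openSector s → l s ∈ H) →
        ∀ {x y : X.Unmarked} (γ : Path x y), (∀ t, γ t ∈ B) → θ (.mk γ) ∈ H) := by
  obtain ⟨θ, h1, h2, h3, h4⟩ := exists_monodromy τ.isOpen_regions τ.isOpen_diamonds
    τ.mem_regions_or_diamonds (τ.sectorFun l) (by
      intro x hx
      obtain ⟨s, hs⟩ := τ.exists_mem_openSector hx
      filter_upwards [((τ.isOpen_openSector s).preimage continuous_subtype_val).mem_nhds hs] with y hy
      rw [τ.sectorFun_eq l hs, τ.sectorFun_eq l hy])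
  have hcast : ∀ {x y x' y' : X.Unmarked} (γ : Path.Homotopic.Quotient x y) (hx : x' = x)
      (hy : y' = y), θ (γ.cast hx hy) = θ γ := by
    rintro x y _ _ γ rfl rfl
    rw [Path.Homotopic.Quotient.cast_rfl_rfl]
  refine ⟨θ, h1, h2, ?_, ?_⟩
  · rintro ⟨T, i⟩ hs x y γ hγ
    have hhalf : (1 / 2 : ℝ) ∈ unitInterval := by constructor <;> norm_num
    set m : unitInterval := ⟨1 / 2, hhalf⟩
    have hsec : ∀ t : unitInterval, 0 < (t : ℝ) → spoke i t ∈ sector i := by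
      intro t ht
      constructor <;> simp only [spoke_apply] <;>
        simp [(fin_three_ne i).2.1.symm, (fin_three_ne i).2.2.symm, ht]
    have hreg : ∀ t : unitInterval, (t : ℝ) < 1 → ∀ k, 0 < spoke i t k := by
      intro t ht k
      have := t.2.1
      rw [spoke_apply]
      split_ifs <;> linarith
    have hU : ∀ t : unitInterval, (t : ℝ) < 1 → γ t ∈ τ.regions := fun t ht =>
      ⟨T, spoke i t, ⟨spoke_ne_one i t, fun _ _ => hreg t ht _⟩, (hγ t).symm⟩
    have hV : ∀ t : unitInterval, 0 < (t : ℝ) → γ t ∈ τ.diamonds := fun t ht =>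
      ⟨(T, i), hs, spoke i t, hsec t ht, (hγ t).symm⟩
    have hm1 : (m : ℝ) < 1 := by norm_num [m]
    have hm0 : 0 < (m : ℝ) := by norm_num [m]
    -- The half-edge is cut in its middle. The first piece stays in the regions. The second stays in
    -- the diamonds, starts in the open sector of the side, where the transition function is `l`,
    -- and ends on the side, outside the regions.
    have e1 : θ (.mk (γ.subpath 0 m)) = 1 := by
      refine h3 _ (subpath_mem γ m.2.1 fun t _ ht => hU t ?_)
      exact lt_of_le_of_lt ht hm1
    have e2 : θ (.mk (γ.subpath m 1)) = l (T, i) := by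
      rw [h4 _ (subpath_mem γ m.2.2 fun t ht _ => hV t (lt_of_lt_of_le hm0 ht)), if_pos (hU m hm1),
        if_neg, inv_one, one_mul]
      · apply τ.sectorFun_eq
        exact ⟨spoke i m, ⟨hsec m hm0, hreg m hm1 _⟩, (hγ m).symm⟩
      · refine τ.not_mem_regions_of_side hs (p := spoke i 1) ?_ (hγ 1).symm
        simp [spoke_apply]
    change θ (.mk γ) = l (T, i)
    rw [← hcast (.mk γ) γ.source γ.target, ← mk_subpath_trans γ m, h2, e1, e2, mul_one]
  · intro H B hB x y γ hγ
    -- The path is viewed inside `B`, so that all ends of the pieces of a subdivision are in `B`,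
    -- where the transition function takes its values in `H`.
    let γ' : Path (⟨x, by simpa using hγ 0⟩ : B) (⟨y, by simpa using hγ 1⟩ : B) :=
      ⟨⟨fun t => ⟨γ t, hγ t⟩, by fun_prop⟩, by simp, by simp⟩
    have hγ' : Path.Homotopic.Quotient.mk γ = (Path.Homotopic.Quotient.mk γ').map
      ⟨Subtype.val, continuous_subtype_val⟩ := rfl
    rw [hγ']
    let c : Bool → Set B := fun i => Subtype.val ⁻¹' (cond i τ.regions τ.diamonds)
    refine path_induction (c := c) ?_ ?_
      (fun δ => θ (δ.map ⟨Subtype.val, continuous_subtype_val⟩) ∈ H) ?_ ?_ γ'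
    · rintro (_ | _)
      · exact τ.isOpen_diamonds.preimage continuous_subtype_val
      · exact τ.isOpen_regions.preimage continuous_subtype_val
    · intro x
      rcases τ.mem_regions_or_diamonds x.1 with h | h
      · exact ⟨true, h⟩
      · exact ⟨false, h⟩
    · intro x y z γ δ hγ hδ
      have h5 : (γ.trans δ).map (⟨Subtype.val, continuous_subtype_val⟩ : C(B, X.Unmarked)) =
          (γ.map ⟨Subtype.val, continuous_subtype_val⟩).trans
            (δ.map ⟨Subtype.val, continuous_subtype_val⟩) := by
        exact (FundamentalGroupoid.map (⟨Subtype.val, continuous_subtype_val⟩ :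
          C(B, X.Unmarked))).map_comp (X := ⟨x⟩) (Y := ⟨y⟩) (Z := ⟨z⟩) γ δ
      rw [h5, h2]
      exact H.mul_mem hδ hγ
    · rintro (_ | _) x y γ hγ
      · rw [← Path.Homotopic.Quotient.mk_map, h4 _ hγ]
        have hc : ∀ x : B, x.1 ∈ τ.diamonds → (if x.1 ∈ τ.regions then τ.sectorFun l x.1 else 1) ∈ H := by
          intro x hx
          split_ifs with h
          · obtain ⟨s, hs⟩ := τ.exists_mem_openSector ⟨h, hx⟩
            rw [τ.sectorFun_eq l hs]
            exact hB x.1 x.2 s hs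
          · exact H.one_mem
        refine H.mul_mem (H.inv_mem (hc y ?_)) (hc x ?_)
        · simpa [c] using hγ 1
        · simpa [c] using hγ 0
      · rw [← Path.Homotopic.Quotient.mk_map, h3 _ hγ]
        exact H.one_mem

end IdealTriangulation

end OrbSurface

namespace OrbSurface

/-! ### Generation of the fundamental groupoid by dual edges -/

section SimplyConnected

variable {Y Z W : Type*} [TopologicalSpace Y] [TopologicalSpace Z] [TopologicalSpace W]

/-- The identification of two equal points in the fundamental groupoid. -/
noncomputable abbrev ptHom {x y : Y} (h : x = y) : FundamentalGroupoid.mk x ⟶ FundamentalGroupoid.mk y :=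
  eqToHom (congrArg FundamentalGroupoid.mk h)

/-- The class of the image of the paths between two points of a simply connected space. -/
noncomputable def scHom [SimplyConnectedSpace Z] (f : C(Z, Y)) (a b : Z) :
    FundamentalGroupoid.mk (f a) ⟶ FundamentalGroupoid.mk (f b) :=
  (Path.Homotopic.Quotient.mk (PathConnectedSpace.somePath a b)).map f

variable [SimplyConnectedSpace Z] [SimplyConnectedSpace W]

/-- Paths with the same ends in a simply connected space are homotopic, so the path chosen in
`scHom` is irrelevant. -/
theorem scHom_eq (f : C(Z, Y)) {a b : Z} (q : Path.Homotopic.Quotient a b) : q.map f = scHom f a b :=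
  congrArg (fun q => Path.Homotopic.Quotient.map q f) (Subsingleton.elim _ _)

@[simp] theorem scHom_self (f : C(Z, Y)) (a : Z) : scHom f a a = 𝟙 _ := by
  rw [← scHom_eq f (.refl a)]
  exact (FundamentalGroupoid.map f).map_id ⟨a⟩

@[simp] theorem scHom_comp (f : C(Z, Y)) (a b c : Z) : scHom f a b ≫ scHom f b c = scHom f a c := by
  rw [← scHom_eq f (Path.Homotopic.Quotient.trans (.mk (PathConnectedSpace.somePath a b))
    (.mk (PathConnectedSpace.somePath b c)))]
  exact ((FundamentalGroupoid.map f).map_comp (X := ⟨a⟩) (Y := ⟨b⟩) (Z := ⟨c⟩)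
    (Path.Homotopic.Quotient.mk (PathConnectedSpace.somePath a b))
    (Path.Homotopic.Quotient.mk (PathConnectedSpace.somePath b c))).symm

@[simp] theorem scHom_comp_assoc (f : C(Z, Y)) (a b c : Z) {x : FundamentalGroupoid Y}
    (g : FundamentalGroupoid.mk (f c) ⟶ x) :
    scHom f a b ≫ scHom f b c ≫ g = scHom f a c ≫ g := by
  rw [← Category.assoc, scHom_comp]

theorem mk_eq_scHom (f : C(Z, Y)) {x y : Y} {a b : Z} (γ : Path x y) (δ : Path a b)
    (h : ∀ t, f (δ t) = γ t) (ha : x = f a) (hb : f b = y) :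
    FundamentalGroupoid.fromPath (.mk γ) = ptHom ha ≫ scHom f a b ≫ ptHom hb := by
  subst ha hb
  rw [← scHom_eq f (.mk δ)]
  simp only [eqToHom_refl, Category.id_comp, Category.comp_id]
  rw [← Path.Homotopic.Quotient.mk_map]
  exact congrArg Path.Homotopic.Quotient.mk (Path.ext (funext fun t => (h t).symm))

/-- One pair of paths with a common image suffices, since either class can be computed along any
path. -/
theorem scHom_comparison (f : C(Z, Y)) (g : C(W, Y)) {a b : Z} {c d : W} (α : Path a b)
    (β : Path c d) (h : ∀ t, f (α t) = g (β t)) (hac : f a = g c) (hbd : f b = g d) :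
    scHom f a b = ptHom hac ≫ scHom g c d ≫ ptHom hbd.symm := by
  rw [← mk_eq_scHom g (α.map f.continuous) β (fun t => (h t).symm) hac hbd.symm,
    ← scHom_eq f (.mk α)]
  rfl

theorem scHom_reverse {f : C(Z, Y)} {g : C(W, Y)} {a b : Z} {c d : W} {hac : f a = g c}
    {hbd : f b = g d} (h : scHom f a b = ptHom hac ≫ scHom g c d ≫ ptHom hbd.symm) :
    scHom f b a = ptHom hbd ≫ scHom g d c ≫ ptHom hac.symm := by
  rw [← cancel_epi (scHom f a b), scHom_comp, h]
  simp

end SimplyConnected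

section Face

/-- The triangle without its vertices. -/
abbrev Face : Type := {p : Triangle // ∀ k, p k ≠ 1}

/-- The barycentre. -/
noncomputable def Face.center : Face := ⟨spoke 0 0, spoke_ne_one 0 0⟩

theorem Face.center_apply (k : Fin 3) : Face.center.1 k = 1 / 3 := by
  simp [Face.center, spoke_apply]

theorem spoke_zero (i : Fin 3) : spoke i 0 = Face.center.1 := by
  apply Subtype.ext
  funext k
  change spoke i 0 k = Face.center.1 k
  rw [Face.center_apply]
  simp [spoke_apply]

/-- The midpoint of a side. -/
noncomputable def Face.mid (i : Fin 3) : Face := ⟨spoke i 1, spoke_ne_one i 1⟩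

/-- The straight contraction to the barycentre never meets a vertex: a coordinate less than one
stays less than one. -/
instance : ContractibleSpace Face := by
  have hle : ∀ (p : Triangle) (k : Fin 3), p k ≤ 1 := fun p k => by
    have := triangle_sum p k
    have := triangle_nonneg p (k + 1)
    have := triangle_nonneg p (k + 2)
    linarith
  let H : unitInterval × Face → Triangle := fun a =>
    trianglePt 0 ((1 - (a.1 : ℝ)) * a.2.1 0 + a.1 / 3) ((1 - (a.1 : ℝ)) * a.2.1 1 + a.1 / 3)
      ((1 - (a.1 : ℝ)) * a.2.1 2 + a.1 / 3)
      (add_nonneg (mul_nonneg (sub_nonneg.2 a.1.2.2) (triangle_nonneg _ _))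
        (div_nonneg a.1.2.1 (by norm_num)))
      (add_nonneg (mul_nonneg (sub_nonneg.2 a.1.2.2) (triangle_nonneg _ _))
        (div_nonneg a.1.2.1 (by norm_num)))
      (add_nonneg (mul_nonneg (sub_nonneg.2 a.1.2.2) (triangle_nonneg _ _))
        (div_nonneg a.1.2.1 (by norm_num)))
      (by
        have h : a.2.1 0 + a.2.1 1 + a.2.1 2 = 1 := triangle_sum a.2.1 0
        linear_combination (1 - (a.1 : ℝ)) * h)
  have hH : ∀ a k, H a k = (1 - (a.1 : ℝ)) * a.2.1 k + a.1 / 3 := by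
    intro a k
    fin_cases k
    · exact trianglePt_zero
    · exact trianglePt_one (i := 0)
    · exact trianglePt_two (i := 0)
  have hcont : Continuous H := by
    have hc : ∀ k, Continuous fun a : unitInterval × Face => (1 - (a.1 : ℝ)) * a.2.1 k + a.1 / 3 := by
      intro k
      have : Continuous fun a : unitInterval × Face => a.2.1 k :=
        (triangle_continuous k).comp (continuous_subtype_val.comp continuous_snd)
      fun_prop
    exact continuous_trianglePt _ (hc 0) (hc 1) (hc 2) _ _ _ _
  rw [contractible_iff_id_nullhomotopic]
  refine ⟨Face.center, ⟨⟨⟨fun a => ⟨H a, fun k h => ?_⟩, by fun_prop⟩, ?_, ?_⟩⟩⟩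
  · rw [hH] at h
    have h1 := a.1.2.1
    have h2 := a.1.2.2
    have h3 := lt_of_le_of_ne (hle a.2.1 k) (a.2.2 k)
    rcases h2.eq_or_lt with h4 | h4
    · rw [h4] at h
      norm_num at h
    · nlinarith
  · intro p
    apply Subtype.ext
    refine triangle_ext 0 ?_ ?_ ?_ <;> simp [hH]
  · intro p
    apply Subtype.ext
    refine triangle_ext 0 ?_ ?_ ?_ <;> simp [hH, Face.center_apply]

end Face

variable {S : Type*} [TopologicalSpace S] [ChartedSpace (EuclideanHalfSpace 2) S]
  {X : MarkedSurface S}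

namespace IdealTriangulation

instance : SimplyConnectedSpace diamond := by
  have : ContractibleSpace diamond := convex_diamond.contractibleSpace
    ⟨(1 / 2, 0), by refine ⟨?_, ?_, ?_, ?_⟩ <;> norm_num⟩
  infer_instance

/-- The centre of the diamond. -/
noncomputable def diamondCenter : diamond :=
  ⟨(1 / 2, 0), by refine ⟨?_, ?_, ?_, ?_⟩ <;> norm_num⟩

/-- A point of the closed upper half of the diamond is joined to the centre in this half. -/
theorem exists_path_upper {q : diamond} (hq : 0 ≤ q.1.2) :
    ∃ γ : Path q diamondCenter, ∀ t, 0 ≤ (γ t).1.2 := by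
  have hc : Convex ℝ (diamond ∩ {q | 0 ≤ q.2}) :=
    convex_diamond.inter (convex_halfSpace_ge (IsLinearMap.mk (fun _ _ => rfl) fun _ _ => rfl) 0)
  obtain ⟨γ, hγ⟩ := (hc.isPathConnected ⟨_, q.2, hq⟩).joinedIn q.1 ⟨q.2, hq⟩ diamondCenter.1
    ⟨diamondCenter.2, le_refl (0 : ℝ)⟩
  exact ⟨⟨⟨fun t => ⟨γ t, (hγ t).1⟩, by fun_prop⟩, Subtype.ext γ.source, Subtype.ext γ.target⟩,
    fun t => (hγ t).2⟩

theorem exists_path_lower {q : diamond} (hq : q.1.2 ≤ 0) :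
    ∃ γ : Path q diamondCenter, ∀ t, (γ t).1.2 ≤ 0 := by
  have hc : Convex ℝ (diamond ∩ {q | q.2 ≤ 0}) :=
    convex_diamond.inter (convex_halfSpace_le (IsLinearMap.mk (fun _ _ => rfl) fun _ _ => rfl) 0)
  obtain ⟨γ, hγ⟩ := (hc.isPathConnected ⟨_, q.2, hq⟩).joinedIn q.1 ⟨q.2, hq⟩ diamondCenter.1
    ⟨diamondCenter.2, le_refl (0 : ℝ)⟩
  exact ⟨⟨⟨fun t => ⟨γ t, (hγ t).1⟩, by fun_prop⟩, Subtype.ext γ.source, Subtype.ext γ.target⟩,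
    fun t => (hγ t).2⟩

theorem diamondPt_center (i : Fin 3) : diamondPt i diamondCenter = (Face.mid i).1 := by
  refine triangle_ext i ?_ ?_ ?_ <;>
    simp [diamondPt, diamondCenter, Face.mid, spoke_apply, (fin_three_ne i).2.1.symm,
      (fin_three_ne i).2.2.symm]
  norm_num

theorem diamondPt'_center (i : Fin 3) : diamondPt' i diamondCenter = (Face.mid i).1 := by
  refine triangle_ext i ?_ ?_ ?_ <;>
    simp [diamondPt', diamondCenter, Face.mid, spoke_apply, (fin_three_ne i).2.1.symm,
      (fin_three_ne i).2.2.symm]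
  norm_num

variable (τ : IdealTriangulation X)

/-- The inclusion of a triangle without its vertices. -/
def faceMap (T : Fin τ.n) : C(Face, X.Unmarked) :=
  ⟨fun p => ⟨τ.chi T p.1, τ.notMem_vertices T _ p.2⟩, by fun_prop⟩

/-- The inclusion of a diamond. -/
noncomputable def diamondHom {s : Fin τ.n × Fin 3} (hs : τ.mate s ≠ s) : C(diamond, X.Unmarked) :=
  ⟨fun q => ⟨τ.diamondMap s q, τ.diamondMap_notMem hs q⟩,
    (τ.continuous_diamondMap hs).subtype_mk _⟩

/-- The barycentre of a triangle. -/
noncomputable abbrev base (T : Fin τ.n) : FundamentalGroupoid X.Unmarked := ⟨τ.faceMap T .center⟩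

theorem faceMap_mid {T T' : Fin τ.n} {i j : Fin 3} (h : τ.mate (T, i) = (T', j)) :
    τ.faceMap T (.mid i) = τ.faceMap T' (.mid j) :=
  Subtype.ext (Subtype.ext_iff.1 (τ.halfEdge_one h) :)

/-- The edge of the dual graph which crosses a side. -/
noncomputable def edgeHom {T T' : Fin τ.n} {i j : Fin 3} (h : τ.mate (T, i) = (T', j)) :
    τ.base T ⟶ τ.base T' :=
  scHom (τ.faceMap T) .center (.mid i) ≫ ptHom (τ.faceMap_mid h) ≫
    scHom (τ.faceMap T') (.mid j) .center

theorem edgeHom_comp {T T' : Fin τ.n} {i j : Fin 3} (h : τ.mate (T, i) = (T', j))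
    (h' : τ.mate (T', j) = (T, i)) : τ.edgeHom h ≫ τ.edgeHom h' = 𝟙 _ := by
  simp only [edgeHom, Category.assoc, scHom_comp_assoc, scHom_self, Category.id_comp,
    eqToHom_trans_assoc, eqToHom_refl, scHom_comp]

/-- The edges of the dual graph, as a relation. -/
inductive IsEdge : Fin τ.n × Fin 3 → ∀ T T' : Fin τ.n, (τ.base T ⟶ τ.base T') → Prop
  | mk {T T' : Fin τ.n} {i j : Fin 3} (h : τ.mate (T, i) = (T', j)) (hne : τ.mate (T, i) ≠ (T, i)) :
      IsEdge (T, i) T T' (τ.edgeHom h)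

theorem isOpenEmbedding_region [T2Space S] (T : Fin τ.n) :
    Topology.IsOpenEmbedding fun p : τ.region T => τ.faceMap T ⟨p.1, p.2.1⟩ := by
  refine .of_continuous_injective_isOpenMap (by fun_prop) ?_ ?_
  · intro p q h
    exact Subtype.ext (Prod.mk.inj (τ.region_unique p.2 (congrArg Subtype.val h))).2
  · intro O hO
    convert (τ.isOpen_image_of_subset_region ((τ.isOpen_region T).isOpenMap_subtype_val O hO)
      (Subtype.coe_image_subset _ _)).preimage
        (continuous_subtype_val (p := (· ∉ X.marked ∪ X.punctures))) using 1
    ext x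
    constructor
    · rintro ⟨p, hp, rfl⟩
      exact ⟨p, ⟨p, hp, rfl⟩, rfl⟩
    · rintro ⟨_, ⟨p, hp, rfl⟩, h⟩
      exact ⟨p, hp, Subtype.ext h⟩

/-- The morphisms which are composites of edges and of a path in a triangle. -/
def Reach (T₀ : Fin τ.n) (x : X.Unmarked) (κ : τ.base T₀ ⟶ FundamentalGroupoid.mk x) : Prop :=
  ∃ (T : Fin τ.n) (p : Face) (h : τ.faceMap T p = x) (g : τ.base T₀ ⟶ τ.base T)
    (l : List (Fin τ.n × Fin 3)), Realizes τ.IsEdge g l ∧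
      κ = g ≫ scHom (τ.faceMap T) .center p ≫ ptHom h

/-- A path to the centre in the closed upper half of the diamond is also a path to the midpoint of
the side in the first triangle. This matches the two inclusions, and `diamond_lower` does the same
across the side. -/
theorem diamond_upper {s : Fin τ.n × Fin 3} (hs : τ.mate s ≠ s) {q : diamond} (hq : 0 ≤ q.1.2)
    {p : Face} (hp : p.1 = diamondPt s.2 q) :
    ∃ (h : τ.faceMap s.1 p = τ.diamondHom hs q)
      (h' : τ.faceMap s.1 (.mid s.2) = τ.diamondHom hs diamondCenter),
      scHom (τ.faceMap s.1) p (.mid s.2) =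
        ptHom h ≫ scHom (τ.diamondHom hs) q diamondCenter ≫ ptHom h'.symm := by
  have key : ∀ (q : diamond) (p : Face), 0 ≤ q.1.2 → p.1 = diamondPt s.2 q →
      τ.faceMap s.1 p = τ.diamondHom hs q := by
    intro q p hq hp
    apply Subtype.ext
    change τ.chi s.1 p.1 = τ.diamondMap s q
    rw [hp, τ.diamondMap_of_nonneg hq]
  have h2 := key diamondCenter (.mid s.2) le_rfl (diamondPt_center _).symm
  obtain ⟨γ, hγ⟩ := exists_path_upper hq
  let α : Path p (.mid s.2) :=
    ⟨⟨fun t => ⟨diamondPt s.2 (γ t), ne_one_of_mem_sector (diamondPt_mem _ _)⟩,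
      ((continuous_diamondPt s.2).comp γ.continuous).subtype_mk _⟩, by
        apply Subtype.ext
        simp [hp], by
        apply Subtype.ext
        simp [diamondPt_center]⟩
  exact ⟨key q p hq hp, h2, scHom_comparison _ _ α γ (fun t => key _ _ (hγ t) rfl) _ h2⟩

theorem diamond_lower {s : Fin τ.n × Fin 3} (hs : τ.mate s ≠ s) {q : diamond} (hq : q.1.2 ≤ 0)
    {p : Face} (hp : p.1 = diamondPt' (τ.mate s).2 q) :
    ∃ (h : τ.faceMap (τ.mate s).1 p = τ.diamondHom hs q)
      (h' : τ.faceMap (τ.mate s).1 (.mid (τ.mate s).2) = τ.diamondHom hs diamondCenter),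
      scHom (τ.faceMap (τ.mate s).1) p (.mid (τ.mate s).2) =
        ptHom h ≫ scHom (τ.diamondHom hs) q diamondCenter ≫ ptHom h'.symm := by
  have key : ∀ (q : diamond) (p : Face), q.1.2 ≤ 0 → p.1 = diamondPt' (τ.mate s).2 q →
      τ.faceMap (τ.mate s).1 p = τ.diamondHom hs q := by
    intro q p hq hp
    apply Subtype.ext
    change τ.chi (τ.mate s).1 p.1 = τ.diamondMap s q
    rw [hp, τ.diamondMap_of_nonpos hs hq]
  have h2 := key diamondCenter (.mid (τ.mate s).2) le_rfl (diamondPt'_center _).symm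
  obtain ⟨γ, hγ⟩ := exists_path_lower hq
  let α : Path p (.mid (τ.mate s).2) :=
    ⟨⟨fun t => ⟨diamondPt' (τ.mate s).2 (γ t), ne_one_of_mem_sector (diamondPt'_mem _ _)⟩,
      ((continuous_diamondPt' _).comp γ.continuous).subtype_mk _⟩, by
        apply Subtype.ext
        simp [hp], by
        apply Subtype.ext
        simp [diamondPt'_center]⟩
  exact ⟨key q p hq hp, h2, scHom_comparison _ _ α γ (fun t => key _ _ (hγ t) rfl) _ h2⟩

/-- The midpoint is approached inside the triangle where the point was reached; if this is the
triangle across the side, one more edge leads back to `s.1`. -/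
theorem Reach.to_center {T₀ : Fin τ.n} {s : Fin τ.n × Fin 3} (hs : τ.mate s ≠ s) {q : diamond}
    {κ : τ.base T₀ ⟶ FundamentalGroupoid.mk (τ.diamondHom hs q)} (hκ : τ.Reach T₀ _ κ)
    (h' : τ.faceMap s.1 (.mid s.2) = τ.diamondHom hs diamondCenter) :
    ∃ (g : τ.base T₀ ⟶ τ.base s.1) (l : List (Fin τ.n × Fin 3)), Realizes τ.IsEdge g l ∧
      κ ≫ scHom (τ.diamondHom hs) q diamondCenter =
        g ≫ scHom (τ.faceMap s.1) .center (.mid s.2) ≫ ptHom h' := by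
  obtain ⟨T, p, h, g, l, hg, rfl⟩ := hκ
  rcases (τ.chi_eq_diamondMap hs).1 (congrArg Subtype.val h) with ⟨rfl, hp, h1⟩ | ⟨rfl, hp, h1⟩
  · obtain rfl : q = ⟨_, diamondInv_mem hp⟩ := Subtype.ext h1.symm
    obtain ⟨h2, h3, h4⟩ := τ.diamond_upper hs (triangle_nonneg p.1 _) (diamondPt_inv hp).symm
    refine ⟨g, l, hg, ?_⟩
    rw [← scHom_comp _ .center p (.mid s.2), h4]
    simp
  · obtain rfl : q = ⟨_, diamondInv'_mem hp⟩ := Subtype.ext h1.symm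
    obtain ⟨h2, h3, h4⟩ := τ.diamond_lower hs (neg_nonpos.2 (triangle_nonneg p.1 _))
      (diamondPt'_inv hp).symm
    have hm : τ.mate ((τ.mate s).1, (τ.mate s).2) = (s.1, s.2) := τ.mate_mate s
    refine ⟨g ≫ τ.edgeHom hm, _, .cons _ hg (.mk hm fun h => hs ?_), ?_⟩
    · exact (h.symm.trans hm)
    · have h5 : scHom (τ.diamondHom hs) ⟨diamondInv' (τ.mate s).2 p.1, diamondInv'_mem hp⟩
          diamondCenter = ptHom h2.symm ≫ scHom (τ.faceMap (τ.mate s).1) p (.mid (τ.mate s).2) ≫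
            ptHom h3 := by
        rw [h4]
        simp
      rw [h5]
      simp [edgeHom, base]

/-- If the target is in the lower half, the path ends in the triangle across the side, and the edge
which crosses the side is added to the list. -/
theorem Reach.of_center {T₀ : Fin τ.n} {s : Fin τ.n × Fin 3} (hs : τ.mate s ≠ s) (q : diamond)
    (h' : τ.faceMap s.1 (.mid s.2) = τ.diamondHom hs diamondCenter)
    {g : τ.base T₀ ⟶ τ.base s.1} {l : List (Fin τ.n × Fin 3)} (hg : Realizes τ.IsEdge g l) :
    τ.Reach T₀ _ (g ≫ scHom (τ.faceMap s.1) .center (.mid s.2) ≫ ptHom h' ≫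
      scHom (τ.diamondHom hs) diamondCenter q) := by
  rcases le_total 0 q.1.2 with hq | hq
  · let p : Face := ⟨diamondPt s.2 q, ne_one_of_mem_sector (diamondPt_mem _ q)⟩
    obtain ⟨h2, h3, h4⟩ := τ.diamond_upper hs (p := p) hq rfl
    refine ⟨s.1, p, h2, g, l, hg, ?_⟩
    rw [← scHom_comp _ .center (.mid s.2) p]
    simp only [Category.assoc]
    congr 2
    rw [scHom_reverse (hbd := h3) h4]
    simp
  · let p : Face := ⟨diamondPt' (τ.mate s).2 q, ne_one_of_mem_sector (diamondPt'_mem _ q)⟩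
    obtain ⟨h2, h3, h4⟩ := τ.diamond_lower hs (p := p) hq rfl
    have hm : τ.mate (s.1, s.2) = ((τ.mate s).1, (τ.mate s).2) := rfl
    refine ⟨(τ.mate s).1, p, h2, g ≫ τ.edgeHom hm, _, .cons _ hg (.mk hm hs), ?_⟩
    simp only [edgeHom, base, Category.assoc, scHom_comp_assoc]
    rw [scHom_reverse (hbd := h3) h4]
    simp

/-- This is the generation half of van Kampen's theorem. A piece of the path in a region stays in
one triangle, and a piece in a diamond can be deformed to pass through the midpoint of the side. -/
theorem reach_of_path [T2Space S] {T₀ : Fin τ.n} {x y : X.Unmarked} (γ : Path x y)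
    {κ : τ.base T₀ ⟶ FundamentalGroupoid.mk x} (hκ : τ.Reach T₀ x κ) :
    τ.Reach T₀ y (κ ≫ FundamentalGroupoid.fromPath (.mk γ)) := by
  let c : Fin τ.n ⊕ (Fin τ.n × Fin 3) → Set X.Unmarked := fun o => o.elim
    (fun T => Set.range fun p : τ.region T => τ.faceMap T ⟨p.1, p.2.1⟩) fun s => {x | τ.mate s ≠ s ∧ x.1 ∈ Set.range (τ.diamondMap s)}
  refine path_induction (c := c) ?_ ?_ (fun {x y} q => ∀ κ : τ.base T₀ ⟶ FundamentalGroupoid.mk x,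
    τ.Reach T₀ x κ → τ.Reach T₀ y (κ ≫ FundamentalGroupoid.fromPath q)) ?_ ?_ γ κ hκ
  · rintro (T | s)
    · exact (τ.isOpenEmbedding_region T).isOpen_range
    · by_cases hs : τ.mate s = s
      · simp [c, hs]
      · convert (τ.isOpenEmbedding_diamondMap hs).isOpen_range.preimage
          (continuous_subtype_val (p := (· ∉ X.marked ∪ X.punctures))) using 1
        ext x
        exact ⟨fun h => h.2, fun h => ⟨hs, h⟩⟩
  · intro x
    rcases τ.mem_regions_or_diamonds x with h | ⟨s, hs, p, hp, h⟩
    · obtain ⟨T, p, hp, h⟩ := h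
      exact ⟨.inl T, ⟨p, hp⟩, Subtype.ext h⟩
    · exact ⟨.inr s, hs, _, (τ.mem_range_diamondMap hs hp).trans h⟩
  · intro x y z γ δ hγ hδ κ hκ
    have h := hδ _ (hγ κ hκ)
    rw [Category.assoc] at h
    exact h
  · rintro (T' | s) x y γ hγ κ ⟨T, p, rfl, g, l, hg, rfl⟩
    · obtain ⟨⟨a, ha⟩, ⟨b, hb⟩, δ, h1, rfl, h3⟩ :=
        exists_path_lift (τ.isOpenEmbedding_region T').isEmbedding γ hγ
      have h2 := τ.region_unique ha (congrArg Subtype.val h1)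
      obtain ⟨rfl, h4⟩ := Prod.mk.inj h2
      obtain rfl : a = p.1 := h4
      let δ' : Path p (⟨b, hb.1⟩ : Face) :=
        ⟨⟨fun t => ⟨(δ t).1, (δ t).2.1⟩, by fun_prop⟩, by simp, by simp⟩
      refine ⟨T', ⟨b, hb.1⟩, rfl, g, l, hg, ?_⟩
      rw [mk_eq_scHom (τ.faceMap T') γ δ' h3 rfl rfl]
      simp
    · have hs : τ.mate s ≠ s := (hγ 0).1
      have hemb : Topology.IsEmbedding (τ.diamondHom hs) :=
        Topology.IsEmbedding.of_comp (τ.diamondHom hs).continuous continuous_subtype_val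
          (τ.isOpenEmbedding_diamondMap hs).isEmbedding
      obtain ⟨q, q', δ, h1, rfl, h3⟩ := exists_path_lift hemb γ fun t => by
        obtain ⟨z, hz⟩ := (hγ t).2
        exact ⟨z, Subtype.ext hz⟩
      have h' : τ.faceMap s.1 (.mid s.2) = τ.diamondHom hs diamondCenter :=
        (τ.diamond_upper hs (q := diamondCenter) le_rfl (diamondPt_center s.2).symm).1
      obtain ⟨g', l', hg', h4⟩ := Reach.to_center τ hs (q := q)
        (κ := g ≫ scHom (τ.faceMap T) .center p ≫ ptHom h1.symm) ⟨T, p, h1.symm, g, l, hg, rfl⟩ h'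
      have h5 := Reach.of_center τ hs q' h' hg'
      rw [mk_eq_scHom _ γ δ h3 h1.symm rfl, ← scHom_comp _ q diamondCenter q']
      convert h5 using 1
      have h6 := congrArg (fun z => z ≫ scHom (τ.diamondHom hs) diamondCenter q') h4
      simpa using h6

theorem realizes_of_hom [T2Space S] {T T' : Fin τ.n} (f : τ.base T ⟶ τ.base T') :
    ∃ l, Realizes τ.IsEdge f l := by
  obtain ⟨γ, rfl⟩ := Path.Homotopic.Quotient.mk_surjective f
  obtain ⟨T₁, p, h, g, l, hg, h1⟩ := τ.reach_of_path γ (κ := 𝟙 (τ.base T))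
    ⟨T, .center, rfl, 𝟙 _, [], .nil _, by simp⟩
  rw [Category.id_comp] at h1
  -- The barycentre has only one preimage in the triangles, so the triangle reached is `T'` and the
  -- point reached is its barycentre.
  have hr : Face.center.1 ∈ τ.region T' :=
    ⟨Face.center.2, fun i _ => by rw [Face.center_apply]; norm_num⟩
  have h2 := τ.region_unique hr (congrArg Subtype.val h).symm
  obtain ⟨rfl, h3⟩ := Prod.mk.inj h2
  obtain rfl : Face.center = p := Subtype.ext h3
  refine ⟨l, ?_⟩
  rw [scHom_self] at h1
  have h4 : g ≫ 𝟙 (τ.base T') ≫ 𝟙 (τ.base T') = g := by simp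
  change Realizes τ.IsEdge (FundamentalGroupoid.fromPath (.mk γ)) l
  rw [h1.trans h4]
  exact hg

end IdealTriangulation

end OrbSurface

namespace OrbSurface

/-! ### Pushing the marked points off the boundary -/

section Push

/-- A translation away from the boundary of the half-plane, supported near `o`. -/
noncomputable def halfPush (o : EuclideanHalfSpace 2) (r : ℝ) (t : unitInterval)
    (y : EuclideanHalfSpace 2) : EuclideanHalfSpace 2 :=
  ⟨y.1 + ((t : ℝ) * max 0 (r - dist y.1 o.1)) • EuclideanSpace.single 0 1, by
    have h : 0 ≤ (t : ℝ) * max 0 (r - dist y.1 o.1) := mul_nonneg t.2.1 (le_max_left _ _)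
    simpa using add_nonneg y.2 h⟩

variable {o : EuclideanHalfSpace 2} {r : ℝ}

theorem continuous_halfPush : Continuous fun a : unitInterval × EuclideanHalfSpace 2 =>
    halfPush o r a.1 a.2 := by
  have h : Continuous fun a : unitInterval × EuclideanHalfSpace 2 => a.2.1 :=
    continuous_subtype_val.comp continuous_snd
  refine Continuous.subtype_mk ?_ _
  fun_prop

theorem halfPush_zero (y : EuclideanHalfSpace 2) : halfPush o r 0 y = y :=
  Subtype.ext (by simp [halfPush])

theorem halfPush_of_le {y : EuclideanHalfSpace 2} (h : r ≤ dist y.1 o.1) (t : unitInterval) :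
    halfPush o r t y = y :=
  Subtype.ext (by simp [halfPush, max_eq_left (sub_nonpos.2 h)])

theorem dist_halfPush {y : EuclideanHalfSpace 2} (h : dist y.1 o.1 ≤ r) (t : unitInterval) :
    dist (halfPush o r t y).1 o.1 ≤ r := by
  have h1 : dist (halfPush o r t y).1 y.1 ≤ r - dist y.1 o.1 := by
    simp only [halfPush, dist_self_add_left, norm_smul, max_eq_right (sub_nonneg.2 h),
      PiLp.norm_single]
    rw [norm_one, mul_one, Real.norm_of_nonneg (mul_nonneg t.2.1 (sub_nonneg.2 h))]
    exact mul_le_of_le_one_left (sub_nonneg.2 h) t.2.2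
  have := dist_triangle (halfPush o r t y).1 y.1 o.1
  linarith

/-- The displacement is along the inner normal, so a point sent to the boundary point `o` was on the
boundary with the same tangential coordinate. It is thus `o` itself, which moves by `t * r`. -/
theorem eq_zero_of_halfPush (hr : 0 < r) (ho : o.1 0 = 0) {t : unitInterval}
    {y : EuclideanHalfSpace 2} (h : halfPush o r t y = o) : t = 0 := by
  have h0 := congrArg (fun z => z.1 0) h
  have h1 := congrArg (fun z => z.1 1) h
  simp only [halfPush, PiLp.add_apply, PiLp.smul_apply, smul_eq_mul] at h0 h1
  simp [ho] at h0 h1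
  have hy : 0 ≤ y.1 0 := y.2
  have h2 : 0 ≤ (t : ℝ) * max 0 (r - dist y.1 o.1) := mul_nonneg t.2.1 (le_max_left _ _)
  have h3 : y.1 0 = 0 := by linarith
  have h4 : y.1 = o.1 := by
    ext k
    fin_cases k
    · exact h3.trans ho.symm
    · exact h1
  rw [h3, h4, dist_self, sub_zero, zero_add, max_eq_right hr.le] at h0
  exact Subtype.ext ((mul_eq_zero.1 h0).resolve_right hr.ne')

end Push

variable {S : Type*} [TopologicalSpace S] [ChartedSpace (EuclideanHalfSpace 2) S]

open Classical in
/-- A boundary point can be pushed into the surface, inside of a given neighbourhood. -/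
theorem exists_push_of_boundary [T2Space S] {m : S}
    (hm : m ∈ (modelWithCornersEuclideanHalfSpace 2).boundary S) {N : Set S} (hN : IsOpen N)
    (hmN : m ∈ N) :
    ∃ H : C(unitInterval × S, S), (∀ x, H (0, x) = x) ∧ (∀ t, ∀ x ∉ N, H (t, x) = x) ∧
      (∀ t, ∀ x ∈ N, H (t, x) ∈ N) ∧ ∀ t x, H (t, x) = m → t = 0 := by
  set φ := chartAt (EuclideanHalfSpace 2) m
  set o := φ m
  have ho : o.1 0 = 0 := by
    have h1 : extChartAt (modelWithCornersEuclideanHalfSpace 2) m m ∈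
      frontier (Set.range (modelWithCornersEuclideanHalfSpace 2)) := hm
    rw [frontier_range_modelWithCornersEuclideanHalfSpace] at h1
    exact h1.symm
  have hms : m ∈ φ.source := mem_chart_source _ m
  have hopen : IsOpen (φ.target ∩ φ.symm ⁻¹' N) := φ.symm.isOpen_inter_preimage hN
  obtain ⟨O, hO, hO'⟩ := isOpen_induced_iff.1 hopen
  have hoO : o.1 ∈ O := by
    have : o ∈ Subtype.val ⁻¹' O := by
      rw [hO']
      exact ⟨φ.map_source hms, by simpa [o, φ.left_inv hms] using hmN⟩
    exact this
  obtain ⟨r, hr, hrO⟩ := Metric.nhds_basis_closedBall.mem_iff.1 (hO.mem_nhds hoO)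
  have hball : ∀ y : EuclideanHalfSpace 2, dist y.1 o.1 ≤ r → y ∈ φ.target ∧ φ.symm y ∈ N := by
    intro y hy
    have : y ∈ Subtype.val ⁻¹' O := hrO hy
    rw [hO'] at this
    exact this
  let B : Set (EuclideanHalfSpace 2) := {y | dist y.1 o.1 ≤ r}
  have hB : IsCompact B := by
    have h1 : Topology.IsClosedEmbedding (Subtype.val : EuclideanHalfSpace 2 → _) :=
      (isClosed_le continuous_const (PiLp.continuous_apply 2 _ 0)).isClosedEmbedding_subtypeVal
    exact h1.isCompact_preimage (isCompact_closedBall o.1 r)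
  -- The support of the push is compact, hence closed in a Hausdorff surface, and the push can be
  -- extended by the identity.
  have hK : IsClosed (φ.symm '' B) :=
    (hB.image_of_continuousOn (φ.continuousOn_symm.mono fun y hy => (hball y hy).1)).isClosed
  have hpush : ∀ (t : unitInterval) (y : EuclideanHalfSpace 2), y ∈ φ.target →
      halfPush o r t y ∈ φ.target := by
    intro t y hy
    rcases le_total r (dist y.1 o.1) with h | h
    · rwa [halfPush_of_le h]
    · exact (hball _ (dist_halfPush h t)).1
  let H : unitInterval × S → S := fun a =>
    if a.2 ∈ φ.source then φ.symm (halfPush o r a.1 (φ a.2)) else a.2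
  have hH1 : ∀ t, ∀ x ∈ φ.source, H (t, x) = φ.symm (halfPush o r t (φ x)) := fun t x hx => if_pos hx
  have hH2 : ∀ t, ∀ x ∉ φ.symm '' B, H (t, x) = x := by
    intro t x hx
    by_cases hxs : x ∈ φ.source
    · rw [hH1 t x hxs, halfPush_of_le, φ.left_inv hxs]
      by_contra h
      exact hx ⟨φ x, (not_le.1 h).le, φ.left_inv hxs⟩
    · exact if_neg hxs
  have hKN : φ.symm '' B ⊆ N := by
    rintro _ ⟨y, hy, rfl⟩
    exact (hball y hy).2
  have hKs : φ.symm '' B ⊆ φ.source := by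
    rintro _ ⟨y, hy, rfl⟩
    exact φ.map_target (hball y hy).1
  have hcont : Continuous H := by
    rw [continuous_iff_continuousAt]
    rintro ⟨t, x⟩
    by_cases hx : x ∈ φ.symm '' B
    · have hxs := hKs hx
      have h1 : ContinuousOn (fun a : unitInterval × S => φ.symm (halfPush o r a.1 (φ a.2)))
          (Set.univ ×ˢ φ.source) := by
        refine φ.continuousOn_symm.comp ?_ fun a ha => hpush _ _ (φ.map_source ha.2)
        refine continuous_halfPush.comp_continuousOn (continuousOn_fst.prodMk ?_)
        exact φ.continuousOn.comp continuousOn_snd fun a ha => ha.2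
      have h2 : Set.univ ×ˢ φ.source ∈ nhds (t, x) :=
        (isOpen_univ.prod φ.open_source).mem_nhds ⟨trivial, hxs⟩
      refine (h1.continuousAt h2).congr ?_
      filter_upwards [h2] with a ha
      exact (hH1 a.1 a.2 ha.2).symm
    · have h2 : Set.univ ×ˢ (φ.symm '' B)ᶜ ∈ nhds (t, x) :=
        (isOpen_univ.prod hK.isOpen_compl).mem_nhds ⟨trivial, hx⟩
      refine continuous_snd.continuousAt.congr ?_
      filter_upwards [h2] with a ha
      exact (hH2 a.1 a.2 ha.2).symm
  refine ⟨⟨H, hcont⟩, ?_, fun t x hx => hH2 t x fun h => hx (hKN h), ?_, ?_⟩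
  · intro x
    by_cases hxs : x ∈ φ.source
    · exact (hH1 0 x hxs).trans (by rw [halfPush_zero, φ.left_inv hxs])
    · exact if_neg hxs
  · intro t x hx
    by_cases h : x ∈ φ.symm '' B
    · obtain ⟨y, hy, rfl⟩ := h
      have h1 := hH1 t _ (φ.map_target (hball y hy).1)
      rw [φ.right_inv (hball y hy).1] at h1
      change H (t, φ.symm y) ∈ N
      rw [h1]
      exact (hball _ (dist_halfPush hy t)).2
    · change H (t, x) ∈ N
      rwa [hH2 t x h]
  · intro t x hx
    change H (t, x) = m at hx
    by_cases hxs : x ∈ φ.source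
    · rw [hH1 t x hxs] at hx
      apply eq_zero_of_halfPush hr ho (y := φ x)
      rw [← φ.right_inv (hpush t _ (φ.map_source hxs)), hx]
    · rw [hH2 t x fun h => hxs (hKs h)] at hx
      exact absurd (hx ▸ hms) hxs

/-- A finite set of boundary points can be pushed into the surface, relatively to a finite set. -/
theorem exists_push [T2Space S] {M A : Set S} (hM : M.Finite) (hA : A.Finite) (hMA : Disjoint M A)
    (hb : M ⊆ (modelWithCornersEuclideanHalfSpace 2).boundary S) :
    ∃ H : C(unitInterval × S, S), (∀ x, H (0, x) = x) ∧ (∀ t, ∀ x ∈ A, H (t, x) = x) ∧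
      (∀ t x, H (t, x) ∈ A → x ∈ A) ∧ ∀ t x, H (t, x) ∈ M → t = 0 := by
  induction M, hM using Set.Finite.induction_on generalizing A with
  | empty => exact ⟨⟨Prod.snd, continuous_snd⟩, by simp, by simp, by simp, by simp⟩
  | @insert m M hmM hM ih =>
    rw [Set.disjoint_insert_left] at hMA
    obtain ⟨H, h1, h2, h3, h4⟩ := ih hA hMA.2 ((Set.subset_insert _ _).trans hb)
    -- The new push is supported away from `A` and from the other points of `M`, so it neither moves
    -- them nor brings other points onto them.
    obtain ⟨K, k1, k2, k3, k4⟩ := exists_push_of_boundary (hb (Set.mem_insert _ _))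
      (N := (A ∪ M)ᶜ) (hA.union hM).isClosed.isOpen_compl (by simp [hMA.1, hmM])
    have k5 : ∀ t x, K (t, x) ∈ A ∪ M → K (t, x) = x := by
      intro t x hx
      refine k2 t x fun h => k3 t x h hx
    refine ⟨K.comp ⟨fun a => (a.1, H a), by fun_prop⟩, ?_, ?_, ?_, ?_⟩
    · intro x
      simp [h1, k1]
    · intro t x hx
      simp only [ContinuousMap.comp_apply, ContinuousMap.coe_mk]
      rw [h2 t x hx, k2 t x (by simp [hx])]
    · intro t x hx
      simp only [ContinuousMap.comp_apply, ContinuousMap.coe_mk] at hx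
      rw [k5 t _ (Or.inl hx)] at hx
      exact h3 t x hx
    · rintro t x (hx | hx)
      · exact k4 t _ hx
      · simp only [ContinuousMap.comp_apply, ContinuousMap.coe_mk] at hx
        rw [k5 t _ (Or.inr hx)] at hx
        exact h4 t x hx

end OrbSurface

namespace OrbSurface

/-! ### A disc around the puncture of a self-folded triangle -/

section FoldCoordinates

/-- The coordinate on the cone obtained from a quadrant by gluing its two sides. -/
noncomputable def coneCoord (u v : ℝ) : ℂ :=
  ⟨u + v - 4 * min u v, if v ≤ u then √(8 * v * (u - v)) else -√(8 * u * (v - u))⟩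

theorem continuous_coneCoord : Continuous fun a : ℝ × ℝ => coneCoord a.1 a.2 := by
  have h1 : Continuous fun a : ℝ × ℝ => a.1 + a.2 - 4 * min a.1 a.2 := by fun_prop
  have h2 : Continuous fun a : ℝ × ℝ =>
      if a.2 ≤ a.1 then √(8 * a.2 * (a.1 - a.2)) else -√(8 * a.1 * (a.2 - a.1)) := by
    refine Continuous.if_le (by fun_prop) (by fun_prop) (by fun_prop) (by fun_prop) ?_
    intro a ha
    simp [ha]
  exact Complex.equivRealProdCLM.symm.continuous.comp (h1.prodMk h2)

theorem coneCoord_zero_left {u : ℝ} (hu : 0 ≤ u) : coneCoord 0 u = u := by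
  apply Complex.ext
  · simp [coneCoord, hu]
  · simp only [coneCoord, mul_zero, zero_mul, Real.sqrt_zero, neg_zero, Complex.ofReal_im]
    split_ifs with h
    · exact Real.sqrt_eq_zero_of_nonpos (by nlinarith)
    · rfl

theorem coneCoord_zero_right {u : ℝ} (hu : 0 ≤ u) : coneCoord u 0 = u := by
  apply Complex.ext
  · simp [coneCoord, hu]
  · simp [coneCoord, hu]

/-- The imaginary part is the square root that completes the real part to the modulus `u + v`, with
a sign telling which coordinate is larger. Hence both half-axes go to the positive real axis and the
diagonal goes to the negative one. -/
theorem norm_coneCoord {u v : ℝ} (hu : 0 ≤ u) (hv : 0 ≤ v) : ‖coneCoord u v‖ = u + v := by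
  rw [← abs_of_nonneg (norm_nonneg _), ← abs_of_nonneg (add_nonneg hu hv), ← sq_eq_sq_iff_abs_eq_abs,
    ← Complex.normSq_eq_norm_sq, Complex.normSq_apply]
  rcases le_or_gt v u with h | h
  · simp only [coneCoord, if_pos h, min_eq_right h]
    rw [Real.mul_self_sqrt (mul_nonneg (by linarith) (by linarith))]
    ring
  · simp only [coneCoord, if_neg (not_le.2 h), min_eq_left h.le]
    rw [neg_mul_neg, Real.mul_self_sqrt (mul_nonneg (by linarith) (by linarith))]
    ring

/-- The smaller coordinate of the point of the cone. -/
noncomputable def coneMin (z : ℂ) : ℝ := (‖z‖ - z.re) / 4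

/-- The larger coordinate of the point of the cone. -/
noncomputable def coneMax (z : ℂ) : ℝ := (3 * ‖z‖ + z.re) / 4

theorem coneMin_nonneg (z : ℂ) : 0 ≤ coneMin z := by
  have := Complex.re_le_norm z
  rw [coneMin]
  linarith

theorem coneMin_le_coneMax (z : ℂ) : coneMin z ≤ coneMax z := by
  have := neg_le_of_abs_le (Complex.abs_re_le_norm z)
  rw [coneMin, coneMax]
  linarith

theorem coneMax_nonneg (z : ℂ) : 0 ≤ coneMax z := (coneMin_nonneg z).trans (coneMin_le_coneMax z)

theorem coneMin_add_coneMax (z : ℂ) : coneMin z + coneMax z = ‖z‖ := by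
  rw [coneMin, coneMax]
  ring

theorem sqrt_cone (z : ℂ) : √(8 * coneMin z * (coneMax z - coneMin z)) = |z.im| := by
  rw [← Real.sqrt_sq_eq_abs]
  congr 1
  have h := Complex.normSq_apply z
  rw [Complex.normSq_eq_norm_sq] at h
  rw [coneMin, coneMax]
  linear_combination h

theorem coneCoord_max_min {z : ℂ} (hz : 0 ≤ z.im) : coneCoord (coneMax z) (coneMin z) = z := by
  have h := coneMin_le_coneMax z
  apply Complex.ext
  · simp only [coneCoord, min_eq_right h]
    rw [coneMin, coneMax]
    ring
  · simp only [coneCoord, if_pos h]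
    rw [sqrt_cone, abs_of_nonneg hz]

theorem coneCoord_min_max {z : ℂ} (hz : z.im < 0) : coneCoord (coneMin z) (coneMax z) = z := by
  have h := coneMin_le_coneMax z
  have h' : ¬ coneMax z ≤ coneMin z := by
    intro h1
    have h2 := sqrt_cone z
    rw [le_antisymm h1 h, sub_self, mul_zero, Real.sqrt_zero] at h2
    exact hz.ne (abs_eq_zero.1 h2.symm)
  apply Complex.ext
  · simp only [coneCoord, min_eq_left h]
    rw [coneMin, coneMax]
    ring
  · simp only [coneCoord, if_neg h']
    rw [sqrt_cone, abs_of_neg hz, neg_neg]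

variable {u v : ℝ} (hu : 0 ≤ u) (hv : 0 ≤ v)
include hu hv

theorem coneMin_coneCoord : coneMin (coneCoord u v) = min u v := by
  rw [coneMin, norm_coneCoord hu hv]
  simp only [coneCoord]
  ring

theorem coneMax_coneCoord : coneMax (coneCoord u v) = max u v := by
  rw [coneMax, norm_coneCoord hu hv]
  simp only [coneCoord]
  linarith [min_add_max u v]

end FoldCoordinates

section FoldPoints

/-- A point of the triangle which is not on the side opposite to the vertex `i + 1`, given by
homogeneous coordinates. -/
noncomputable def cornerPt (i : Fin 3) (u v : ℝ) (hu : 0 ≤ u) (hv : 0 ≤ v) : Triangle :=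
  trianglePt i (u / (1 + (u + v))) (1 / (1 + (u + v))) (v / (1 + (u + v))) (by positivity)
    (by positivity) (by positivity) (by
      have : (1 + (u + v)) ≠ 0 := by positivity
      field_simp
      ring)

theorem continuous_cornerPt {Z : Type*} [TopologicalSpace Z] (i : Fin 3) {u v : Z → ℝ}
    (hu : Continuous u) (hv : Continuous v) (h0 : ∀ a, 0 ≤ u a) (h1 : ∀ a, 0 ≤ v a) :
    Continuous fun a => cornerPt i (u a) (v a) (h0 a) (h1 a) := by
  have h : ∀ a, 1 + (u a + v a) ≠ 0 := fun a => by
    have := h0 a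
    have := h1 a
    positivity
  exact continuous_trianglePt _ (hu.div (by fun_prop) h) (continuous_const.div (by fun_prop) h)
    (hv.div (by fun_prop) h) _ _ _ _

/-- The homogeneous coordinates of a point of a triangle, as a point of the cone. -/
noncomputable def foldCoord (i : Fin 3) (p : Triangle) : ℂ :=
  coneCoord (p i / p (i + 1)) (p (i + 2) / p (i + 1))

theorem foldCoord_cornerPt (i : Fin 3) {u v : ℝ} (hu : 0 ≤ u) (hv : 0 ≤ v) :
    foldCoord i (cornerPt i u v hu hv) = coneCoord u v := by
  have : (1 + (u + v)) ≠ 0 := by positivity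
  simp only [foldCoord, cornerPt, trianglePt_zero, trianglePt_one, trianglePt_two]
  congr 1 <;> field_simp

theorem cornerPt_pos (i : Fin 3) {u v : ℝ} (hu : 0 ≤ u) (hv : 0 ≤ v) :
    0 < cornerPt i u v hu hv (i + 1) := by
  rw [cornerPt, trianglePt_one]
  positivity

theorem cornerPt_ne_one (i : Fin 3) {u v : ℝ} (hu : 0 ≤ u) (hv : 0 ≤ v) (h : 0 < u + v) (k : Fin 3) :
    cornerPt i u v hu hv k ≠ 1 := by
  have hpos : 0 < 1 + (u + v) := by positivity
  intro hk
  rcases fin_three_cases i k with rfl | rfl | rfl <;> simp only [cornerPt, trianglePt_zero,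
    trianglePt_one, trianglePt_two, div_eq_one_iff_eq hpos.ne'] at hk <;> linarith

theorem eq_cornerPt {i : Fin 3} {p : Triangle} (hp : 0 < p (i + 1)) {u v : ℝ} (hu : 0 ≤ u)
    (hv : 0 ≤ v) (h : p i / p (i + 1) = u) (h' : p (i + 2) / p (i + 1) = v) :
    cornerPt i u v hu hv = p := by
  have h1 := triangle_sum p i
  have h2 : 1 + (u + v) = 1 / p (i + 1) := by
    rw [← h, ← h']
    field_simp
    linarith
  refine triangle_ext i ?_ ?_ ?_
  · rw [cornerPt, trianglePt_zero, h2, ← h]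
    field_simp
  · rw [cornerPt, trianglePt_one, h2]
    field_simp
  · rw [cornerPt, trianglePt_two, h2, ← h']
    field_simp

end FoldPoints

variable {S : Type*} [TopologicalSpace S] [ChartedSpace (EuclideanHalfSpace 2) S]
  {X : MarkedSurface S}

namespace IdealTriangulation

variable {τ : IdealTriangulation X} {T : Fin τ.n} {i : Fin 3} (hT : τ.mate (T, i) = (T, i + 1))
include hT

/-- Folding exchanges the two half-axes in the homogeneous coordinates, which `coneCoord`
identifies. The third side is excluded, since the coordinate `i + 1` vanishes on it. -/
theorem fold_of_glue {a b : Fin τ.n × Triangle} (hab : Glue τ.mate a b) (ha : a.1 = T)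
    (hp : 0 < a.2 (i + 1)) : b.1 = T ∧ b.2 (i + 1) = a.2 (i + 1) ∧
      foldCoord i b.2 = foldCoord i a.2 := by
  obtain ⟨k, j, h1, -, h3, h4, h5, h6⟩ := hab
  obtain ⟨T', a⟩ := a
  obtain ⟨T'', b⟩ := b
  dsimp only at *
  subst ha
  have hT' : τ.mate (T', i + 1) = (T', i) := by rw [← hT, τ.mate_mate]
  rcases fin_three_cases i k with rfl | rfl | rfl
  · rw [hT] at h1
    obtain ⟨rfl, rfl⟩ := Prod.mk.inj h1
    simp only [fin_three_add] at h4 h5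
    refine ⟨rfl, h6, ?_⟩
    rw [foldCoord, foldCoord, h4, h3, h5, h6, zero_div,
      coneCoord_zero_left (div_nonneg (triangle_nonneg _ _) (triangle_nonneg _ _)),
      coneCoord_zero_right (div_nonneg (triangle_nonneg _ _) (triangle_nonneg _ _))]
  · rw [hT'] at h1
    obtain ⟨rfl, rfl⟩ := Prod.mk.inj h1
    simp only [fin_three_add] at h3 h6
    refine ⟨rfl, h5, ?_⟩
    rw [foldCoord, foldCoord, h4, h3, h5, h6, zero_div,
      coneCoord_zero_left (div_nonneg (triangle_nonneg _ _) (triangle_nonneg _ _)),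
      coneCoord_zero_right (div_nonneg (triangle_nonneg _ _) (triangle_nonneg _ _))]
  · rw [(fin_three_add i).2.2.2] at h3
    exact absurd h3 hp.ne'

/-- The points near the vertex of a self-folded triangle. -/
theorem fold_of_chi_eq {T' : Fin τ.n} {p p' : Triangle} (hp : 0 < p (i + 1))
    (h : τ.chi T p = τ.chi T' p') : T' = T ∧ p' (i + 1) = p (i + 1) ∧
      foldCoord i p' = foldCoord i p := by
  -- Fixing the positive value `c` of the coordinate `i + 1` keeps the whole chain of gluings away
  -- from the third side.
  have key : ∀ (c : ℝ) (z : ℂ) (a b : Fin τ.n × Triangle), 0 < c →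
      Relation.EqvGen (Glue τ.mate) a b →
      ((a.1 = T ∧ a.2 (i + 1) = c ∧ foldCoord i a.2 = z) ↔
        (b.1 = T ∧ b.2 (i + 1) = c ∧ foldCoord i b.2 = z)) := by
    intro c z a b hc h
    have h1 : ∀ a b, Glue τ.mate a b → (a.1 = T ∧ a.2 (i + 1) = c ∧ foldCoord i a.2 = z) →
        (b.1 = T ∧ b.2 (i + 1) = c ∧ foldCoord i b.2 = z) := by
      rintro a b h ⟨h1, h2, h3⟩
      obtain ⟨h4, h5, h6⟩ := fold_of_glue hT h h1 (h2 ▸ hc)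
      exact ⟨h4, h5.trans h2, h6.trans h3⟩
    induction h with
    | rel a b h => exact ⟨h1 a b h, h1 b a (h.symm τ.mate_mate)⟩
    | refl a => rfl
    | symm a b _ ih => exact ih.symm
    | trans a b c _ _ ih1 ih2 => exact ih1.trans ih2
  exact (key (p (i + 1)) (foldCoord i p) (T, p) (T', p') hp ((τ.chi_eq_iff _ _ _ _).1 h)).1
    ⟨rfl, rfl, rfl⟩

theorem chi_cornerPt_swap {u : ℝ} (hu : 0 ≤ u) :
    τ.chi T (cornerPt i u 0 hu le_rfl) = τ.chi T (cornerPt i 0 u le_rfl hu) := by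
  rw [τ.chi_eq_iff]
  refine Relation.EqvGen.rel _ _ ⟨i, i + 1, hT, ?_, ?_, ?_, ?_, ?_⟩
  · simp
  · simp [cornerPt]
  · simp [cornerPt, fin_three_add]
  · simp [cornerPt, fin_three_add]
  · simp [cornerPt]

omit hT in
variable (T i) in
open Classical in
/-- The parametrization of the neighbourhood of the vertex of a self-folded triangle. -/
noncomputable def foldMap (z : ℂ) : S :=
  if 0 ≤ z.im then τ.chi T (cornerPt i (coneMax z) (coneMin z) (coneMax_nonneg z) (coneMin_nonneg z))
    else τ.chi T (cornerPt i (coneMin z) (coneMax z) (coneMin_nonneg z) (coneMax_nonneg z))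

theorem foldMap_of_nonpos {z : ℂ} (hz : z.im ≤ 0) : τ.foldMap T i z =
    τ.chi T (cornerPt i (coneMin z) (coneMax z) (coneMin_nonneg z) (coneMax_nonneg z)) := by
  rcases hz.eq_or_lt with h | h
  · rw [foldMap, if_pos h.ge]
    -- On the real axis either the smaller coordinate vanishes, and the two formulas give points
    -- which are glued, or the two coordinates coincide.
    have h1 := sqrt_cone z
    rw [h, abs_zero, Real.sqrt_eq_zero (mul_nonneg (mul_nonneg (by norm_num) (coneMin_nonneg z))
      (sub_nonneg.2 (coneMin_le_coneMax z))), mul_eq_zero] at h1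
    rcases h1 with h1 | h1
    · have h2 : coneMin z = 0 := by linarith
      simp only [h2]
      exact chi_cornerPt_swap hT _
    · have h2 : coneMax z = coneMin z := by linarith
      simp only [h2]
  · exact if_neg (not_le.2 h)

theorem continuous_foldMap : Continuous (τ.foldMap T i) := by
  have h1 : Continuous coneMin := by
    unfold coneMin
    fun_prop
  have h2 : Continuous coneMax := by
    unfold coneMax
    fun_prop
  refine Continuous.if_le ((τ.chi T).continuous.comp (continuous_cornerPt i h2 h1 _ _))
    ((τ.chi T).continuous.comp (continuous_cornerPt i h1 h2 _ _)) continuous_const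
    Complex.continuous_im ?_
  intro z hz
  rw [← foldMap_of_nonpos hT hz.ge, foldMap, if_pos hz.le]

omit hT in
theorem exists_foldMap (z : ℂ) : ∃ p : Triangle, 0 < p (i + 1) ∧ foldCoord i p = z ∧
    τ.foldMap T i z = τ.chi T p := by
  rcases le_or_gt 0 z.im with h | h
  · exact ⟨_, cornerPt_pos i _ _, by rw [foldCoord_cornerPt, coneCoord_max_min h], if_pos h⟩
  · exact ⟨_, cornerPt_pos i _ _, by rw [foldCoord_cornerPt, coneCoord_min_max h],
      if_neg (not_le.2 h)⟩

theorem foldMap_foldCoord {p : Triangle} (hp : 0 < p (i + 1)) :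
    τ.foldMap T i (foldCoord i p) = τ.chi T p := by
  have hu : 0 ≤ p i / p (i + 1) := div_nonneg (triangle_nonneg _ _) hp.le
  have hv : 0 ≤ p (i + 2) / p (i + 1) := div_nonneg (triangle_nonneg _ _) hp.le
  rcases le_or_gt (p (i + 2) / p (i + 1)) (p i / p (i + 1)) with h | h
  · have h1 : 0 ≤ (foldCoord i p).im := by
      simp only [foldCoord, coneCoord, if_pos h]
      positivity
    rw [foldMap, if_pos h1]
    congr 1
    apply eq_cornerPt hp
    · rw [foldCoord, coneMax_coneCoord hu hv, max_eq_left h]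
    · rw [foldCoord, coneMin_coneCoord hu hv, min_eq_right h]
  · have h1 : (foldCoord i p).im ≤ 0 := by
      simp only [foldCoord, coneCoord, if_neg (not_le.2 h)]
      exact neg_nonpos.2 (Real.sqrt_nonneg _)
    rw [foldMap_of_nonpos hT h1]
    congr 1
    apply eq_cornerPt hp
    · rw [foldCoord, coneMin_coneCoord hu hv, min_eq_left h.le]
    · rw [foldCoord, coneMax_coneCoord hu hv, max_eq_right h.le]

/-- Removing the side opposite to the puncture from the folded triangle leaves a neighbourhood of
the puncture, on which the single chart `foldCoord` inverts the parametrization. -/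
theorem isOpenEmbedding_foldMap [T2Space S] : Topology.IsOpenEmbedding (τ.foldMap T i) := by
  refine τ.isOpenEmbedding_of_charts (κ := Unit) (continuous_foldMap hT) (fun _ => T)
    (fun _ => {p | 0 < p (i + 1)}) (fun _ => isOpen_lt continuous_const (triangle_continuous _))
    (fun _ => foldCoord i) (fun _ => ?_) (fun _ _ _ _ _ _ => rfl) ?_
  · refine continuous_coneCoord.comp_continuousOn (f := fun p : Triangle =>
      (p i / p (i + 1), p (i + 2) / p (i + 1))) ?_
    exact ((triangle_continuous _).continuousOn.div (triangle_continuous _).continuousOn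
      fun p hp => ne_of_gt hp).prodMk ((triangle_continuous _).continuousOn.div
        (triangle_continuous _).continuousOn fun p hp => ne_of_gt hp)
  · intro T' p z
    constructor
    · intro h
      obtain ⟨q, hq, h1, h2⟩ := exists_foldMap (T := T) (i := i) z
      obtain ⟨h3, h4, h5⟩ := fold_of_chi_eq hT hq (h2.symm.trans h.symm)
      exact ⟨(), h3.symm, by simpa [h4] using hq, h5.trans h1⟩
    · rintro ⟨-, rfl, h1, rfl⟩
      exact (foldMap_foldCoord hT h1).symm

omit hT in
theorem foldMap_zero : τ.foldMap T i 0 = τ.chi T (stdSimplex.vertex (i + 1)) := by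
  rw [foldMap, if_pos (by simp)]
  congr 1
  refine triangle_ext i ?_ ?_ ?_ <;>
    simp [cornerPt, coneMin, coneMax, (fin_three_ne i).2.2, (fin_three_ne i).1.symm]

omit hT in
theorem eq_zero_of_foldMap {z : ℂ} (h : τ.foldMap T i z ∈ X.punctures) : z = 0 := by
  have hm := coneMin_nonneg z
  have hM := coneMax_nonneg z
  have hs := coneMin_add_coneMax z
  by_contra hz
  have hz' : 0 < ‖z‖ := norm_pos_iff.2 hz
  rw [foldMap] at h
  split_ifs at h
  · exact τ.notMem_vertices T _ (cornerPt_ne_one i _ _ (by linarith)) (Or.inr h)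
  · exact τ.notMem_vertices T _ (cornerPt_ne_one i _ _ (by linarith)) (Or.inr h)

/-- The disc around the vertex of a self-folded triangle. -/
noncomputable def foldDisc [T2Space S] (hP : τ.chi T (stdSimplex.vertex (i + 1)) ∈ X.punctures) :
    PuncturedDisc X where
  phi := τ.foldMap T i
  isOpenEmbedding := isOpenEmbedding_foldMap hT
  center_mem := by rwa [foldMap_zero]
  eq_zero_of_mem _ h := eq_zero_of_foldMap h

end IdealTriangulation

end OrbSurface

namespace OrbSurface

/-! ### Folded edges are involutions of the orbifold groupoid -/

section Groupoids

variable {Y Z W : Type*} [TopologicalSpace Y] [TopologicalSpace Z] [TopologicalSpace W]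

theorem map_scHom [SimplyConnectedSpace Z] (g : C(Y, W)) (f : C(Z, Y)) (a b : Z) :
    (FundamentalGroupoid.map g).map (scHom f a b) = scHom (g.comp f) a b := by
  exact (Path.Homotopic.Quotient.map_comp (p := Path.Homotopic.Quotient.mk
    (PathConnectedSpace.somePath a b)) (f := f) (g := g)).symm

theorem map_ptHom (g : C(Y, W)) {x y : Y} (h : x = y) :
    (FundamentalGroupoid.map g).map (ptHom h) = ptHom (congrArg g h) := by
  subst h
  exact (FundamentalGroupoid.map g).map_id _

/-- A representation of a groupoid: the composite `f ≫ g` goes to the product of the image of `g` and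
of the image of `f`. -/
structure Rep (𝒢 : Type*) [Category* 𝒢] (G : Type*) [Group G] where
  toFun : ∀ {x y : 𝒢}, (x ⟶ y) → G
  map_id : ∀ x, toFun (𝟙 x) = 1
  map_comp : ∀ {x y z : 𝒢} (f : x ⟶ y) (g : y ⟶ z), toFun (f ≫ g) = toFun g * toFun f

theorem Rep.map_eqToHom {𝒢 : Type*} [Category* 𝒢] {G : Type*} [Group G] (Θ : Rep 𝒢 G) {x y : 𝒢}
    (h : x = y) : Θ.toFun (eqToHom h) = 1 := by
  subst h
  exact Θ.map_id x

/-- The composite of a representation and of a functor. -/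
def Rep.comap {𝒢 ℋ : Type*} [Category* 𝒢] [Category* ℋ] {G : Type*} [Group G] (Θ : Rep ℋ G)
    (F : 𝒢 ⥤ ℋ) : Rep 𝒢 G where
  toFun f := Θ.toFun (F.map f)
  map_id x := by rw [F.map_id, Θ.map_id]
  map_comp f g := by rw [F.map_comp, Θ.map_comp]

/-- The hypothesis says that `f` is conjugate by `k` to the inverse of `g`. -/
theorem sq_of_conj {C : Type*} [Category* C] {x y : C} {f : x ⟶ x} {k : x ⟶ y} [IsIso k] {g : y ⟶ y}
    (h : f ≫ k ≫ g = k) (hg : g ≫ g = 𝟙 y) : f ≫ f = 𝟙 x := by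
  have h1 : f ≫ k = k ≫ g := by
    calc f ≫ k = f ≫ k ≫ g ≫ g := by rw [hg, Category.comp_id]
      _ = (f ≫ k ≫ g) ≫ g := by simp only [Category.assoc]
      _ = k ≫ g := by rw [h]
  rw [← cancel_mono k, Category.assoc, h1, h, Category.id_comp]

end Groupoids

variable {S : Type*} [TopologicalSpace S] [ChartedSpace (EuclideanHalfSpace 2) S]
  {X : MarkedSurface S}

namespace MarkedSurface

/-- The inclusion. -/
def incl (X : MarkedSurface S) : C(X.Unmarked, X.Punctured) :=
  ⟨fun x => ⟨x.1, fun h => x.2 (Or.inr h)⟩, by fun_prop⟩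

/-- The class of a path which avoids the marked points in the orbifold groupoid. -/
noncomputable def toOrb (X : MarkedSurface S) : FundamentalGroupoid X.Unmarked ⥤ Orb X :=
  FundamentalGroupoid.map X.incl ⋙ Quotient.functor (punctureHomRel X)

end MarkedSurface

theorem PuncturedDisc.loop_comp_loop (D : PuncturedDisc X) :
    (Quotient.functor (punctureHomRel X)).map (FundamentalGroupoid.fromPath (.mk D.loop)) ≫
      (Quotient.functor (punctureHomRel X)).map (FundamentalGroupoid.fromPath (.mk D.loop)) =
        𝟙 _ := by
  have h := CategoryTheory.Quotient.sound (punctureHomRel X) (PunctureRel.loop D)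
  nth_rw 2 [h]
  have h2 : FundamentalGroupoid.fromPath (Path.Homotopic.Quotient.mk D.loop) ≫
      FundamentalGroupoid.fromPath (Path.Homotopic.Quotient.mk D.loop.symm) = 𝟙 _ :=
    Path.Homotopic.Quotient.trans_symm (.mk D.loop)
  rw [← Functor.map_comp, h2]
  exact CategoryTheory.Functor.map_id _ _

namespace IdealTriangulation

variable {τ : IdealTriangulation X} {T : Fin τ.n} {i : Fin 3} (hT : τ.mate (T, i) = (T, i + 1))
include hT

/-- The loop around the vertex of a self-folded triangle, inside of the triangle. -/
theorem exists_fold_path [T2Space S]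
    (hP : τ.chi T (stdSimplex.vertex (i + 1)) ∈ X.punctures) :
    ∃ α : Path (Face.mid i) (Face.mid (i + 1)), ∀ t,
      X.incl.comp (τ.faceMap T) (α t) = (foldDisc hT hP).loop t := by
  let z : unitInterval → ℂ := fun t => Complex.exp (2 * Real.pi * Complex.I * (t : ℝ))
  have hz : Continuous z := by fun_prop
  have hmin : Continuous fun t => coneMin (z t) := by
    unfold coneMin
    fun_prop
  have hmax : Continuous fun t => coneMax (z t) := by
    unfold coneMax
    fun_prop
  have hpos : ∀ t, 0 < coneMin (z t) + coneMax (z t) := by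
    intro t
    rw [coneMin_add_coneMax]
    exact norm_pos_iff.2 (Complex.exp_ne_zero _)
  have hexp : ∀ t : unitInterval, z t = Complex.exp (((2 * Real.pi * t : ℝ) : ℂ) * Complex.I) := by
    intro t
    simp only [z]
    congr 1
    push_cast
    ring
  have him : ∀ t : unitInterval, (z t).im = Real.sin (2 * Real.pi * t) := by
    intro t
    rw [hexp, Complex.exp_ofReal_mul_I_im]
  have him1 : ∀ t : unitInterval, (t : ℝ) ≤ 1 / 2 → 0 ≤ (z t).im := by
    intro t ht
    rw [him]
    have := t.2.1
    have := Real.pi_pos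
    exact Real.sin_nonneg_of_nonneg_of_le_pi (by positivity) (by nlinarith)
  have him2 : ∀ t : unitInterval, 1 / 2 ≤ (t : ℝ) → (z t).im ≤ 0 := by
    intro t ht
    rw [him, ← Real.sin_sub_two_pi]
    have := t.2.2
    have := Real.pi_pos
    exact Real.sin_nonpos_of_nonpos_of_neg_pi_le (by nlinarith) (by nlinarith)
  let p1 : unitInterval → Face := fun t =>
    ⟨cornerPt i (coneMax (z t)) (coneMin (z t)) (coneMax_nonneg _) (coneMin_nonneg _),
      cornerPt_ne_one i _ _ (by linarith [hpos t])⟩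
  let p2 : unitInterval → Face := fun t =>
    ⟨cornerPt i (coneMin (z t)) (coneMax (z t)) (coneMin_nonneg _) (coneMax_nonneg _),
      cornerPt_ne_one i _ _ (hpos t)⟩
  have h0 : z 0 = 1 := by simp [z]
  have h1 : z 1 = 1 := by simp [z, Complex.exp_two_pi_mul_I]
  classical
  -- The two lifts, over the upper and the lower half-circle, agree at `-1`, which comes from the
  -- diagonal. At the ends, the value `1` lifts to the midpoints of the two different folded sides.
  have hcont : Continuous fun t : unitInterval => if (t : ℝ) ≤ 1 / 2 then p1 t else p2 t := by
    refine Continuous.if_le ((continuous_cornerPt i hmax hmin _ _).subtype_mk _)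
      ((continuous_cornerPt i hmin hmax _ _).subtype_mk _) continuous_subtype_val
      continuous_const ?_
    intro t ht
    have h2 : z t = -1 := by
      rw [hexp, ht]
      have : ((2 * Real.pi * (1 / 2) : ℝ) : ℂ) * Complex.I = Real.pi * Complex.I := by
        push_cast
        ring
      rw [this, Complex.exp_pi_mul_I]
    have h3 : coneMax (z t) = coneMin (z t) := by
      rw [h2]
      norm_num [coneMax, coneMin]
    apply Subtype.ext
    simp only [p1, p2, h3]
  refine ⟨⟨⟨_, hcont⟩, ?_, ?_⟩, fun t => ?_⟩
  · apply Subtype.ext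
    refine triangle_ext i ?_ ?_ ?_ <;> norm_num [p1, h0, cornerPt, coneMax, coneMin, Face.mid,
      spoke_apply, (fin_three_ne i).2.1.symm, (fin_three_ne i).2.2.symm]
  · apply Subtype.ext
    refine triangle_ext i ?_ ?_ ?_ <;> norm_num [p2, h1, cornerPt, coneMax, coneMin, Face.mid,
      spoke_apply, fin_three_add, (fin_three_ne i).1, (fin_three_ne i).2.1]
  · apply Subtype.ext
    change τ.chi T (if (t : ℝ) ≤ 1 / 2 then p1 t else p2 t).1 = τ.foldMap T i (z t)
    split_ifs with h
    · rw [foldMap, if_pos (him1 t h)]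
    · rw [foldMap_of_nonpos hT (him2 t (not_le.1 h).le)]

/-- Up to conjugation, the folded edge is the inverse of the standard loop of the disc `foldDisc`,
whose square is trivial by the defining relation. -/
theorem edgeHom_sq [T2Space S] (hP : τ.chi T (stdSimplex.vertex (i + 1)) ∈ X.punctures) :
    X.toOrb.map (τ.edgeHom hT) ≫ X.toOrb.map (τ.edgeHom hT) = 𝟙 _ := by
  obtain ⟨α, hα⟩ := exists_fold_path hT hP
  set D := foldDisc hT hP
  set f := X.incl.comp (τ.faceMap T)
  have ha : D.point 1 one_ne_zero = f (Face.mid i) := by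
    rw [← D.loop.source, ← hα, α.source]
  have hb : f (Face.mid (i + 1)) = D.point 1 one_ne_zero := by
    rw [← D.loop.target, ← hα, α.target]
  have hD := mk_eq_scHom f D.loop α hα ha hb
  set E := scHom f .center (.mid i) ≫ ptHom (ha.symm.trans hb.symm) ≫ scHom f (.mid (i + 1)) .center
  have hE : (FundamentalGroupoid.map X.incl).map (τ.edgeHom hT) = E := by
    rw [edgeHom, Functor.map_comp, Functor.map_comp, map_scHom, map_scHom]
    exact congrArg (fun z => scHom f .center (.mid i) ≫ z ≫ scHom f (.mid (i + 1)) .center)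
      (map_ptHom X.incl (τ.faceMap_mid hT))
  set k := scHom f .center (.mid i) ≫ ptHom ha.symm
  set ℓ := FundamentalGroupoid.fromPath (Path.Homotopic.Quotient.mk D.loop)
  have hk : E ≫ k ≫ ℓ = k := by
    rw [hD]
    simp [k, E]
  set Q := Quotient.functor (punctureHomRel X)
  have key : Q.map E ≫ Q.map E = 𝟙 _ :=
    sq_of_conj (k := Q.map k) (by rw [← Q.map_comp, ← Q.map_comp, hk]) D.loop_comp_loop
  exact (congrArg (fun z => Q.map z ≫ Q.map z) hE).trans key

end IdealTriangulation

/-! ### Descent of representations to the orbifold groupoid -/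

section Descent

variable {G : Type*} [Group G] (Θ : Rep (FundamentalGroupoid X.Unmarked) G)

/-- A representation which is an involution on the small loops around a puncture is an involution on
the loops in the discs around it. -/
theorem disc_loop_sq (r : C(X.Punctured, X.Unmarked)) (ρ : C(S, S)) (hr : ∀ x, (r x).1 = ρ x.1)
    (D : PuncturedDisc X) {O : Set S} (hO : IsOpen O) (hPO : ρ (D.phi 0) ∈ O)
    (h : ∀ {x y : X.Unmarked} (γ : Path x y), (∀ t, (γ t).1 ∈ O) →
      Θ.toFun (FundamentalGroupoid.fromPath (.mk γ)) *
        Θ.toFun (FundamentalGroupoid.fromPath (.mk γ)) = 1) :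
    (Θ.comap (FundamentalGroupoid.map r)).toFun (FundamentalGroupoid.fromPath (.mk D.loop)) *
      (Θ.comap (FundamentalGroupoid.map r)).toFun (FundamentalGroupoid.fromPath (.mk D.loop)) =
        1 := by
  -- In the exponential coordinate the punctured disc becomes the simply connected plane, and the
  -- loop becomes a segment from `0` to the period `c`.
  let g : C(ℂ, X.Unmarked) := r.comp
    ⟨fun z => D.point (Complex.exp z) (Complex.exp_ne_zero z),
      (D.isOpenEmbedding.continuous.comp Complex.continuous_exp).subtype_mk _⟩
  have hg : ∀ z, (g z).1 = ρ (D.phi (Complex.exp z)) := fun z => hr _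
  set c : ℂ := 2 * Real.pi * Complex.I
  have hper : ∀ z, g (z + c) = g z := by
    intro z
    apply Subtype.ext
    rw [hg, hg, Complex.exp_periodic]
  have : ContractibleSpace ℂ := inferInstance
  let ϑ : ℂ → ℂ → G := fun z w => Θ.toFun (scHom g z w)
  have hϑ : ∀ a b d, ϑ b d * ϑ a b = ϑ a d := fun a b d => by
    rw [← Θ.map_comp, scHom_comp]
  have hϑ1 : ∀ a, ϑ a a = 1 := fun a => by
    rw [← Θ.map_id, ← scHom_self g]
  have hmk : ∀ {x y : X.Unmarked} {a b : ℂ} (γ : Path x y) (δ : Path a b),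
      (∀ t, g (δ t) = γ t) → Θ.toFun (FundamentalGroupoid.fromPath (.mk γ)) = ϑ a b := by
    intro x y a b γ δ hδ
    rw [mk_eq_scHom g γ δ hδ (by rw [← γ.source, ← hδ, δ.source])
      (by rw [← γ.target, ← hδ, δ.target]), Θ.map_comp, Θ.map_comp, Θ.map_eqToHom, Θ.map_eqToHom,
      one_mul, mul_one]
  have htrans : ∀ a b, ϑ (a + c) (b + c) = ϑ a b := by
    intro a b
    have δ : Path a b := PathConnectedSpace.somePath a b
    let δ' : Path (a + c) (b + c) := ⟨⟨fun t => δ t + c, by fun_prop⟩, by simp, by simp⟩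
    rw [← hmk (δ'.map g.continuous) δ' (fun t => rfl)]
    exact hmk (δ'.map g.continuous) δ fun t => (hper _).symm
  obtain ⟨R, hR⟩ : ∃ R : ℝ, ∀ z : ℂ, ‖z‖ ≤ Real.exp R → ρ (D.phi z) ∈ O := by
    have h1 : IsOpen ((fun z => ρ (D.phi z)) ⁻¹' O) :=
      hO.preimage (ρ.continuous.comp D.isOpenEmbedding.continuous)
    obtain ⟨ε, hε, h2⟩ := Metric.nhds_basis_closedBall.mem_iff.1 (h1.mem_nhds hPO)
    refine ⟨Real.log ε, fun z hz => ?_⟩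
    rw [Real.exp_log hε] at hz
    exact h2 (by simpa using hz)
  have hsmall : ϑ R (R + c) * ϑ R (R + c) = 1 := by
    let δ : Path (R : ℂ) (R + c) := ⟨⟨fun t => R + c * (t : ℝ), by fun_prop⟩, by simp, by simp⟩
    rw [← hmk (δ.map g.continuous) δ (fun t => rfl)]
    refine h _ fun t => ?_
    change (g (δ t)).1 ∈ O
    rw [hg]
    apply hR
    rw [Complex.norm_exp]
    simp [δ, c]
  have hloop : (Θ.comap (FundamentalGroupoid.map r)).toFun
      (FundamentalGroupoid.fromPath (.mk D.loop)) = ϑ 0 c := by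
    let δ : Path (0 : ℂ) c := ⟨⟨fun t => c * (t : ℝ), by fun_prop⟩, by simp, by simp⟩
    exact hmk (D.loop.map r.continuous) δ fun t => rfl
  -- By periodicity the path from `R + c` to `c` has the same image as the one from `R` to `0`, so
  -- the given loop is conjugate to the loop of radius `exp R`, which lies in the small
  -- neighbourhood.
  have h3 : ϑ 0 c = ϑ R 0 * ϑ R (R + c) * ϑ 0 R := by
    rw [← htrans R 0, mul_assoc, hϑ, hϑ, zero_add]
  have h4 : ϑ 0 R * ϑ R 0 = 1 := by rw [hϑ, hϑ1]
  have h5 : ϑ R 0 * ϑ 0 R = 1 := by rw [hϑ, hϑ1]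
  rw [hloop, h3]
  calc ϑ R 0 * ϑ R (R + c) * ϑ 0 R * (ϑ R 0 * ϑ R (R + c) * ϑ 0 R)
      = ϑ R 0 * ϑ R (R + c) * (ϑ 0 R * ϑ R 0) * ϑ R (R + c) * ϑ 0 R := by group
    _ = ϑ R 0 * (ϑ R (R + c) * ϑ R (R + c)) * ϑ 0 R := by rw [h4]; group
    _ = 1 := by rw [hsmall, mul_one, h5]

/-- The representation of the orbifold groupoid. -/
theorem exists_orb_rep (F : Rep (FundamentalGroupoid X.Punctured) G)
    (h : ∀ D : PuncturedDisc X, F.toFun (FundamentalGroupoid.fromPath (.mk D.loop)) *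
      F.toFun (FundamentalGroupoid.fromPath (.mk D.loop)) = 1) :
    ∃ F' : Rep (Orb X) G, ∀ {x y} (f : x ⟶ y),
      F'.toFun ((Quotient.functor (punctureHomRel X)).map f) = F.toFun f := by
  let L : FundamentalGroupoid X.Punctured ⥤ SingleObj G :=
    { obj := fun _ => SingleObj.star G
      map := fun f => F.toFun f
      map_id := F.map_id
      map_comp := F.map_comp }
  let L' : Orb X ⥤ SingleObj G := CategoryTheory.Quotient.lift _ L (by
    -- An element with trivial square is its own inverse, and the inverse is the image of the
    -- reversed loop.
    rintro x y _ _ ⟨D⟩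
    have h2 : FundamentalGroupoid.fromPath (Path.Homotopic.Quotient.mk D.loop) ≫
        FundamentalGroupoid.fromPath (Path.Homotopic.Quotient.mk D.loop.symm) = 𝟙 _ :=
      Path.Homotopic.Quotient.trans_symm (.mk D.loop)
    have h3 := congrArg F.toFun h2
    rw [F.map_comp, F.map_id, ← h D] at h3
    exact (mul_right_cancel h3).symm)
  exact ⟨⟨fun f => L'.map f, L'.map_id, L'.map_comp⟩, fun f => rfl⟩

end Descent

end OrbSurface

namespace OrbSurface

/-! ### Removal of the marked points; letters attached to the dual edges -/

section PushClasses

variable {Y : Type*} [TopologicalSpace Y]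

theorem map_map_hom {Z W : Type*} [TopologicalSpace Z] [TopologicalSpace W] (g : C(Z, W)) (f : C(Y, Z))
    {x y : FundamentalGroupoid Y} (q : x ⟶ y) : (FundamentalGroupoid.map (g.comp f)).map q =
      (FundamentalGroupoid.map g).map ((FundamentalGroupoid.map f).map q) := by
  obtain ⟨γ, rfl⟩ := Path.Homotopic.Quotient.mk_surjective q
  rfl

/-- A path is homotopic to its image under the end of a homotopy which fixes its ends. -/
theorem map_eq_of_homotopy (K : C(unitInterval × Y, Y)) (h0 : ∀ y, K (0, y) = y) (f : C(Y, Y))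
    (h1 : ∀ y, K (1, y) = f y) {x y : Y} (hx : ∀ t, K (t, x) = x) (hy : ∀ t, K (t, y) = y)
    (hfx : f x = x) (hfy : f y = y) (q : FundamentalGroupoid.mk x ⟶ FundamentalGroupoid.mk y) :
    (FundamentalGroupoid.map f).map q = ptHom hfx ≫ q ≫ ptHom hfy.symm := by
  obtain ⟨γ, rfl⟩ := Path.Homotopic.Quotient.mk_surjective q
  have h2 := FundamentalGroupoid.conj_eqToHom (p := Path.Homotopic.Quotient.mk γ) hfx hfy
  refine Eq.trans ?_ h2.symm
  change Path.Homotopic.Quotient.map (.mk γ) f = _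
  rw [← Path.Homotopic.Quotient.mk_map, ← Path.Homotopic.Quotient.mk_cast,
    Path.Homotopic.Quotient.eq]
  refine Path.Homotopic.symm ⟨⟨⟨K.comp ⟨fun a => (a.1, γ a.2), by fun_prop⟩, ?_, ?_⟩, ?_⟩⟩
  · intro t
    exact h0 _
  · intro t
    exact h1 _
  · rintro t s (rfl | rfl)
    · simp [hx, hfx]
    · simp [hy, hfy]

end PushClasses

variable {S : Type*} [TopologicalSpace S] [ChartedSpace (EuclideanHalfSpace 2) S]
  {X : MarkedSurface S}

namespace FoldedTriangulation

variable (τ : FoldedTriangulation X)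

/-- The marked points can be pushed away from the boundary, while the punctures and the
barycentres are fixed. -/
theorem exists_retraction [T2Space S] :
    ∃ (ρ : C(S, S)) (r : C(X.Punctured, X.Unmarked)), (∀ x, (r x).1 = ρ x.1) ∧
      (∀ P ∈ X.punctures, ρ P = P) ∧ (∀ T, r (X.incl (τ.faceMap T .center)) = τ.faceMap T .center) ∧
      (∀ {T T' : Fin τ.n} (q : τ.base T ⟶ τ.base T'),
        ∃ h h', (FundamentalGroupoid.map r).map ((FundamentalGroupoid.map X.incl).map q) =
          ptHom h ≫ q ≫ ptHom h') ∧
      ∀ {T T' : Fin τ.n} (q : FundamentalGroupoid.mk (X.incl (τ.faceMap T .center)) ⟶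
        FundamentalGroupoid.mk (X.incl (τ.faceMap T' .center))),
        ∃ q' : τ.base T ⟶ τ.base T', (FundamentalGroupoid.map X.incl).map q' = q := by
  -- The barycentres are kept fixed together with the punctures, so that the homotopies below fix
  -- the base points.
  let A : Set S := X.punctures ∪ Set.range fun T => (τ.faceMap T .center).1
  have hMA : Disjoint X.marked A := by
    rw [Set.disjoint_left]
    rintro x hx (h | ⟨T, rfl⟩)
    · exact Set.disjoint_left.1 ModelWithCorners.disjoint_interior_boundary (X.punctures_subset h)
        (X.marked_subset hx)
    · exact (τ.faceMap T .center).2 (Or.inl hx)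
  obtain ⟨H, h0, h1, h2, h3⟩ := exists_push X.marked_finite
    (X.punctures_finite.union (Set.finite_range _)) hMA X.marked_subset
  have hpunc : ∀ t x, x ∉ X.punctures → H (t, x) ∉ X.punctures := by
    intro t x hx h
    apply hx
    rwa [h1 t x (h2 t x (Or.inl h))] at h
  let ρ : C(S, S) := ⟨fun x => H (1, x), by fun_prop⟩
  let r : C(X.Punctured, X.Unmarked) := ⟨fun x => ⟨ρ x.1, by
    rintro (h | h)
    · exact one_ne_zero (h3 _ _ h)
    · exact hpunc _ _ x.2 h⟩, by fun_prop⟩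
  have hbase : ∀ T t, H (t, (τ.faceMap T .center).1) = (τ.faceMap T .center).1 :=
    fun T t => h1 t _ (Or.inr ⟨T, rfl⟩)
  -- A marked point is hit only at time `0`, so the homotopy preserves the unmarked surface. With
  -- `K'` on the larger surface, this makes `r` inverse to the inclusion on classes of paths between
  -- barycentres.
  let K : C(unitInterval × X.Unmarked, X.Unmarked) := ⟨fun a => ⟨H (a.1, a.2.1), by
    rintro (h | h)
    · have h4 : a.1 = 0 := h3 _ _ h
      rw [h4, h0] at h
      exact a.2.2 (Or.inl h)
    · exact hpunc _ _ (fun h => a.2.2 (Or.inr h)) h⟩, by fun_prop⟩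
  let K' : C(unitInterval × X.Punctured, X.Punctured) :=
    ⟨fun a => ⟨H (a.1, a.2.1), hpunc _ _ a.2.2⟩, by fun_prop⟩
  have hr : ∀ T, r (X.incl (τ.faceMap T .center)) = τ.faceMap T .center :=
    fun T => Subtype.ext (hbase T 1)
  refine ⟨ρ, r, fun x => rfl, fun P hP => h1 1 P (Or.inl hP), hr, ?_, ?_⟩
  · intro T T' q
    refine ⟨hr T, (hr T').symm, ?_⟩
    have h4 := map_eq_of_homotopy K (fun y => Subtype.ext (h0 _)) (r.comp X.incl) (fun y => rfl)
      (fun t => Subtype.ext (hbase T t)) (fun t => Subtype.ext (hbase T' t)) (hr T) (hr T') q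
    exact (map_map_hom r X.incl q).symm.trans h4
  · intro T T' q
    have h4 := map_eq_of_homotopy K' (fun y => Subtype.ext (h0 _)) (X.incl.comp r) (fun y => rfl)
      (fun t => Subtype.ext (hbase T t)) (fun t => Subtype.ext (hbase T' t))
      (congrArg X.incl (hr T)) (congrArg X.incl (hr T')) q
    refine ⟨ptHom (hr T).symm ≫ (FundamentalGroupoid.map r).map q ≫ ptHom (hr T'), ?_⟩
    have h5 : (FundamentalGroupoid.map X.incl).map ((FundamentalGroupoid.map r).map q) =
      ptHom (congrArg X.incl (hr T)) ≫ q ≫ ptHom (congrArg X.incl (hr T')).symm :=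
      (map_map_hom X.incl r q).symm.trans h4
    refine ((FundamentalGroupoid.map X.incl).map_comp _ _).trans ?_
    have h8 := (FundamentalGroupoid.map X.incl).map_comp ((FundamentalGroupoid.map r).map q)
      (ptHom (hr T'))
    rw [h5] at h8
    refine (congrArg₂ (fun a b => a ≫ b) (map_ptHom X.incl (hr T).symm) (h8.trans
      (congrArg _ (map_ptHom X.incl (hr T'))))).trans ?_
    have h9 : ptHom (congrArg X.incl (hr T).symm) ≫ (ptHom (congrArg X.incl (hr T)) ≫ q ≫
        ptHom (congrArg X.incl (hr T')).symm) ≫ ptHom (congrArg X.incl (hr T')) = q := by simp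
    exact h9

/-- The corners of the punctures. -/
def IsCorner (s : Fin τ.n × Fin 3) : Prop := ∃ P, τ.corner P = s

theorem corner_injective : Function.Injective τ.corner := by
  intro P Q h
  apply Subtype.ext
  rw [← τ.chi_corner P, h, τ.chi_corner Q]

variable {τ} in
theorem IsCorner.mate_eq {s : Fin τ.n × Fin 3} (h : τ.IsCorner s) : τ.mate s = (s.1, s.2 + 1) := by
  obtain ⟨P, rfl⟩ := h
  exact τ.mate_corner P

variable {τ} in
theorem IsCorner.not_mate {s : Fin τ.n × Fin 3} (h : τ.IsCorner s) : ¬ τ.IsCorner (τ.mate s) := by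
  intro h'
  have h1 := h'.mate_eq
  rw [τ.mate_mate, h.mate_eq] at h1
  have h2 : s.2 = s.2 + 1 + 1 := congrArg Prod.snd h1
  revert h2
  generalize s.2 = i
  revert i
  decide

open Classical in
/-- The word attached to a half-edge: it is empty when the half-edge leads to the second of the sides
which are glued around a puncture. -/
noncomputable def halfWord (s : Fin τ.n × Fin 3) : List (Fin τ.n × Fin 3) :=
  if τ.IsCorner (τ.mate s) then [] else [s]

/-- The word attached to an edge of the dual graph. -/
noncomputable def edgeWord (s : Fin τ.n × Fin 3) : List (Fin τ.n × Fin 3) :=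
  τ.halfWord (τ.mate s) ++ τ.halfWord s

theorem edgeWord_of_corner {s : Fin τ.n × Fin 3} (h : τ.IsCorner s) : τ.edgeWord s = [s] := by
  simp [edgeWord, halfWord, τ.mate_mate, h, h.not_mate]

theorem edgeWord_of_mate_corner {s : Fin τ.n × Fin 3} (h : τ.IsCorner (τ.mate s)) :
    τ.edgeWord s = [τ.mate s] := by
  have h1 := h.not_mate
  rw [τ.mate_mate] at h1
  simp [edgeWord, halfWord, τ.mate_mate, h, h1]

theorem edgeWord_of_not {s : Fin τ.n × Fin 3} (h : ¬ τ.IsCorner s) (h' : ¬ τ.IsCorner (τ.mate s)) :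
    τ.edgeWord s = [τ.mate s, s] := by
  simp [edgeWord, halfWord, τ.mate_mate, h, h']

/-- The barycentre of a triangle, in the orbifold groupoid. -/
noncomputable abbrev orbBase (T : Fin τ.n) : Orb X := X.toOrb.obj (τ.base T)

/-- The edges of the dual graph, in the orbifold groupoid. -/
inductive IsOrbEdge : Fin τ.n × Fin 3 → ∀ T T' : Fin τ.n, (τ.orbBase T ⟶ τ.orbBase T') → Prop
  | mk {T T' : Fin τ.n} {i j : Fin 3} (h : τ.mate (T, i) = (T', j)) (hne : τ.mate (T, i) ≠ (T, i)) :
      IsOrbEdge (T, i) T T' (X.toOrb.map (τ.edgeHom h))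

theorem corner_edge_sq [T2Space S] {T : Fin τ.n} {i : Fin 3} (h : τ.IsCorner (T, i))
    (hT : τ.mate (T, i) = (T, i + 1)) :
    X.toOrb.map (τ.edgeHom hT) ≫ X.toOrb.map (τ.edgeHom hT) = 𝟙 _ := by
  obtain ⟨P, hP⟩ := h
  apply IdealTriangulation.edgeHom_sq hT
  have := τ.chi_corner P
  rw [hP] at this
  rw [this]
  exact P.2

/-- An ordinary arc carries the two distinct letters of its sides, a folded arc one letter for both
directions. So equal letters at a junction mean that an arc is crossed back, or that a folded arc is
crossed twice in one direction, which is trivial by `corner_edge_sq`. -/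
theorem edgeLetters [T2Space S] : EdgeLetters τ.IsOrbEdge τ.edgeWord where
  ne_nil s := by
    by_cases h : τ.IsCorner s
    · simp [τ.edgeWord_of_corner h]
    by_cases h' : τ.IsCorner (τ.mate s)
    · simp [τ.edgeWord_of_mate_corner h']
    · simp [τ.edgeWord_of_not h h']
  length_le s := by
    by_cases h : τ.IsCorner s
    · simp [τ.edgeWord_of_corner h]
    by_cases h' : τ.IsCorner (τ.mate s)
    · simp [τ.edgeWord_of_mate_corner h']
    · simp [τ.edgeWord_of_not h h']
  fix s T T' f hs hf := by
    exfalso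
    apply hs
    by_cases h : τ.IsCorner s
    · simp [τ.edgeWord_of_corner h]
    by_cases h' : τ.IsCorner (τ.mate s)
    · simp [τ.edgeWord_of_mate_corner h']
    · cases hf with
      | mk h1 hne =>
        simpa [τ.edgeWord_of_not h h'] using hne
  cancel := by
    intro s t T T' T'' f g hf hg hlast
    -- An ordinary edge `s` has the word `mate s, s`, so a coincidence of letters forces `t` to be
    -- the mate of `s`; only the single letter of a folded arc also allows `t = s`.
    have key : t = τ.mate s ∨ (t = s ∧ (τ.IsCorner s ∨ τ.IsCorner (τ.mate s))) := by
      have ht : (τ.IsCorner (τ.mate t) ∧ (τ.edgeWord t).getLast? = some (τ.mate t)) ∨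
          (τ.edgeWord t).getLast? = some t := by
        by_cases h : τ.IsCorner t
        · simp [τ.edgeWord_of_corner h]
        by_cases h' : τ.IsCorner (τ.mate t)
        · simp [τ.edgeWord_of_mate_corner h', h']
        · simp [τ.edgeWord_of_not h h']
      by_cases hs : τ.IsCorner s
      · rw [τ.edgeWord_of_corner hs] at hlast
        rcases ht with ⟨-, ht⟩ | ht
        · left
          rw [← τ.mate_mate t]
          congr 1
          simpa using ht.symm.trans hlast
        · exact Or.inr ⟨by simpa using ht.symm.trans hlast, Or.inl hs⟩
      · have h1 : (τ.edgeWord s).head? = some (τ.mate s) := by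
          by_cases h' : τ.IsCorner (τ.mate s)
          · simp [τ.edgeWord_of_mate_corner h']
          · simp [τ.edgeWord_of_not hs h']
        rw [h1] at hlast
        rcases ht with ⟨h2, ht⟩ | ht
        · have h3 : τ.mate t = τ.mate s := by simpa using ht.symm.trans hlast
          refine Or.inr ⟨?_, Or.inr (h3 ▸ h2)⟩
          rw [← τ.mate_mate t, h3, τ.mate_mate]
        · exact Or.inl (by simpa using ht.symm.trans hlast)
    cases hf with | @mk T T' i j h _ =>
    cases hg with | @mk T' T'' i' j' h' _ =>
    rcases key with key | ⟨key, hc⟩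
    · rw [h] at key
      obtain rfl : i' = j := congrArg Prod.snd key
      have h1 : τ.mate (T', i') = (T, i) := by rw [← h, τ.mate_mate]
      rw [h1] at h'
      obtain ⟨rfl, rfl⟩ := Prod.mk.inj h'
      refine ⟨rfl, ?_⟩
      rw [← Functor.map_comp, τ.edgeHom_comp h h1]
      exact CategoryTheory.Functor.map_id _ _
    · obtain ⟨rfl, rfl⟩ := Prod.mk.inj key
      rw [h] at h'
      obtain ⟨rfl, rfl⟩ := Prod.mk.inj h'
      refine ⟨rfl, ?_⟩
      rcases hc with hc | hc
      · have h1 : j = i' + 1 := congrArg Prod.snd (h.symm.trans hc.mate_eq)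
        subst h1
        exact τ.corner_edge_sq hc h
      · have h1 : τ.mate (T', j) = (T', i') := by rw [← h, τ.mate_mate]
        rw [h] at hc
        have h2 : i' = j + 1 := congrArg Prod.snd (h1.symm.trans hc.mate_eq)
        subst h2
        have h3 := τ.corner_edge_sq hc h1
        have h4 : X.toOrb.map (τ.edgeHom h1) ≫ X.toOrb.map (τ.edgeHom h) = 𝟙 _ := by
          rw [← Functor.map_comp, τ.edgeHom_comp h1 h]
          exact CategoryTheory.Functor.map_id _ _
        have h5 : X.toOrb.map (τ.edgeHom h) = X.toOrb.map (τ.edgeHom h1) := by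
          rw [← cancel_epi (X.toOrb.map (τ.edgeHom h1)), h3, h4]
        rw [h5, h3]
        rfl

end FoldedTriangulation

end OrbSurface

namespace OrbSurface

variable {S : Type*} [TopologicalSpace S] [ChartedSpace (EuclideanHalfSpace 2) S]
  {X : MarkedSurface S}

/-! ### The representation of the orbifold groupoid in the Coxeter group -/

namespace FoldedTriangulation

variable (τ : FoldedTriangulation X)

theorem realizes_orb_of_realizes {T T' : Fin τ.n} {f : τ.base T ⟶ τ.base T'}
    {l : List (Fin τ.n × Fin 3)} (h : Realizes τ.IsEdge f l) :
    Realizes τ.IsOrbEdge (X.toOrb.map f) l := by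
  induction h with
  | nil =>
    rw [X.toOrb.map_id]
    exact .nil _
  | cons s _ hf ih =>
    rw [X.toOrb.map_comp]
    refine .cons s ih ?_
    cases hf with
    | mk h hne => exact .mk h hne

/-- Thanks to the push, every orbifold morphism between barycentres is represented by a path which
avoids the marked points, and such a path is a composite of edges. -/
theorem exists_realizes [T2Space S] {T T' : Fin τ.n} (f : τ.orbBase T ⟶ τ.orbBase T') :
    ∃ l, Realizes τ.IsOrbEdge f l := by
  obtain ⟨-, -, -, -, -, -, h⟩ := τ.exists_retraction
  obtain ⟨q, rfl⟩ := (Quotient.functor (punctureHomRel X)).map_surjective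
    (X := FundamentalGroupoid.mk (X.incl (τ.faceMap T .center)))
    (Y := FundamentalGroupoid.mk (X.incl (τ.faceMap T' .center))) f
  obtain ⟨q', rfl⟩ := h q
  obtain ⟨l, hl⟩ := τ.realizes_of_hom q'
  exact ⟨l, τ.realizes_orb_of_realizes hl⟩

/-- The points of the self-folded triangle which are close to the puncture. -/
def cornerNhd (P : X.punctures) : Set S :=
  τ.chi (τ.corner P).1 '' {p | 1 / 2 < p ((τ.corner P).2 + 1)}

theorem isOpen_cornerNhd [T2Space S] (P : X.punctures) : IsOpen (τ.cornerNhd P) := by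
  refine τ.isOpen_of_preimage fun T => ?_
  by_cases hT : T = (τ.corner P).1
  · subst hT
    have : τ.chi (τ.corner P).1 ⁻¹' τ.cornerNhd P = {p | 1 / 2 < p ((τ.corner P).2 + 1)} := by
      ext p
      constructor
      · rintro ⟨q, hq, h⟩
        have h0 : 0 < q ((τ.corner P).2 + 1) := lt_trans (by norm_num) hq
        have h1 := (IdealTriangulation.fold_of_chi_eq (τ.mate_corner P) h0 h).2.1
        change 1 / 2 < p ((τ.corner P).2 + 1)
        rw [h1]
        exact hq
      · exact fun hp => ⟨p, hp, rfl⟩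
    rw [this]
    exact isOpen_lt continuous_const (triangle_continuous _)
  · convert isOpen_empty
    rw [Set.eq_empty_iff_forall_notMem]
    rintro p ⟨q, hq, h⟩
    have h0 : 0 < q ((τ.corner P).2 + 1) := lt_trans (by norm_num) hq
    exact hT (IdealTriangulation.fold_of_chi_eq (τ.mate_corner P) h0 h).1

theorem mem_cornerNhd (P : X.punctures) : (P : S) ∈ τ.cornerNhd P :=
  ⟨_, by norm_num, τ.chi_corner P⟩

/-- Near the puncture the opposite coordinate exceeds one half, which rules out the sector of the
third side. The two folded sides carry a single letter and the empty word, so nearby loops only see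
that letter. -/
theorem wordProd_halfWord_mem {P : X.punctures} {x : S} (hx : x ∈ τ.cornerNhd P)
    {s : Fin τ.n × Fin 3} (hs : x ∈ τ.openSector s) :
    wordProd (τ.halfWord s) ∈ Subgroup.zpowers (letter (τ.corner P)) := by
  obtain ⟨q, hq, rfl⟩ := hx
  obtain ⟨p, ⟨hp, -⟩, h⟩ := hs
  have h0 : 0 < q ((τ.corner P).2 + 1) := lt_trans (by norm_num) hq
  obtain ⟨h1, h2, -⟩ := IdealTriangulation.fold_of_chi_eq (τ.mate_corner P) h0 h.symm
  have hc : τ.IsCorner (τ.corner P) := ⟨P, rfl⟩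
  have h3 := triangle_sum p (τ.corner P).2
  have h4 := triangle_nonneg p (τ.corner P).2
  have h5 : 1 / 2 < p ((τ.corner P).2 + 1) := by
    rw [h2]
    exact hq
  rcases fin_three_cases (τ.corner P).2 s.2 with h6 | h6 | h6
  · have : s = τ.corner P := Prod.ext h1 h6
    rw [this, halfWord, if_neg hc.not_mate]
    simp
  · have h8 : s = ((τ.corner P).1, (τ.corner P).2 + 1) := Prod.ext h1 h6
    have : s = τ.mate (τ.corner P) := h8.trans (τ.mate_corner P).symm
    rw [this, halfWord, τ.mate_mate, if_pos hc]
    exact one_mem _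
  · have h7 := hp.1
    rw [h6, (fin_three_add _).2.2.2] at h7
    linarith

theorem inv_wordProd_halfWord (s : Fin τ.n × Fin 3) :
    (wordProd (τ.halfWord s))⁻¹ = wordProd (τ.halfWord s) := by
  rw [halfWord]
  split_ifs
  · simp
  · simp [letter_inv]

/-- The representation of the orbifold groupoid in a universal Coxeter group. -/
theorem exists_representation [T2Space S] :
    ∃ Θ : Rep (Orb X) (Equiv.Perm (ReducedWord (Fin τ.n × Fin 3))),
      ∀ (s : Fin τ.n × Fin 3) (T T' : Fin τ.n) (f : τ.orbBase T ⟶ τ.orbBase T'),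
        τ.IsOrbEdge s T T' f → Θ.toFun f = wordProd (τ.edgeWord s) := by
  obtain ⟨θ, t1, t2, t3, t4⟩ := τ.exists_side_monodromy fun s => wordProd (τ.halfWord s)
  let Θ : Rep (FundamentalGroupoid X.Unmarked) (Equiv.Perm (ReducedWord (Fin τ.n × Fin 3))) :=
    { toFun := fun {x y} f => θ (x := x.as) (y := y.as) f
      map_id := fun x => t1 x.as
      map_comp := fun f g => t2 f g }
  obtain ⟨ρ, r, hr, hρ, -, hret, -⟩ := τ.exists_retraction
  -- Paths near the puncture act through the group generated by one letter, in which every element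
  -- squares to one; `disc_loop_sq` extends this to the loops of all discs.
  obtain ⟨F, hF⟩ := exists_orb_rep (Θ.comap (FundamentalGroupoid.map r)) fun D => by
    refine disc_loop_sq Θ r ρ hr D (τ.isOpen_cornerNhd ⟨_, D.center_mem⟩) ?_ ?_
    · rw [hρ _ D.center_mem]
      exact τ.mem_cornerNhd ⟨_, D.center_mem⟩
    · intro x y γ hγ
      have h : Θ.toFun (FundamentalGroupoid.fromPath (.mk γ)) ∈
          Subgroup.zpowers (letter (τ.corner ⟨_, D.center_mem⟩)) :=
        t4 _ {x | x.1 ∈ τ.cornerNhd ⟨_, D.center_mem⟩}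
          (fun x hx s hs => τ.wordProd_halfWord_mem hx hs) γ hγ
      obtain ⟨k, hk⟩ := h
      rw [← hk]
      change letter _ ^ k * letter _ ^ k = 1
      rw [← (Commute.refl _).mul_zpow, letter_mul_self, one_zpow]
  refine ⟨F, ?_⟩
  intro s T T' f hf
  cases hf with | @mk T T' i j h hne => ?_
  have hne' : τ.mate (T', j) ≠ (T', j) := by
    intro h'
    rw [← h, τ.mate_mate, h] at h'
    exact hne (h.trans h'.symm)
  have hhalf : ∀ (T : Fin τ.n) (i : Fin 3), τ.mate (T, i) ≠ (T, i) →
      Θ.toFun (scHom (τ.faceMap T) .center (.mid i)) = wordProd (τ.halfWord (T, i)) := by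
    intro T i hne
    let δ : Path Face.center (Face.mid i) :=
      ⟨⟨fun t => ⟨spoke i t, spoke_ne_one i t⟩, (continuous_spoke i).subtype_mk _⟩,
        Subtype.ext (spoke_zero i), rfl⟩
    rw [← scHom_eq _ (.mk δ), ← Path.Homotopic.Quotient.mk_map]
    exact t3 (T, i) hne _ fun t => rfl
  have hhalf' : Θ.toFun (scHom (τ.faceMap T') (.mid j) .center) =
      wordProd (τ.halfWord (T', j)) := by
    rw [← τ.inv_wordProd_halfWord, ← hhalf T' j hne', eq_inv_iff_mul_eq_one, ← Θ.map_comp,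
      scHom_comp, scHom_self, Θ.map_id]
  obtain ⟨h1, h2, h3⟩ := hret (τ.edgeHom h)
  have h4 : F.toFun (X.toOrb.map (τ.edgeHom h)) = Θ.toFun (τ.edgeHom h) := by
    refine (hF _).trans ?_
    change Θ.toFun ((FundamentalGroupoid.map r).map
      ((FundamentalGroupoid.map X.incl).map (τ.edgeHom h))) = _
    have h5 : Θ.toFun (ptHom h1 ≫ τ.edgeHom h ≫ ptHom h2) = Θ.toFun (τ.edgeHom h) := by
      rw [Θ.map_comp, Θ.map_comp, Θ.map_eqToHom, Θ.map_eqToHom, one_mul, mul_one]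
    exact (congrArg Θ.toFun h3).trans h5
  -- An edge is a half-edge followed by the inverse of another one. The image of a half-edge is its
  -- own inverse, whence the concatenation `edgeWord`.
  rw [h4, IdealTriangulation.edgeHom, Θ.map_comp, Θ.map_comp, Θ.map_eqToHom, mul_one, hhalf T i hne,
    hhalf', edgeWord, h, wordProd_append]

end FoldedTriangulation

end OrbSurface

/-! ### Barycentres as base points and connectedness of the groupoid -/

namespace OrbSurface

theorem cancel_middle {C : Type*} [Category* C] {x y z z' : C} {a : x ⟶ y} {a' : y ⟶ x}
    (h : a' ≫ a = 𝟙 y) (f : y ⟶ z) (g : z ⟶ z') (k : z' ⟶ y) :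
    ((a ≫ f ≫ 𝟙 z) ≫ g ≫ k ≫ a') ≫ a = a ≫ f ≫ g ≫ k := by
  simp [h]

variable {S : Type*} [TopologicalSpace S] [ChartedSpace (EuclideanHalfSpace 2) S]
  {X : MarkedSurface S}

namespace FoldedTriangulation

variable (τ : FoldedTriangulation X)

/-- The point `P'` is the barycentre of the self-folded triangle. -/
theorem nearPt_eq (P : X.punctures) :
    τ.nearPt P = X.incl (τ.faceMap (τ.corner P).1 .center) := by
  apply Subtype.ext
  change τ.chi _ (spoke _ 0) = τ.chi _ Face.center.1
  rw [spoke_zero]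

/-- The path from the barycentre to the midpoint of a side. -/
noncomputable def facePath (i : Fin 3) : Path Face.center (Face.mid i) :=
  ⟨⟨fun t => ⟨spoke i t, spoke_ne_one i t⟩, (continuous_spoke i).subtype_mk _⟩,
    Subtype.ext (spoke_zero i), rfl⟩

theorem nearLoop_eq (P : X.punctures) :
    FundamentalGroupoid.fromPath (.mk (τ.nearLoop P)) ≫ ptHom (τ.nearPt_eq P) =
      ptHom (τ.nearPt_eq P) ≫ (FundamentalGroupoid.map X.incl).map (τ.edgeHom (τ.mate_corner P)) := by
  have hm := congrArg X.incl (τ.faceMap_mid (τ.mate_corner P))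
  have h0 : (FundamentalGroupoid.map X.incl).map (τ.edgeHom (τ.mate_corner P)) =
      scHom (X.incl.comp (τ.faceMap (τ.corner P).1)) .center (.mid (τ.corner P).2) ≫
        ptHom hm ≫
        scHom (X.incl.comp (τ.faceMap (τ.corner P).1)) (.mid ((τ.corner P).2 + 1)) .center := by
    rw [← map_scHom, ← map_scHom, ← map_ptHom X.incl (τ.faceMap_mid (τ.mate_corner P))]
    exact (Functor.map_comp _ _ _).trans (congrArg _ (Functor.map_comp _ _ _))
  have h1 := mk_eq_scHom (X.incl.comp (τ.faceMap (τ.corner P).1))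
    (τ.halfEdgePath (τ.corner P).1 (τ.corner P).2) (facePath (τ.corner P).2) (fun t => rfl)
    (τ.nearPt_eq P) rfl
  have h2 := mk_eq_scHom (X.incl.comp (τ.faceMap (τ.corner P).1))
    ((τ.halfEdgePath (τ.corner P).1 ((τ.corner P).2 + 1)).symm.cast
      (τ.halfEdge_one (τ.mate_corner P)) (τ.halfEdge_zero _ _ _))
    (facePath ((τ.corner P).2 + 1)).symm (fun t => rfl) hm (τ.nearPt_eq P).symm
  have h3 : FundamentalGroupoid.fromPath (.mk (τ.nearLoop P)) =
      FundamentalGroupoid.fromPath (.mk (τ.halfEdgePath (τ.corner P).1 (τ.corner P).2)) ≫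
      FundamentalGroupoid.fromPath (.mk
        ((τ.halfEdgePath (τ.corner P).1 ((τ.corner P).2 + 1)).symm.cast
          (τ.halfEdge_one (τ.mate_corner P)) (τ.halfEdge_zero _ _ _))) := rfl
  rw [h3, h1, h2]
  refine Eq.trans ?_ (congrArg (fun z => ptHom (τ.nearPt_eq P) ≫ z) h0.symm)
  have h4 : ptHom (τ.nearPt_eq P).symm ≫ ptHom (τ.nearPt_eq P) = 𝟙 _ := by simp
  exact cancel_middle h4 _ _ _

/-- The identification of `P'` with a barycentre. -/
noncomputable def ptIso (P : X.punctures) : τ.pt P ⟶ τ.orbBase (τ.corner P).1 :=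
  (Quotient.functor (punctureHomRel X)).map (ptHom (τ.nearPt_eq P))

theorem e_comp_ptIso (P : X.punctures) :
    End.asHom (τ.e P) ≫ τ.ptIso P =
      τ.ptIso P ≫ X.toOrb.map (τ.edgeHom (τ.mate_corner P)) := by
  have h := congrArg (Quotient.functor (punctureHomRel X)).map (τ.nearLoop_eq P)
  exact (Functor.map_comp _ _ _).symm.trans (h.trans (Functor.map_comp _ _ _))

/-- The segment from the barycentre to `p` meets no vertex except possibly at its end, which is not
a puncture. -/
theorem nonempty_hom_orbBase (T : Fin τ.n) (p : Triangle) (x : X.Punctured)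
    (hx : τ.chi T p = x.1) : Nonempty (τ.orbBase T ⟶ orbPt X x) := by
  let σ : unitInterval → Triangle := fun t => trianglePt 0
    ((1 - (t : ℝ)) / 3 + t * p 0) ((1 - (t : ℝ)) / 3 + t * p 1) ((1 - (t : ℝ)) / 3 + t * p 2)
    (add_nonneg (div_nonneg (sub_nonneg.2 t.2.2) (by norm_num))
      (mul_nonneg t.2.1 (triangle_nonneg _ _)))
    (add_nonneg (div_nonneg (sub_nonneg.2 t.2.2) (by norm_num))
      (mul_nonneg t.2.1 (triangle_nonneg _ _)))
    (add_nonneg (div_nonneg (sub_nonneg.2 t.2.2) (by norm_num))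
      (mul_nonneg t.2.1 (triangle_nonneg _ _)))
    (by
      have h : p 0 + p 1 + p 2 = 1 := triangle_sum p 0
      linear_combination (t : ℝ) * h)
  have hcont : Continuous σ :=
    continuous_trianglePt _ (by fun_prop) (by fun_prop) (by fun_prop) _ _ _ _
  have happ : ∀ t k, σ t k = (1 - (t : ℝ)) / 3 + t * p k := by
    intro t k
    fin_cases k
    · exact trianglePt_zero
    · exact trianglePt_one (i := 0)
    · exact trianglePt_two (i := 0)
  have h0 : σ 0 = Face.center.1 := by
    refine triangle_ext 0 ?_ ?_ ?_ <;> rw [happ, Face.center_apply] <;> simp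
  have h1 : σ 1 = p := by
    refine triangle_ext 0 ?_ ?_ ?_ <;> rw [happ] <;> simp
  have hmem : ∀ t, τ.chi T (σ t) ∉ X.punctures := by
    intro t
    rcases eq_or_ne t 1 with rfl | ht
    · rw [h1, hx]
      exact x.2
    · refine τ.notMem_punctures T _ fun k hk => ?_
      rw [happ] at hk
      have h2 : (t : ℝ) < 1 := lt_of_le_of_ne t.2.2 fun h => ht (Subtype.ext h)
      have h3 := t.2.1
      have h4 := triangle_sum p k
      have h5 := triangle_nonneg p (k + 1)
      have h6 := triangle_nonneg p (k + 2)
      nlinarith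
  let γ : Path (X.incl (τ.faceMap T .center)) x :=
    ⟨⟨fun t => ⟨τ.chi T (σ t), hmem t⟩,
      ((τ.chi T).continuous.comp hcont).subtype_mk _⟩,
      Subtype.ext (congrArg (τ.chi T) h0), Subtype.ext ((congrArg (τ.chi T) h1).trans hx)⟩
  exact ⟨orbPath X γ⟩

/-- A puncture is a vertex of its folded triangle only, so the two triangles coincide there; at any
other point both barycentres are joined to the common point. -/
theorem nonempty_hom_of_chi_eq [T2Space S] {T T' : Fin τ.n} {p p' : Triangle}
    (h : τ.chi T p = τ.chi T' p') : Nonempty (τ.orbBase T ⟶ τ.orbBase T') := by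
  by_cases hP : τ.chi T p ∈ X.punctures
  · have h0 : (0 : ℝ) < stdSimplex.vertex (S := ℝ) ((τ.corner ⟨_, hP⟩).2 + 1)
        ((τ.corner ⟨_, hP⟩).2 + 1) := by simp
    have h1 := τ.chi_corner ⟨_, hP⟩
    obtain rfl : T = T' :=
      (IdealTriangulation.fold_of_chi_eq (τ.mate_corner ⟨_, hP⟩) h0 h1).1.trans
        (IdealTriangulation.fold_of_chi_eq (τ.mate_corner ⟨_, hP⟩) h0 (h1.trans h)).1.symm
    exact ⟨𝟙 _⟩
  · obtain ⟨f⟩ := τ.nonempty_hom_orbBase T p ⟨_, hP⟩ rfl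
    obtain ⟨g⟩ := τ.nonempty_hom_orbBase T' p' ⟨_, hP⟩ h.symm
    exact ⟨f ≫ Groupoid.inv g⟩

/-- The triangles with reachable barycentre and the other triangles cover two complementary closed
subsets of the connected surface. -/
theorem nonempty_hom [T2Space S] [ConnectedSpace S] (T T' : Fin τ.n) :
    Nonempty (τ.orbBase T ⟶ τ.orbBase T') := by
  have hclosed : ∀ A : Set (Fin τ.n), IsClosed (⋃ T ∈ A, Set.range (τ.chi T)) := fun A =>
    A.toFinite.isClosed_biUnion fun T _ => (isCompact_range (τ.chi T).continuous).isClosed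
  let A : Set (Fin τ.n) := {T' | Nonempty (τ.orbBase T ⟶ τ.orbBase T')}
  have hcompl : (⋃ T ∈ A, Set.range (τ.chi T))ᶜ = ⋃ T ∈ Aᶜ, Set.range (τ.chi T) := by
    ext x
    obtain ⟨T₁, p, rfl⟩ := τ.chi_surjective x
    simp only [Set.mem_compl_iff, Set.mem_iUnion, not_exists, exists_prop]
    constructor
    · exact fun h => ⟨T₁, fun hA => h T₁ ⟨hA, p, rfl⟩, p, rfl⟩
    · rintro ⟨T₂, h2, q, hq⟩ T₃ ⟨⟨f⟩, q', hq'⟩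
      obtain ⟨g⟩ := τ.nonempty_hom_of_chi_eq (hq'.trans hq.symm)
      exact h2 ⟨f ≫ g⟩
  have hclopen : IsClopen (⋃ T ∈ A, Set.range (τ.chi T)) :=
    ⟨hclosed A, by
      rw [← isClosed_compl_iff, hcompl]
      exact hclosed _⟩
  have hT : τ.chi T Face.center.1 ∈ ⋃ T ∈ A, Set.range (τ.chi T) := by
    simp only [Set.mem_iUnion]
    exact ⟨T, ⟨𝟙 _⟩, _, rfl⟩
  have huniv := hclopen.eq_univ ⟨_, hT⟩
  have h := huniv.ge (Set.mem_univ (τ.chi T' Face.center.1))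
  simp only [Set.mem_iUnion] at h
  obtain ⟨T₁, ⟨f⟩, q, hq⟩ := h
  obtain ⟨g⟩ := τ.nonempty_hom_of_chi_eq hq
  exact ⟨f ≫ g⟩

include τ in
theorem nonempty_orbPt_hom [T2Space S] [ConnectedSpace S] (x y : X.Punctured) :
    Nonempty (orbPt X x ⟶ orbPt X y) := by
  obtain ⟨T, p, hp⟩ := τ.chi_surjective x.1
  obtain ⟨T', p', hp'⟩ := τ.chi_surjective y.1
  obtain ⟨f⟩ := τ.nonempty_hom_orbBase T p x hp
  obtain ⟨g⟩ := τ.nonempty_hom_orbBase T' p' y hp'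
  obtain ⟨h⟩ := τ.nonempty_hom T T'
  exact ⟨Groupoid.inv f ≫ h ≫ g⟩

end FoldedTriangulation

end OrbSurface

namespace OrbSurface

/-! ### Free conjugacy and the reflection system of the orbifold group -/

section Conjugation

variable {𝒢 : Type*} [Groupoid 𝒢] {x y z : 𝒢}

/-- The conjugation by a morphism. -/
def conjEnd (f : x ⟶ y) : End x ≃* End y where
  toFun g := Groupoid.inv f ≫ End.asHom g ≫ f
  invFun g := f ≫ End.asHom g ≫ Groupoid.inv f
  left_inv g := by simp [End.asHom]
  right_inv g := by simp [End.asHom]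
  map_mul' g h := by simp [End.asHom, End.mul_def]

theorem conjEnd_apply (f : x ⟶ y) (g : End x) :
    conjEnd f g = Groupoid.inv f ≫ End.asHom g ≫ f := rfl

theorem freeClass_eq_iff {α : End x} {β : End y} :
    freeClass α = freeClass β ↔ ∃ f : x ⟶ y, End.asHom α ≫ f = f ≫ End.asHom β :=
  Quotient.eq (r := freeSetoid 𝒢)

theorem freeClass_eq_iff_conj {α β : End x} :
    freeClass α = freeClass β ↔ ∃ h : End x, α = h * β * h⁻¹ := by
  rw [freeClass_eq_iff]
  constructor
  · rintro ⟨f, hf⟩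
    -- Products in `End` read from right to left: `h * β * h⁻¹` is `h⁻¹ ≫ β ≫ h`.
    refine ⟨Groupoid.inv f, ?_⟩
    change α = Groupoid.inv (Groupoid.inv f) ≫ End.asHom β ≫ Groupoid.inv f
    rw [← cancel_mono f]
    simpa [End.asHom] using hf
  · rintro ⟨h, rfl⟩
    refine ⟨Groupoid.inv h, ?_⟩
    change (Groupoid.inv h ≫ β ≫ h) ≫ Groupoid.inv h = Groupoid.inv h ≫ β
    simp

theorem freeClass_conjEnd (f : x ⟶ y) (g : End x) : freeClass (conjEnd f g) = freeClass g :=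
  freeClass_eq_iff.2 ⟨Groupoid.inv f, by simp [conjEnd_apply, End.asHom]⟩

theorem isPrimitive_of_freeClass_eq {α β : End x}
    (h : freeClass α = freeClass β) (hα : IsPrimitive α) : IsPrimitive β := by
  obtain ⟨k, hk⟩ := freeClass_eq_iff_conj.1 h.symm
  exact hα.conj hk

end Conjugation

namespace IsReflectionSystem

variable {P G : Type*} [Group G] {s : P → G} (hs : IsReflectionSystem s)
include hs

theorem mul_mem_of_mem {p : P} {x y : G} (hx : x = 1 ∨ x = s p) (hy : y = 1 ∨ y = s p) :
    x * y = 1 ∨ x * y = s p := by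
  rcases hy with rfl | rfl
  · simpa using hx
  · exact hs.mul_mem hx

omit hs in
theorem link_conj_of_tag_eq {a b : P × P × G} {x y x' y' : G} (hx : x = 1 ∨ x = s a.1)
    (hy : y = 1 ∨ y = s a.2.1) (hx' : x' = 1 ∨ x' = s b.1) (hy' : y' = 1 ∨ y' = s b.2.1)
    (h1 : a.1 = b.1) (h2 : a.2.1 = b.2.1) (h : x * a.2.2 * y = x' * b.2.2 * y') :
    ∃ h, reflLink s a = h * reflLink s b * h⁻¹ := by
  obtain ⟨p, q, v⟩ := a
  obtain ⟨p', q', v'⟩ := b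
  obtain rfl : p = p' := h1
  obtain rfl : q = q' := h2
  obtain ⟨k, hk⟩ := link_conj (v := v) hx hy
  obtain ⟨k', hk'⟩ := link_conj (v := v') hx' hy'
  have h' : x * v * y = x' * v' * y' := h
  rw [h', hk'] at hk
  refine ⟨k⁻¹ * k', ?_⟩
  rw [mul_inv_rev, inv_inv]
  calc _ = k⁻¹ * (k * reflLink s (p, q, v) * k⁻¹) * k := by group
    _ = _ := by
      rw [← hk]
      group

/-- The inverse path belongs to the triple with swapped ends, whose link is conjugate to that of `b`
by `link_swap`; this reduces to equal directions. -/
theorem link_conj_of_tag_eq_inv {a b : P × P × G} {x y x' y' : G} (hx : x = 1 ∨ x = s a.1)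
    (hy : y = 1 ∨ y = s a.2.1) (hx' : x' = 1 ∨ x' = s b.1) (hy' : y' = 1 ∨ y' = s b.2.1)
    (h1 : a.1 = b.2.1) (h2 : a.2.1 = b.1) (h : x * a.2.2 * y = (x' * b.2.2 * y')⁻¹) :
    ∃ h, reflLink s a = h * reflLink s b * h⁻¹ := by
  obtain ⟨p', q', v'⟩ := b
  obtain ⟨k, hk⟩ := hs.link_swap (v := v') (x := 1) (y := 1) (p := p') (q := q') (.inl rfl)
    (.inl rfl)
  obtain ⟨k', hk'⟩ := link_conj_of_tag_eq (b := (q', p', 1 * v'⁻¹ * 1)) hx hy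
    (hs.inv_mem hy') (hs.inv_mem hx') h1 h2 (h.trans (by group))
  refine ⟨k' * k, ?_⟩
  rw [hk', hk]
  group

omit hs in
theorem pow_val_mem (p : P) (ε : ZMod 2) : s p ^ ε.val = 1 ∨ s p ^ ε.val = s p := by
  fin_cases ε
  · exact .inl (pow_zero _)
  · exact .inr (pow_one _)

theorem pow_val_injective (p : P) : Function.Injective fun ε : ZMod 2 => s p ^ ε.val := by
  have h := hs.ne_one p
  intro ε ε' h'
  have h0 : s p ^ (0 : ZMod 2).val = 1 := pow_zero _
  have h1 : s p ^ (1 : ZMod 2).val = s p := pow_one _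
  have key : ∀ ε : ZMod 2, ε = 0 ∨ ε = 1 := by decide
  rcases key ε with rfl | rfl <;> rcases key ε' with rfl | rfl <;>
    simp only [h0, h1] at h' <;> first | rfl | exact absurd h' h | exact absurd h'.symm h

end IsReflectionSystem

variable {S : Type*} [TopologicalSpace S] [ChartedSpace (EuclideanHalfSpace 2) S]
  {X : MarkedSurface S}

namespace FoldedTriangulation

variable (τ : FoldedTriangulation X)

theorem exists_comp_edge {P : X.punctures} {T : Fin τ.n} {i : Fin 3} (hP : τ.corner P = (T, i))
    (h : τ.mate (T, i) = (T, i + 1)) :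
    ∃ κ : τ.pt P ⟶ τ.orbBase T, End.asHom (τ.e P) ≫ κ = κ ≫ X.toOrb.map (τ.edgeHom h) := by
  obtain rfl : (τ.corner P).1 = T := congrArg Prod.fst hP
  obtain rfl : (τ.corner P).2 = i := congrArg Prod.snd hP
  exact ⟨τ.ptIso P, τ.e_comp_ptIso P⟩

variable [T2Space S]

/-- An involution is conjugate to an edge with a single letter. Such an edge is folded, and it is
conjugate to some `e P` in whichever direction it is crossed, being its own inverse. -/
theorem exists_comp_of_involution {T : Fin τ.n} {g : τ.orbBase T ⟶ τ.orbBase T}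
    (h1 : g ≫ g = 𝟙 _) (hne : g ≠ 𝟙 _) :
    ∃ (P : X.punctures) (k : τ.orbBase T ⟶ τ.pt P), g ≫ k = k ≫ End.asHom (τ.e P) := by
  obtain ⟨l, hl⟩ := τ.exists_realizes g
  obtain ⟨Θ, hΘ⟩ := τ.exists_representation
  obtain ⟨T₁, s, f, k, hE, hlen, hk⟩ := τ.edgeLetters.exists_edge_of_involution Θ.toFun Θ.map_id
    Θ.map_comp hΘ hl h1 hne
  suffices h : ∃ (P : X.punctures) (κ : τ.pt P ⟶ τ.orbBase T₁),
      End.asHom (τ.e P) ≫ κ = κ ≫ f by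
    obtain ⟨P, κ, hκ⟩ := h
    refine ⟨P, k ≫ Groupoid.inv κ, ?_⟩
    rw [← cancel_mono κ]
    simp only [Category.assoc, hκ, Groupoid.inv_comp, Category.comp_id]
    rw [hk, ← Category.assoc (Groupoid.inv κ), Groupoid.inv_comp, Category.id_comp]
  cases hE with | @mk _ _ i j h hne => ?_
  by_cases hc : τ.IsCorner (T₁, i)
  · obtain rfl : j = i + 1 := congrArg Prod.snd (h.symm.trans hc.mate_eq)
    obtain ⟨P, hP⟩ := hc
    exact ⟨P, τ.exists_comp_edge hP h⟩
  by_cases hc' : τ.IsCorner (T₁, j)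
  · have h2 : τ.mate (T₁, j) = (T₁, i) := by rw [← h, τ.mate_mate]
    obtain rfl : i = j + 1 := congrArg Prod.snd (h2.symm.trans hc'.mate_eq)
    have h3 := τ.corner_edge_sq hc' h2
    have h4 : X.toOrb.map (τ.edgeHom h2) ≫ X.toOrb.map (τ.edgeHom h) = 𝟙 _ := by
      rw [← Functor.map_comp, τ.edgeHom_comp h2 h]
      exact CategoryTheory.Functor.map_id _ _
    have h5 : X.toOrb.map (τ.edgeHom h) = X.toOrb.map (τ.edgeHom h2) := by
      rw [← cancel_epi (X.toOrb.map (τ.edgeHom h2)), h3, h4]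
    obtain ⟨P, hP⟩ := hc'
    rw [h5]
    exact ⟨P, τ.exists_comp_edge hP h2⟩
  · rw [τ.edgeWord_of_not hc (by rwa [h])] at hlen
    simp at hlen

variable {x₀ : X.Punctured} (w : ∀ P : X.punctures, τ.pt P ⟶ orbPt X x₀)

/-- Conjugation to a barycentre identifies the group at `x₀` with a group of edge loops, on which
the representation is injective. The `s P` go to conjugates of the letters `corner P`, which are
distinct. -/
theorem isReflectionSystem : IsReflectionSystem (τ.s w) := by
  obtain ⟨Θ, hΘ⟩ := τ.exists_representation
  obtain ⟨T, p, hp⟩ := τ.chi_surjective x₀.1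
  obtain ⟨u⟩ := τ.nonempty_hom_orbBase T p x₀ hp
  have hword : ∀ {T T' : Fin τ.n} (f : τ.orbBase T ⟶ τ.orbBase T'),
      ∃ l, Θ.toFun f = wordProd l := by
    intro T T' f
    obtain ⟨l, hl⟩ := τ.exists_realizes f
    exact ⟨_, hl.theta_eq Θ.toFun Θ.map_id Θ.map_comp hΘ⟩
  let c : OrbGroup X x₀ ≃* End (τ.orbBase T) := conjEnd (Groupoid.inv u)
  have hc : ∀ g, c g = u ≫ End.asHom g ≫ Groupoid.inv u := fun g => by
    change Groupoid.inv (Groupoid.inv u) ≫ End.asHom g ≫ Groupoid.inv u = _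
    simp
  let θ : OrbGroup X x₀ →* Equiv.Perm (ReducedWord (Fin τ.n × Fin 3)) :=
    MonoidHom.mk' (fun g => Θ.toFun (c g)) fun g h => by
      rw [map_mul]
      exact Θ.map_comp _ _
  refine isReflectionSystem_of_injective θ ?_ (fun g => hword _) τ.corner τ.corner_injective ?_ ?_
  · rw [injective_iff_map_eq_one]
    intro g hg
    obtain ⟨l, hl⟩ := τ.exists_realizes (c g)
    exact (map_eq_one_iff c c.injective).1
      (τ.edgeLetters.eq_of_theta Θ.toFun Θ.map_id Θ.map_comp hΘ hl hg)
  · intro P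
    have hP : τ.IsCorner (τ.corner P) := ⟨P, rfl⟩
    have h1 : Θ.toFun (X.toOrb.map (τ.edgeHom (τ.mate_corner P))) = letter (τ.corner P) := by
      rw [hΘ (τ.corner P) _ _ _ (.mk _ (fun h => hP.not_mate ((congrArg τ.IsCorner h).mpr hP))),
        τ.edgeWord_of_corner hP]
      simp
    obtain ⟨l, hl⟩ := hword (Groupoid.inv (τ.ptIso P) ≫ w P ≫ Groupoid.inv u)
    refine ⟨l, ?_⟩
    have h2 : u ≫ End.asHom (τ.s w P) ≫ Groupoid.inv u =
        Groupoid.inv (Groupoid.inv (τ.ptIso P) ≫ w P ≫ Groupoid.inv u) ≫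
          X.toOrb.map (τ.edgeHom (τ.mate_corner P)) ≫
            Groupoid.inv (τ.ptIso P) ≫ w P ≫ Groupoid.inv u := by
      have h3 : X.toOrb.map (τ.edgeHom (τ.mate_corner P)) =
          Groupoid.inv (τ.ptIso P) ≫ End.asHom (τ.e P) ≫ τ.ptIso P := by
        rw [τ.e_comp_ptIso]
        simp
      rw [h3]
      simp [FoldedTriangulation.s, End.asHom]
    have h4 : Θ.toFun (Groupoid.inv (Groupoid.inv (τ.ptIso P) ≫ w P ≫ Groupoid.inv u)) =
        (wordProd l)⁻¹ := by
      rw [← hl, eq_inv_iff_mul_eq_one, ← Θ.map_comp, Groupoid.comp_inv, Θ.map_id]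
    change Θ.toFun (c (τ.s w P)) = _
    rw [hc, h2, Θ.map_comp, Θ.map_comp, h1, h4, hl]
  · intro g hg hne
    have hg' : c g * c g = 1 := by rw [← map_mul, hg, map_one]
    obtain ⟨P, k, hk⟩ := τ.exists_comp_of_involution (g := c g) hg'
      fun h => hne ((map_eq_one_iff c c.injective).1 h)
    refine ⟨P, (Groupoid.inv (Groupoid.inv u ≫ k ≫ w P) : orbPt X x₀ ⟶ orbPt X x₀), ?_⟩
    change End.asHom g = Groupoid.inv (Groupoid.inv (Groupoid.inv u ≫ k ≫ w P)) ≫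
      (Groupoid.inv (w P) ≫ End.asHom (τ.e P) ≫ w P) ≫
        Groupoid.inv (Groupoid.inv u ≫ k ≫ w P)
    rw [hc] at hk
    rw [← cancel_epi u, ← cancel_mono (Groupoid.inv u), ← cancel_mono k]
    simpa using hk

end FoldedTriangulation

end OrbSurface

namespace OrbSurface

variable {S : Type*} [TopologicalSpace S] [ChartedSpace (EuclideanHalfSpace 2) S]
  {X : MarkedSurface S}

/-! ### From paths between the points near the punctures to group elements -/

namespace FoldedTriangulation

variable {τ : FoldedTriangulation X} {x₀ : X.Punctured}
  (w : ∀ P : X.punctures, τ.pt P ⟶ orbPt X x₀)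

/-- The element of the group at `x₀` which corresponds to a path between the points `P'`. -/
noncomputable def groupElt (W : TaggedPath τ) : OrbGroup X x₀ :=
  Groupoid.inv (w W.source) ≫ W.hom ≫ w W.target

theorem groupElt_inv (W : TaggedPath τ) : groupElt w W.inv = (groupElt w W)⁻¹ := by
  change Groupoid.inv (w W.target) ≫ Groupoid.inv W.hom ≫ w W.source =
    Groupoid.inv (Groupoid.inv (w W.source) ≫ W.hom ≫ w W.target)
  simp

theorem conjEnd_e_pow (P : X.punctures) (n : ℕ) : conjEnd (w P) (τ.e P ^ n) = τ.s w P ^ n :=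
  map_pow _ _ _

/-- Transport to `x₀` turns the loops `e_P` into the reflections `s_P`, so that comparing tagged
paths becomes a problem in the orbifold group. -/
theorem groupElt_tagged (a : X.punctures × X.punctures × OrbGroup X x₀) (ε₁ ε₂ : ZMod 2) :
    groupElt w (τ.tagged w a ε₁ ε₂) =
      τ.s w a.1 ^ ε₁.val * a.2.2 * τ.s w a.2.1 ^ ε₂.val := by
  rw [← conjEnd_e_pow, ← conjEnd_e_pow]
  change Groupoid.inv (w a.2.1) ≫ (End.asHom (τ.e a.2.1 ^ ε₂.val) ≫ w a.2.1 ≫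
    End.asHom a.2.2 ≫ Groupoid.inv (w a.1) ≫ End.asHom (τ.e a.1 ^ ε₁.val)) ≫ w a.1 =
      (Groupoid.inv (w a.2.1) ≫ End.asHom (τ.e a.2.1 ^ ε₂.val) ≫ w a.2.1) ≫ End.asHom a.2.2 ≫
        Groupoid.inv (w a.1) ≫ End.asHom (τ.e a.1 ^ ε₁.val) ≫ w a.1
  simp only [Category.assoc]

theorem groupElt_sq {W : TaggedPath τ} (h : W.SqEqOne) :
    W.source = W.target ∧ groupElt w W * groupElt w W = 1 := by
  obtain ⟨P, f, rfl, hf⟩ := h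
  refine ⟨rfl, ?_⟩
  let g : End (τ.pt P) := f
  have hg : g * g = 1 := hf
  change conjEnd (w P) g * conjEnd (w P) g = 1
  rw [← map_mul, hg, map_one]

theorem tagged_sq_ne_one {a : X.punctures × X.punctures × OrbGroup X x₀}
    (ha : IsPrimitive (τ.link w a)) (ε₁ ε₂ : ZMod 2) : ¬ (τ.tagged w a ε₁ ε₂).SqEqOne := by
  intro h
  obtain ⟨h1, h2⟩ := groupElt_sq w h
  rw [groupElt_tagged] at h2
  obtain ⟨p, q, v⟩ := a
  obtain rfl : q = p := h1
  exact IsReflectionSystem.tag_sq_ne_one ha (IsReflectionSystem.pow_val_mem _ _)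
    (IsReflectionSystem.pow_val_mem _ _) h2

variable [T2Space S]

theorem exists_loop_of_reversibleClass [ConnectedSpace S] (τ : FoldedTriangulation X)
    (x₀ : X.Punctured) (c : ReversibleClass X) :
    ∃ γ : OrbGroup X x₀, c.1 = freeClass γ ∧ IsPrimitive γ ∧ freeClass γ = freeClass γ⁻¹ := by
  obtain ⟨c, x, γ, rfl, h1, h2⟩ := c
  obtain ⟨f⟩ := τ.nonempty_orbPt_hom x x₀
  refine ⟨conjEnd f γ, (freeClass_conjEnd f γ).symm, h1.map _, ?_⟩
  rw [← map_inv, freeClass_conjEnd, freeClass_conjEnd, h2]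

theorem exists_link {γ : OrbGroup X x₀} (h1 : IsPrimitive γ) (h2 : freeClass γ = freeClass γ⁻¹) :
    ∃ a, freeClass γ = freeClass (τ.link w a) := by
  obtain ⟨h, hh⟩ := freeClass_eq_iff_conj.1 h2
  obtain ⟨a, k, hk⟩ := (τ.isReflectionSystem w).exists_link h1 (g := h⁻¹) (by
    calc h⁻¹ * γ * h⁻¹⁻¹ = h⁻¹ * (h * γ⁻¹ * h⁻¹) * h⁻¹⁻¹ := by rw [← hh]
      _ = γ⁻¹ := by group)
  exact ⟨a, freeClass_eq_iff_conj.2 ⟨k, hk⟩⟩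

theorem link_iff {γ : OrbGroup X x₀} (h1 : IsPrimitive γ)
    {a b : X.punctures × X.punctures × OrbGroup X x₀} (ha : freeClass γ = freeClass (τ.link w a)) :
    freeClass γ = freeClass (τ.link w b) ↔ Relation.EqvGen (τ.Move w) a b := by
  rw [ha, freeClass_eq_iff_conj]
  constructor
  · rintro ⟨h, hh⟩
    exact (τ.isReflectionSystem w).eqvGen_of_conj (isPrimitive_of_freeClass_eq ha h1) hh
  · intro h
    obtain ⟨k, hk⟩ := (τ.isReflectionSystem w).link_of_eqvGen h
    refine ⟨k⁻¹, ?_⟩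
    change reflLink (τ.s w) a = k⁻¹ * reflLink (τ.s w) b * k⁻¹⁻¹
    rw [hk]
    group

theorem tagged_injective {a : X.punctures × X.punctures × OrbGroup X x₀}
    (ha : IsPrimitive (τ.link w a)) {ε₁ ε₂ ε₁' ε₂' : ZMod 2}
    (h : groupElt w (τ.tagged w a ε₁ ε₂) = groupElt w (τ.tagged w a ε₁' ε₂')) :
    ε₁ = ε₁' ∧ ε₂ = ε₂' := by
  have hs := τ.isReflectionSystem w
  rw [groupElt_tagged, groupElt_tagged] at h
  have hm := fun (P : X.punctures) (ε : ZMod 2) =>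
    IsReflectionSystem.pow_val_mem (s := τ.s w) P ε
  obtain ⟨h1, h2⟩ := hs.tag_injective (x := (τ.s w a.1 ^ ε₁'.val)⁻¹ * τ.s w a.1 ^ ε₁.val)
    (y := τ.s w a.2.1 ^ ε₂.val * (τ.s w a.2.1 ^ ε₂'.val)⁻¹) ha
    (hs.mul_mem_of_mem (hs.inv_mem (hm _ _)) (hm _ _))
    (hs.mul_mem_of_mem (hm _ _) (hs.inv_mem (hm _ _))) (by
      rw [mul_assoc (_)⁻¹, mul_assoc (_)⁻¹, ← mul_assoc _ _ (_)⁻¹, h]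
      group)
  exact ⟨hs.pow_val_injective _ (inv_mul_eq_one.1 h1).symm,
    hs.pow_val_injective _ (mul_inv_eq_one.1 h2)⟩

theorem tagged_ne_inv {a : X.punctures × X.punctures × OrbGroup X x₀}
    (ha : IsPrimitive (τ.link w a)) {ε₁ ε₂ ε₁' ε₂' : ZMod 2} (h0 : a.1 = a.2.1) :
    groupElt w (τ.tagged w a ε₁ ε₂) ≠ (groupElt w (τ.tagged w a ε₁' ε₂'))⁻¹ := by
  intro h
  have hs := τ.isReflectionSystem w
  rw [groupElt_tagged, groupElt_tagged] at h
  obtain ⟨p, q, v⟩ := a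
  obtain rfl : p = q := h0
  have hm := fun (ε : ZMod 2) => IsReflectionSystem.pow_val_mem (s := τ.s w) p ε
  refine hs.tag_ne_inv (x := τ.s w p ^ ε₂'.val * τ.s w p ^ ε₁.val)
    (y := τ.s w p ^ ε₂.val * τ.s w p ^ ε₁'.val) ha (hs.mul_mem_of_mem (hm _) (hm _))
    (hs.mul_mem_of_mem (hm _) (hm _)) ?_
  have h' : τ.s w p ^ ε₁.val * v * τ.s w p ^ ε₂.val =
    (τ.s w p ^ ε₁'.val * v * τ.s w p ^ ε₂'.val)⁻¹ := h
  calc _ = τ.s w p ^ ε₂'.val * (τ.s w p ^ ε₁.val * v * τ.s w p ^ ε₂.val) * τ.s w p ^ ε₁'.val := by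
        simp only [mul_assoc]
    _ = _ := by
      rw [h']
      group

/-- Two paths with the same pair are equal or inverse to each other, and in both cases the links are
conjugate. The alternative is recorded because it is needed to recover the signs. -/
theorem eq_of_tagged_pair_eq {a b : X.punctures × X.punctures × OrbGroup X x₀}
    {ε₁ ε₂ ε₁' ε₂' : ZMod 2} (h : ({τ.tagged w a ε₁ ε₂, (τ.tagged w a ε₁ ε₂).inv} : Set _) =
      {τ.tagged w b ε₁' ε₂', (τ.tagged w b ε₁' ε₂').inv}) :
    freeClass (τ.link w a) = freeClass (τ.link w b) ∧
      (groupElt w (τ.tagged w a ε₁ ε₂) = groupElt w (τ.tagged w b ε₁' ε₂') ∨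
        a.1 = b.2.1 ∧
          groupElt w (τ.tagged w a ε₁ ε₂) = (groupElt w (τ.tagged w b ε₁' ε₂'))⁻¹) := by
  have hs := τ.isReflectionSystem w
  have hm := fun (P : X.punctures) (ε : ZMod 2) =>
    IsReflectionSystem.pow_val_mem (s := τ.s w) P ε
  rw [freeClass_eq_iff_conj]
  rcases h.le (Set.mem_insert _ _) with h1 | h1
  · have h2 := congrArg (groupElt w) h1
    refine ⟨?_, .inl h2⟩
    rw [groupElt_tagged, groupElt_tagged] at h2
    exact IsReflectionSystem.link_conj_of_tag_eq (hm _ _) (hm _ _) (hm _ _) (hm _ _)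
      (congrArg TaggedPath.target h1) (congrArg TaggedPath.source h1) h2
  · rw [Set.mem_singleton_iff] at h1
    have h2 := (congrArg (groupElt w) h1).trans (groupElt_inv w _)
    refine ⟨?_, .inr ⟨congrArg TaggedPath.target h1, h2⟩⟩
    rw [groupElt_tagged, groupElt_tagged] at h2
    exact hs.link_conj_of_tag_eq_inv (hm _ _) (hm _ _) (hm _ _) (hm _ _)
      (congrArg TaggedPath.target h1) (congrArg TaggedPath.source h1) h2

end FoldedTriangulation

end OrbSurface
theorem mainTheorem11 {S : Type*} [TopologicalSpace S] [T2Space S] [CompactSpace S]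
    [ConnectedSpace S] [ChartedSpace (EuclideanHalfSpace 2) S]
    (X : MarkedSurface S) (τ : FoldedTriangulation X)
    (x₀ : X.Punctured) (w : ∀ P : X.punctures, τ.pt P ⟶ orbPt X x₀) :
    (∀ γ : OrbGroup X x₀, IsPrimitive γ → freeClass γ = freeClass γ⁻¹ →
      (∃ (P Q : X.punctures) (v : OrbGroup X x₀),
        freeClass γ = freeClass (τ.s w P * v * τ.s w Q * v⁻¹)) ∧
      (∀ a b : X.punctures × X.punctures × OrbGroup X x₀,
        freeClass γ = freeClass (τ.link w a) →
          (freeClass γ = freeClass (τ.link w b) ↔ Relation.EqvGen (τ.Move w) a b))) ∧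
    (∃ t : ReversibleClass X → X.punctures × X.punctures × OrbGroup X x₀,
      ∀ c, c.1 = freeClass (τ.link w (t c))) ∧
    (∀ t : ReversibleClass X → X.punctures × X.punctures × OrbGroup X x₀,
      (∀ c, c.1 = freeClass (τ.link w (t c))) →
        ∃ Φ : ReversibleClass X × (ZMod 2 × ZMod 2) → TaggedPair τ,
          Function.Injective Φ ∧
          ∀ c ε₁ ε₂, (Φ (c, ε₁, ε₂)).1 = {τ.tagged w (t c) ε₁ ε₂, (τ.tagged w (t c) ε₁ ε₂).inv}) := by
  refine ⟨fun γ h1 h2 => ⟨?_, fun a b ha => FoldedTriangulation.link_iff w h1 ha⟩, ?_,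
    fun t ht => ?_⟩
  · obtain ⟨⟨P, Q, v⟩, h⟩ := FoldedTriangulation.exists_link w h1 h2
    exact ⟨P, Q, v, h⟩
  · have h : ∀ c : ReversibleClass X, ∃ a, c.1 = freeClass (τ.link w a) := fun c => by
      obtain ⟨γ, h0, h1, h2⟩ := FoldedTriangulation.exists_loop_of_reversibleClass τ x₀ c
      rw [h0]
      exact FoldedTriangulation.exists_link w h1 h2
    choose t ht using h
    exact ⟨t, ht⟩
  -- Every class has a primitive representative at `x₀` by connectedness, and primitivity passes to
  -- the conjugate link.
  · have hprim : ∀ c, IsPrimitive (τ.link w (t c)) := fun c => by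
      obtain ⟨γ, h0, h1, -⟩ := FoldedTriangulation.exists_loop_of_reversibleClass τ x₀ c
      exact isPrimitive_of_freeClass_eq (h0.symm.trans (ht c)) h1
    refine ⟨fun a => ⟨_, τ.tagged w (t a.1) a.2.1 a.2.2, rfl,
      FoldedTriangulation.tagged_sq_ne_one w (hprim a.1) _ _⟩, ?_, fun _ _ _ => rfl⟩
    rintro ⟨c, ε₁, ε₂⟩ ⟨c', ε₁', ε₂'⟩ h
    obtain ⟨h1, h2⟩ := FoldedTriangulation.eq_of_tagged_pair_eq w (congrArg Subtype.val h)
    obtain rfl : c = c' := Subtype.ext ((ht c).trans (h1.trans (ht c').symm))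
    -- The triple is now the same on both sides. Equal paths give equal signs; inverse paths would
    -- have coinciding ends, which `tagged_ne_inv` excludes.
    rcases h2 with h2 | ⟨h2, h3⟩
    · obtain ⟨rfl, rfl⟩ := FoldedTriangulation.tagged_injective w (hprim c) h2
      rfl
    · exact absurd h3 (FoldedTriangulation.tagged_ne_inv w (hprim c) h2)
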